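/- Let $0<\lambda<\Lambda$ and $\tilde N_-=\frac{\Lambda}{\lambda}+1$ (so $\tilde N_->2$). For a real symmetric matrix $A$ with eigenvalues $\mu_i$ (with multiplicity) put $\mathcal M^-_{\lambda,\Lambda}(A)=\lambda\sum_{\mu_i>0}\mu_i+\Lambda\sum_{\mu_i<0}\mu_i$. For $R>0$ let $B_R\subset\mathbb R^2$ be the open ball of radius $R$ centred at the origin, and for $p\in\mathbb R$ consider the problem $$-\mathcal M^-_{\lambda,\Lambda}(D^2u)=u^p,\quad u>0\quad\text{in } B_R,\qquad u=0\quad\text{on }\partial B_R, \tag{1}$$ where a solution is a function $u\in C^2(B_R)\cap C(\overline{B_R})$ (not assumed radial) satisfying (1) pointwise. For $p\in\mathbb R$ consider also, in the first quadrant $X>0$, $Z>0$, the autonomous system $$(\dot X,\dot Z)=\begin{cases}\big(X(X+\tfrac Z\Lambda),\ Z(2-pX-\tfrac Z\Lambda)\big), & Z\ge\Lambda,\\[2pt] \big(X(X-(\tilde N_--2)+\tfrac Z\lambda),\ Z(\tilde N_--pX-\tfrac Z\lambda)\big), & 0<Z<\Lambda,\end{cases}\tag{2}$$ whose right-hand side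 is continuous. A periodic orbit of (2) is a nonconstant periodic solution $(X,Z):\mathbb R\to(0,\infty)^2$. Define $$\tilde p_-=\inf\Big\{p>\tfrac{\tilde N_-+2}{\tilde N_--2}\ :\ \text{for every } p'>p \text{ the system (2) with exponent } p' \text{ has no periodic orbit}\Big\}.$$ Then the set in this definition is nonempty, so that $\tilde p_-$ is a real number, and for every $R>0$: 1. for every $p>\tilde p_-$ problem (1) has no solution; 2. the set $\mathcal C=\{p>1 : \text{problem (1) has a solution}\}$ is nonempty and bounded above, so that the critical exponent $p_-^*=\sup\mathcal C$ is finite, and $p_-^*\le\tilde p_-$. -/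

import Mathlib

noncomputable section

namespace PucciLaneEmden

/-- The plane with its Euclidean norm. -/
abbrev Plane : Type := EuclideanSpace ℝ (Fin 2)

/-- Pucci's minimal operator: `lam` times the sum of the positive eigenvalues plus `Lam` times
the sum of the negative ones. The roots of the characteristic polynomial are the eigenvalues,
with multiplicity (all eigenvalues of a symmetric real matrix are real). -/
def pucciMinus (lam Lam : ℝ) {n : ℕ} (A : Matrix (Fin n) (Fin n) ℝ) : ℝ :=
  (A.charpoly.roots.map (fun μ : ℝ => if 0 < μ then lam * μ else Lam * μ)).sum

/-- The Hessian matrix `D²u(x)`. -/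
def hessian (u : Plane → ℝ) (x : Plane) : Matrix (Fin 2) (Fin 2) ℝ :=
  Matrix.of fun i j =>
    fderiv ℝ (fderiv ℝ u) x (EuclideanSpace.single i 1) (EuclideanSpace.single j 1)

/-- `u` is a classical solution, `C²` in the open ball and continuous on its closure, of
`-M⁻(D²u) = u ^ p`, `u > 0` in `B_R`, `u = 0` on `∂B_R`. No symmetry of `u` is assumed. -/
structure IsBallSolution (lam Lam p R : ℝ) (u : Plane → ℝ) : Prop where
  contDiffOn : ContDiffOn ℝ 2 u (Metric.ball 0 R)
  continuousOn : ContinuousOn u (Metric.closedBall 0 R)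
  equation : ∀ x ∈ Metric.ball (0 : Plane) R, -pucciMinus lam Lam (hessian u x) = u x ^ p
  pos : ∀ x ∈ Metric.ball (0 : Plane) R, 0 < u x
  boundary : ∀ x ∈ Metric.sphere (0 : Plane) R, u x = 0

/-- The dimension-like number `(Lam / lam) (N - 1) + 1` for `N = 2`. -/
def dimMinus (lam Lam : ℝ) : ℝ := Lam / lam * (2 - 1) + 1

/-- First component of the vector field. The two formulas agree on the line `Z = Lam`, which
separates the regions `Z > Lam` and `0 < Z < Lam`. -/
def fieldX (lam Lam X Z : ℝ) : ℝ :=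
  if Lam ≤ Z then X * (X + Z / Lam) else X * (X - (dimMinus lam Lam - 2) + Z / lam)

/-- Second component of the vector field; again the two formulas agree on `Z = Lam`. -/
def fieldZ (lam Lam p X Z : ℝ) : ℝ :=
  if Lam ≤ Z then Z * (2 - p * X - Z / Lam) else Z * (dimMinus lam Lam - p * X - Z / lam)

/-- The planar system has a periodic orbit: a nonconstant periodic solution, defined for all
times, with values in the open first quadrant. -/
def HasPeriodicOrbit (lam Lam p : ℝ) : Prop :=
  ∃ X Z : ℝ → ℝ,
    (∀ t, 0 < X t ∧ 0 < Z t) ∧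
    (∀ t, HasDerivAt X (fieldX lam Lam (X t) (Z t)) t) ∧
    (∀ t, HasDerivAt Z (fieldZ lam Lam p (X t) (Z t)) t) ∧
    (∃ T > 0, ∀ t, X (t + T) = X t ∧ Z (t + T) = Z t) ∧
    (∃ s t, X s ≠ X t ∨ Z s ≠ Z t)

/-- The exponents `p > (Ñ + 2) / (Ñ - 2)` such that no `p' > p` admits a periodic orbit. -/
def noPeriodicSet (lam Lam : ℝ) : Set ℝ :=
  {p | (dimMinus lam Lam + 2) / (dimMinus lam Lam - 2) < p ∧
    ∀ p' > p, ¬ HasPeriodicOrbit lam Lam p'}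

/-- The exponent `p̃₋`. -/
def pTilde (lam Lam : ℝ) : ℝ := sInf (noPeriodicSet lam Lam)

/-- The exponents `p > 1` for which the Dirichlet problem in `B_R` has a solution. -/
def solvableSet (lam Lam R : ℝ) : Set ℝ :=
  {p | 1 < p ∧ ∃ u : Plane → ℝ, IsBallSolution lam Lam p R u}

/-- The critical exponent `p₋*`. -/
def criticalExponent (lam Lam R : ℝ) : ℝ := sSup (solvableSet lam Lam R)

end PucciLaneEmden

end

/-! A solution in the ball is radial, hence follows a planar orbit, and for `p > (Ñ + 2)/(Ñ - 2)`
the presence of such an orbit forces a periodic orbit at the same exponent. So no exponent above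
`pTilde` is solvable.

Symmetry. `M⁻` is superadditive and invariant under orthogonal maps, so the difference between the
reflected solution and the solution satisfies a one-sided Pucci inequality. A strong minimum
principle and a maximum principle in suitable caps then run the method of moving planes
(`reflect_le`, `radial`, `antitone_on_ray`).

Dynamics. Put `t = log r`, `x = -r u'/u`, `s = log (r² u^(p-1))` and `N = Lam/lam - 1 = Ñ - 2`. The
radial equation becomes `s' = 2 - (p-1) x`, `x' = x² + min (e^s/Lam) (e^s/lam - N x)`, and `X = x`,
`Z = e^s/x` turn it into system (2). The orbit of a solution comes from `x = 0`, `s = -∞`, and it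
must reach `x = N` before `r = R`: otherwise `log u` would stay bounded below up to the boundary,
where `u = 0`. Let `(s₀, al)` be the stationary point. Orbits starting on the line `x = al`, above
`s₀` and below the last passage of the regular orbit, are confined in backward time by the regular
orbit and return to this line after one turn. The return map is monotone. Near `s₀` it does not move
points inwards, because an energy is nonincreasing along forward orbits when `p` is supercritical;
its values stay away from the upper end, because orbits near the last arc run past `x = N`. A
supremum argument gives a fixed point, that is, a periodic orbit (`IsBlowup.hasPeriodicOrbit`).

Finiteness of `pTilde`. The weight `X^(-B) Z^(B-1)` with `B = 2/(p+1)` is a Dulac function for large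
`p`; a Lyapunov function built from it excludes periodic orbits (`not_hasPeriodicOrbit_of_large`).

Solvability for some exponent. For `p = 1 + 1/N` the radial profile shot from the origin reaches
zero at a finite radius, and scaling moves that radius to `R` (`exists_isBallSolution`). -/

noncomputable section
namespace PucciLaneEmden
open Filter Topology

/-! ### Algebra of Pucci's operator in the plane, and pointwise Hessians. -/

/-- The scalar profile of Pucci's minimal operator. -/
def pucciWeight (lam Lam m : ℝ) : ℝ := if 0 < m then lam * m else Lam * m

theorem pucciWeight_of_nonneg {lam Lam m : ℝ} (h : 0 ≤ m) : pucciWeight lam Lam m = lam * m := by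
  unfold pucciWeight
  split_ifs with h1
  · rfl
  · have : m = 0 := le_antisymm (not_lt.1 h1) h
    simp [this]

theorem pucciWeight_of_nonpos {lam Lam m : ℝ} (h : m ≤ 0) : pucciWeight lam Lam m = Lam * m := by
  simp [pucciWeight, not_lt.2 h]

theorem pucciWeight_eq_abs (lam Lam m : ℝ) :
    pucciWeight lam Lam m = (lam + Lam) / 2 * m - (Lam - lam) / 2 * |m| := by
  rcases le_total 0 m with h | h
  · rw [pucciWeight_of_nonneg h, abs_of_nonneg h]; ring
  · rw [pucciWeight_of_nonpos h, abs_of_nonpos h]; ring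

theorem pucciWeight_mul {lam Lam c : ℝ} (m : ℝ) (hc : 0 ≤ c) :
    pucciWeight lam Lam (c * m) = c * pucciWeight lam Lam m := by
  rw [pucciWeight_eq_abs, pucciWeight_eq_abs, abs_mul, abs_of_nonneg hc]; ring

/-- Trace and determinant fix the characteristic polynomial of a 2×2 matrix, so any real pair with
the right sum and product is its pair of eigenvalues. -/
theorem pucciMinus_eq_of_charpoly {lam Lam m₁ m₂ : ℝ} {A : Matrix (Fin 2) (Fin 2) ℝ}
    (htr : A.trace = m₁ + m₂) (hdet : A.det = m₁ * m₂) :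
    pucciMinus lam Lam A = pucciWeight lam Lam m₁ + pucciWeight lam Lam m₂ := by
  have h : A.charpoly = (Polynomial.X - Polynomial.C m₁) * (Polynomial.X - Polynomial.C m₂) := by
    rw [Matrix.charpoly_fin_two, htr, hdet, Polynomial.C_add, Polynomial.C_mul]; ring
  have h2 : A.charpoly.roots = {m₁} + {m₂} := by
    rw [h, Polynomial.roots_mul
      (mul_ne_zero (Polynomial.X_sub_C_ne_zero _) (Polynomial.X_sub_C_ne_zero _)),
      Polynomial.roots_X_sub_C, Polynomial.roots_X_sub_C]
  rw [pucciMinus, h2]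
  simp [pucciWeight]

/-- With `T` the trace and `D` the square root, the eigenvalues are `(T ± D)/2`, and `|T + D| + |T -
D| = 2 max |T| D`. For `lam ≤ Lam` this displays the operator as a linear function minus a convex
one. -/
theorem pucciMinus_eq_max {lam Lam : ℝ} {A : Matrix (Fin 2) (Fin 2) ℝ} (hA : A 0 1 = A 1 0) :
    pucciMinus lam Lam A = (lam + Lam) / 2 * (A 0 0 + A 1 1) -
      (Lam - lam) / 2 * max |A 0 0 + A 1 1| (Real.sqrt ((A 0 0 - A 1 1) ^ 2 + (2 * A 0 1) ^ 2)) := by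
  set T := A 0 0 + A 1 1
  set D := Real.sqrt ((A 0 0 - A 1 1) ^ 2 + (2 * A 0 1) ^ 2) with hD
  have hD0 : 0 ≤ D := Real.sqrt_nonneg _
  have hD2 : D ^ 2 = (A 0 0 - A 1 1) ^ 2 + (2 * A 0 1) ^ 2 := Real.sq_sqrt (by positivity)
  rw [pucciMinus_eq_of_charpoly (m₁ := (T + D) / 2) (m₂ := (T - D) / 2)
    (by rw [Matrix.trace_fin_two]; simp only [T]; ring)
    (by
      rw [Matrix.det_fin_two, ← hA]
      simp only [T]
      linear_combination (1 / 4) * hD2), pucciWeight_eq_abs, pucciWeight_eq_abs]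
  have key : |(T + D) / 2| + |(T - D) / 2| = max |T| D := by
    rcases le_total 0 T with h | h
    · rw [abs_of_nonneg (by linarith : 0 ≤ (T + D) / 2), abs_of_nonneg h]
      rcases le_total T D with h2 | h2
      · rw [abs_of_nonpos (by linarith), max_eq_right h2]; ring
      · rw [abs_of_nonneg (by linarith), max_eq_left h2]; ring
    · rw [abs_of_nonpos (by linarith : (T - D) / 2 ≤ 0), abs_of_nonpos h]
      rcases le_total (-T) D with h2 | h2
      · rw [abs_of_nonneg (by linarith), max_eq_right h2]; ring
      · rw [abs_of_nonpos (by linarith), max_eq_left h2]; ring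
  rw [← key]; ring

theorem sqrt_sq_add_sq_add_le (a b c d : ℝ) :
    Real.sqrt ((a + c) ^ 2 + (b + d) ^ 2) ≤
      Real.sqrt (a ^ 2 + b ^ 2) + Real.sqrt (c ^ 2 + d ^ 2) := by
  have h := norm_add_le (⟨a, b⟩ : ℂ) ⟨c, d⟩
  simpa [Complex.norm_def, Complex.normSq_apply, sq] using h

/-- Continuous bilinear forms on the plane. -/
abbrev BilinForm₂ : Type := Plane →L[ℝ] Plane →L[ℝ] ℝ

/-- The matrix of a bilinear form in the standard basis. -/
def formMatrix (B : BilinForm₂) : Matrix (Fin 2) (Fin 2) ℝ :=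
  Matrix.of fun i j => B (EuclideanSpace.single i 1) (EuclideanSpace.single j 1)

/-- Pucci's minimal operator on bilinear forms. -/
def pucciForm (lam Lam : ℝ) (B : BilinForm₂) : ℝ := pucciMinus lam Lam (formMatrix B)

theorem pucciMinus_hessian (lam Lam : ℝ) (u : Plane → ℝ) (x : Plane) :
    pucciMinus lam Lam (hessian u x) = pucciForm lam Lam (fderiv ℝ (fderiv ℝ u) x) := rfl

/-- The maximum of `|T|` and `D` is subadditive in the matrix entries. This is the substitute for
linearity: used with `B - C` and `C`, it bounds the operator at a difference by the difference of
its values. -/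
theorem pucciForm_add_le {lam Lam : ℝ} (hL : lam ≤ Lam) {B C : BilinForm₂}
    (hB : ∀ v w, B v w = B w v) (hC : ∀ v w, C v w = C w v) :
    pucciForm lam Lam B + pucciForm lam Lam C ≤ pucciForm lam Lam (B + C) := by
  unfold pucciForm
  rw [pucciMinus_eq_max (hB _ _), pucciMinus_eq_max (hC _ _),
    pucciMinus_eq_max (A := formMatrix (B + C)) (by simp [formMatrix, hB _ (EuclideanSpace.single 0 1),
      hC _ (EuclideanSpace.single 0 1)])]
  set b := formMatrix B
  set c := formMatrix C
  have hadd : ∀ i j, formMatrix (B + C) i j = b i j + c i j := fun i j => by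
    simp [formMatrix, b, c]
  simp only [hadd]
  have h1 : max |b 0 0 + c 0 0 + (b 1 1 + c 1 1)|
      (Real.sqrt ((b 0 0 + c 0 0 - (b 1 1 + c 1 1)) ^ 2 + (2 * (b 0 1 + c 0 1)) ^ 2)) ≤
      max |b 0 0 + b 1 1| (Real.sqrt ((b 0 0 - b 1 1) ^ 2 + (2 * b 0 1) ^ 2)) +
      max |c 0 0 + c 1 1| (Real.sqrt ((c 0 0 - c 1 1) ^ 2 + (2 * c 0 1) ^ 2)) := by
    apply max_le
    · calc _ = |(b 0 0 + b 1 1) + (c 0 0 + c 1 1)| := by congr 1; ring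
        _ ≤ _ := abs_add_le _ _
        _ ≤ _ := add_le_add (le_max_left _ _) (le_max_left _ _)
    · have := sqrt_sq_add_sq_add_le (b 0 0 - b 1 1) (2 * b 0 1) (c 0 0 - c 1 1) (2 * c 0 1)
      calc _ = Real.sqrt (((b 0 0 - b 1 1) + (c 0 0 - c 1 1)) ^ 2 + (2 * b 0 1 + 2 * c 0 1) ^ 2) := by
            congr 1; ring
        _ ≤ _ := this
        _ ≤ _ := add_le_add (le_max_right _ _) (le_max_right _ _)
  nlinarith [mul_le_mul_of_nonneg_left h1 (by linarith : 0 ≤ (Lam - lam) / 2)]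

/-- A positive semidefinite form has `D ≤ T`, and the formula with the maximum collapses to `lam *
T`. Together with superadditivity this gives monotonicity of the operator. -/
theorem pucciForm_nonneg {lam Lam : ℝ} (hl : 0 ≤ lam) {B : BilinForm₂}
    (hB : ∀ v w, B v w = B w v) (hpos : ∀ v, 0 ≤ B v v) : 0 ≤ pucciForm lam Lam B := by
  unfold pucciForm
  rw [pucciMinus_eq_max (hB _ _)]
  set a := formMatrix B 0 0 with ha
  set d := formMatrix B 1 1 with hd
  set b := formMatrix B 0 1 with hb
  have hq : ∀ s t : ℝ, 0 ≤ a * s ^ 2 + 2 * b * s * t + d * t ^ 2 := by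
    intro s t
    have h := hpos (s • EuclideanSpace.single 0 1 + t • EuclideanSpace.single 1 1)
    simp only [map_add, map_smul, add_apply, smul_apply,
      smul_eq_mul] at h
    rw [hB (EuclideanSpace.single 1 1) (EuclideanSpace.single 0 1)] at h
    simp only [ha, hb, hd, formMatrix, Matrix.of_apply]
    linarith
  have ha0 : 0 ≤ a := by simpa using hq 1 0
  have hd0 : 0 ≤ d := by simpa using hq 0 1
  have hdet : b ^ 2 ≤ a * d := by
    have := discrim_le_zero (a := a) (b := 2 * b) (c := d) (fun x => by
      have := hq x 1; simp only [one_pow, mul_one] at this; nlinarith)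
    unfold discrim at this; nlinarith
  have hs : Real.sqrt ((a - d) ^ 2 + (2 * b) ^ 2) ≤ a + d := by
    apply Real.sqrt_le_iff.2 ⟨by linarith, by nlinarith⟩
  rw [abs_of_nonneg (by linarith : 0 ≤ a + d), max_eq_left hs]
  nlinarith

/-- The inner product of the plane as a bilinear form. -/
def dotForm : BilinForm₂ := innerSL ℝ

theorem dotForm_apply (v w : Plane) : dotForm v w = inner ℝ v w := rfl

/-- The bilinear form `a x ⊗ x + b I`. -/
def rankOneForm (a b : ℝ) (x : Plane) : BilinForm₂ :=
  a • (innerSL ℝ x).smulRight (innerSL ℝ x) + b • dotForm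

theorem rankOneForm_apply (a b : ℝ) (x v w : Plane) :
    rankOneForm a b x v w = a * (inner ℝ x v * inner ℝ x w) + b * inner ℝ v w := by
  simp [rankOneForm, dotForm_apply]

/-- The direction of `x` and its normal are eigendirections. Every barrier and every radial function
below has a Hessian of this shape. -/
theorem pucciForm_rankOne (lam Lam a b : ℝ) (x : Plane) :
    pucciForm lam Lam (rankOneForm a b x) =
      pucciWeight lam Lam (a * ‖x‖ ^ 2 + b) + pucciWeight lam Lam b := by
  have hx : ‖x‖ ^ 2 = x 0 ^ 2 + x 1 ^ 2 := by
    rw [EuclideanSpace.norm_sq_eq]; simp [Fin.sum_univ_two]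
  unfold pucciForm
  apply pucciMinus_eq_of_charpoly
  · rw [Matrix.trace_fin_two]
    simp [formMatrix, rankOneForm_apply, EuclideanSpace.inner_single_right, hx]
    ring
  · rw [Matrix.det_fin_two]
    simp [formMatrix, rankOneForm_apply, EuclideanSpace.inner_single_right, hx]
    ring

/-- The pull-back of a bilinear form by a linear map. -/
def pullForm (B : BilinForm₂) (A : Plane →L[ℝ] Plane) : BilinForm₂ :=
  (ContinuousLinearMap.precomp ℝ A).comp (B.comp A)

theorem pullForm_apply (B : BilinForm₂) (A : Plane →L[ℝ] Plane) (v w : Plane) :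
    pullForm B A v w = B (A v) (A w) := rfl

theorem plane_eq_sum (v : Plane) :
    v = v 0 • EuclideanSpace.single 0 (1 : ℝ) + v 1 • EuclideanSpace.single 1 (1 : ℝ) := by
  ext i; fin_cases i <;> simp

/-- The matrix `M` of `A` is orthogonal, so `Mᵀ B M` has the trace and determinant of `B`. Hence a
reflected solution solves the same equation. -/
theorem pucciForm_pullForm (lam Lam : ℝ) (B : BilinForm₂) (A : Plane →L[ℝ] Plane)
    (hA : ∀ v w, inner ℝ (A v) (A w) = inner ℝ v w) :
    pucciForm lam Lam (pullForm B A) = pucciForm lam Lam B := by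
  set M : Matrix (Fin 2) (Fin 2) ℝ := Matrix.of fun i j => A (EuclideanSpace.single j 1) i with hM
  have hMM : M.transpose * M = 1 := by
    ext i j
    have h := hA (EuclideanSpace.single i 1) (EuclideanSpace.single j 1)
    rw [PiLp.inner_apply] at h
    simp only [Fin.sum_univ_two, EuclideanSpace.inner_single_left] at h
    simp only [Matrix.mul_apply, Fin.sum_univ_two, hM, Matrix.transpose_apply, Matrix.of_apply]
    simp at h
    rw [Matrix.one_apply]
    fin_cases i <;> fin_cases j <;> simp at h ⊢ <;> linarith
  have hpull : formMatrix (pullForm B A) = M.transpose * formMatrix B * M := by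
    ext i j
    simp only [formMatrix, Matrix.of_apply, pullForm_apply]
    rw [plane_eq_sum (A (EuclideanSpace.single i 1)), plane_eq_sum (A (EuclideanSpace.single j 1))]
    simp only [map_add, map_smul, add_apply, smul_apply,
      smul_eq_mul, Matrix.mul_apply, Fin.sum_univ_two, Matrix.transpose_apply, Matrix.of_apply, hM]
    ring
  have hMM' : M * M.transpose = 1 := mul_eq_one_comm.1 hMM
  have hc : (formMatrix (pullForm B A)).charpoly = (formMatrix B).charpoly := by
    rw [Matrix.charpoly_fin_two, Matrix.charpoly_fin_two, hpull, Matrix.trace_mul_comm,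
      ← Matrix.mul_assoc, hMM', Matrix.one_mul, Matrix.det_mul, Matrix.det_mul]
    have hd : M.transpose.det * M.det = 1 := by rw [← Matrix.det_mul, hMM, Matrix.det_one]
    rw [show M.transpose.det * (formMatrix B).det * M.det = (formMatrix B).det by
      linear_combination (formMatrix B).det * hd]
  simp only [pucciForm, pucciMinus, hc]

/-- `f` is differentiable near `x` and its derivative has derivative `B` at `x`. -/
def HasHessAt (f : Plane → ℝ) (B : BilinForm₂) (x : Plane) : Prop :=
  ∃ f' : Plane → Plane →L[ℝ] ℝ, (∀ᶠ y in 𝓝 x, HasFDerivAt f (f' y) y) ∧ HasFDerivAt f' B x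

namespace HasHessAt
variable {f g : Plane → ℝ} {B C : BilinForm₂} {x : Plane}

theorem fderiv_eq (h : HasHessAt f B x) : fderiv ℝ (fderiv ℝ f) x = B := by
  obtain ⟨f', h1, h2⟩ := h
  have : fderiv ℝ f =ᶠ[𝓝 x] f' := h1.mono fun y hy => hy.fderiv
  rw [this.fderiv_eq, h2.fderiv]

theorem pucciMinus_hessian (h : HasHessAt f B x) (lam Lam : ℝ) :
    pucciMinus lam Lam (hessian f x) = pucciForm lam Lam B := by
  rw [PucciLaneEmden.pucciMinus_hessian, h.fderiv_eq]

theorem symm (h : HasHessAt f B x) (v w : Plane) : B v w = B w v := by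
  obtain ⟨f', h1, h2⟩ := h
  exact second_derivative_symmetric_of_eventually_of_real h1 h2 v w

theorem congr (h : HasHessAt f B x) (hfg : g =ᶠ[𝓝 x] f) : HasHessAt g B x := by
  obtain ⟨f', h1, h2⟩ := h
  refine ⟨f', ?_, h2⟩
  filter_upwards [h1, hfg.eventuallyEq_nhds] with y hy hy2
  exact hy.congr_of_eventuallyEq hy2

theorem add (hf : HasHessAt f B x) (hg : HasHessAt g C x) :
    HasHessAt (fun y => f y + g y) (B + C) x := by
  obtain ⟨f', h1, h2⟩ := hf
  obtain ⟨g', h3, h4⟩ := hg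
  exact ⟨fun y => f' y + g' y, by filter_upwards [h1, h3] with y a b using a.add b, h2.add h4⟩

theorem const_mul (hf : HasHessAt f B x) (c : ℝ) : HasHessAt (fun y => c * f y) (c • B) x := by
  obtain ⟨f', h1, h2⟩ := hf
  exact ⟨fun y => c • f' y, by filter_upwards [h1] with y a using a.const_mul c, h2.const_smul c⟩

theorem sub (hf : HasHessAt f B x) (hg : HasHessAt g C x) :
    HasHessAt (fun y => f y - g y) (B - C) x := by
  have := hf.add (hg.const_mul (-1))
  simp only [neg_one_mul, ← sub_eq_add_neg] at this
  rwa [show B + (-1 : ℝ) • C = B - C by ext v w; simp [sub_eq_add_neg]] at this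

theorem comp_affine {A : Plane →L[ℝ] Plane} {c : Plane} (hf : HasHessAt f B (A x + c)) :
    HasHessAt (fun y => f (A y + c)) (pullForm B A) x := by
  obtain ⟨f', h1, h2⟩ := hf
  have hA : ∀ y, HasFDerivAt (fun y => A y + c) A y := fun y => A.hasFDerivAt.add_const c
  refine ⟨fun y => (f' (A y + c)).comp A, ?_, ?_⟩
  · have := (hA x).continuousAt.eventually h1
    filter_upwards [this] with y hy
    exact hy.comp y (hA y)
  · exact (ContinuousLinearMap.precomp ℝ A).hasFDerivAt.comp x (h2.comp x (hA x))

theorem of_contDiffAt (h : ContDiffAt ℝ 2 f x) : HasHessAt f (fderiv ℝ (fderiv ℝ f) x) x := by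
  refine ⟨fderiv ℝ f, ?_, ?_⟩
  · filter_upwards [h.eventually (by simp)] with y hy
    exact (hy.differentiableAt (by norm_num)).hasFDerivAt
  · have : ContDiffAt ℝ 1 (fderiv ℝ f) x := h.fderiv_right (by norm_num)
    exact (this.differentiableAt (by norm_num)).hasFDerivAt

/-- Composition of a linear form with a scalar function. -/
theorem of_linear {k k₁ : ℝ → ℝ} {k₂ : ℝ} {e : Plane}
    (h1 : ∀ᶠ s in 𝓝 (inner ℝ e x), HasDerivAt k (k₁ s) s)
    (h2 : HasDerivAt k₁ k₂ (inner ℝ e x)) :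
    HasHessAt (fun y => k (inner ℝ e y)) (rankOneForm k₂ 0 e) x := by
  have hin : ∀ y, HasFDerivAt (fun y => inner ℝ e y) (innerSL ℝ e) y := fun y =>
    (innerSL ℝ e).hasFDerivAt
  refine ⟨fun y => k₁ (inner ℝ e y) • innerSL ℝ e, ?_, ?_⟩
  · have := (hin x).continuousAt.eventually h1
    filter_upwards [this] with y hy
    exact hy.comp_hasFDerivAt y (hin y)
  · have := (h2.comp_hasFDerivAt x (hin x)).smul_const (innerSL ℝ e)
    refine this.congr_fderiv ?_
    ext v w
    simp [rankOneForm_apply, mul_assoc]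

/-- Composition of the squared distance to `z` with a scalar function. -/
theorem of_normSq {k k₁ : ℝ → ℝ} {k₂ : ℝ} (z : Plane)
    (h1 : ∀ᶠ s in 𝓝 (‖x - z‖ ^ 2), HasDerivAt k (k₁ s) s)
    (h2 : HasDerivAt k₁ k₂ (‖x - z‖ ^ 2)) :
    HasHessAt (fun y => k (‖y - z‖ ^ 2))
      (rankOneForm (4 * k₂) (2 * k₁ (‖x - z‖ ^ 2)) (x - z)) x := by
  have hin : ∀ y, HasFDerivAt (fun y : Plane => ‖y - z‖ ^ 2) ((2 : ℝ) • dotForm (y - z)) y := by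
    intro y
    have := (((hasFDerivAt_id (𝕜 := ℝ) y).sub_const z)).norm_sq
    refine this.congr_fderiv ?_
    ext v
    simp [dotForm_apply]
  have hl : HasFDerivAt (fun y : Plane => (2 : ℝ) • dotForm (y - z)) ((2 : ℝ) • dotForm) x :=
    (dotForm.hasFDerivAt.comp x ((hasFDerivAt_id (𝕜 := ℝ) x).sub_const z)).const_smul (2 : ℝ)
  refine ⟨fun y => k₁ (‖y - z‖ ^ 2) • ((2 : ℝ) • dotForm (y - z)), ?_, ?_⟩
  · have := (hin x).continuousAt.eventually h1
    filter_upwards [this] with y hy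
    exact hy.comp_hasFDerivAt y (hin y)
  · have := (h2.comp_hasFDerivAt x (hin x)).smul hl
    refine this.congr_fderiv ?_
    ext v w
    simp only [add_apply, smul_apply, ContinuousLinearMap.smulRight_apply, Function.comp_apply,
      dotForm_apply, rankOneForm_apply, smul_eq_mul]
    ring

theorem nonneg_of_isLocalMin (h : HasHessAt f B x) (hm : IsLocalMin f x) (v : Plane) :
    0 ≤ B v v := by
  obtain ⟨f', h1, h2⟩ := h
  have hl : ∀ t : ℝ, HasDerivAt (fun t : ℝ => x + t • v) v t := fun t => by
    simpa using ((hasDerivAt_id t).smul_const v).const_add x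
  have hl0 : Tendsto (fun t : ℝ => x + t • v) (𝓝 0) (𝓝 x) := by
    simpa using (hl 0).continuousAt.tendsto
  set k : ℝ → ℝ := fun t => f (x + t • v)
  have hk1 : ∀ᶠ t in 𝓝 (0 : ℝ), HasDerivAt k (f' (x + t • v) v) t := by
    filter_upwards [hl0.eventually h1] with t ht
    exact ht.comp_hasDerivAt t (hl t)
  have hkm : IsLocalMin k 0 := by
    have := hl0.eventually hm
    filter_upwards [this] with t ht
    simpa [k] using ht
  have hk2 : HasDerivAt (deriv k) (B v v) 0 := by
    have hd : deriv k =ᶠ[𝓝 0] fun t => f' (x + t • v) v := hk1.mono fun t ht => ht.deriv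
    apply HasDerivAt.congr_of_eventuallyEq _ hd
    have h2' : HasFDerivAt f' B (x + (0 : ℝ) • v) := by simpa using h2
    exact (ContinuousLinearMap.apply ℝ ℝ v).hasFDerivAt.comp_hasDerivAt (0 : ℝ)
      (h2'.comp_hasDerivAt (0 : ℝ) (hl 0))
  by_contra hneg
  push Not at hneg
  have hd0 : deriv k 0 = 0 := hkm.deriv_eq_zero
  -- A negative second derivative would make `0` a local maximum besides a local minimum; `k` would
  -- then be locally constant and its second derivative zero.
  have hmax := isLocalMax_of_deriv_deriv_neg (f := k) (x₀ := 0) (by rwa [hk2.deriv]) hd0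
    hk1.self_of_nhds.continuousAt
  have hconst : k =ᶠ[𝓝 0] fun _ => k 0 := by
    filter_upwards [hkm, hmax] with t a b using le_antisymm b a
  have : deriv k =ᶠ[𝓝 0] fun _ => 0 := by
    filter_upwards [hconst.eventuallyEq_nhds] with t ht
    rw [ht.deriv_eq]; simp
  have h0 := this.deriv_eq
  rw [hk2.deriv] at h0
  simp at h0
  linarith

end HasHessAt
end PucciLaneEmden
end

/-! ### Strong minimum principle, reflections, and the maximum principle in caps. -/

noncomputable section
namespace PucciLaneEmden
open Filter Topology Set

theorem form_add_sub_cancel (B C : BilinForm₂) : C + (B - C) = B := by ext v w; simp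

theorem form_sub_add_cancel (B C : BilinForm₂) : B - C + C = B := by ext v w; simp

theorem pucciForm_mono {lam Lam : ℝ} (hl : 0 ≤ lam) (hL : lam ≤ Lam) {B C : BilinForm₂}
    (hB : ∀ v w, B v w = B w v) (hC : ∀ v w, C v w = C w v) (h : ∀ v, C v v ≤ B v v) :
    pucciForm lam Lam C ≤ pucciForm lam Lam B := by
  have hs : ∀ v w, (B - C) v w = (B - C) w v := fun v w => by simp [hB v w, hC v w]
  have h1 := pucciForm_add_le hL hC hs
  have h2 := pucciForm_nonneg (Lam := Lam) hl hs (fun v => by simpa using h v)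
  rw [form_add_sub_cancel] at h1
  linarith

/-- If `f` touches `g` from above at `x`, their Hessians are ordered. -/
theorem pucciForm_le_of_touching {lam Lam : ℝ} (hl : 0 ≤ lam) (hL : lam ≤ Lam) {f g : Plane → ℝ}
    {B C : BilinForm₂} {x : Plane} (hf : HasHessAt f B x) (hg : HasHessAt g C x)
    (hm : IsLocalMin (fun y => f y - g y) x) : pucciForm lam Lam C ≤ pucciForm lam Lam B :=
  pucciForm_mono hl hL hf.symm hg.symm fun v => by
    simpa using (hf.sub hg).nonneg_of_isLocalMin hm v

/-- A nonnegative supersolution positive on a ball is positive on larger concentric balls. -/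
theorem pos_of_pos_on_closedBall {lam Lam : ℝ} (hl : 0 < lam) (hL : lam < Lam) {f : Plane → ℝ}
    {B : Plane → BilinForm₂} {z : Plane} {r r' : ℝ} (hr : 0 < r) (hrr : r < r')
    (hf0 : ∀ x ∈ Metric.closedBall z r', 0 ≤ f x)
    (hB : ∀ x ∈ Metric.closedBall z r', HasHessAt f (B x) x)
    (hP : ∀ x ∈ Metric.closedBall z r', pucciForm lam Lam (B x) ≤ 0)
    (hc : ContinuousOn f (Metric.closedBall z r'))
    (hpos : ∀ x ∈ Metric.closedBall z r, 0 < f x) : ∀ x ∈ Metric.ball z r', 0 < f x := by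
  obtain ⟨x₁, hx₁, hmin⟩ := (isCompact_closedBall z r).exists_isMinOn
    (Metric.nonempty_closedBall.2 hr.le) (hc.mono (Metric.closedBall_subset_closedBall hrr.le))
  set m := f x₁
  have hm : 0 < m := hpos x₁ hx₁
  -- This rate makes the Hopf barrier `h` a strict subsolution outside the small ball: there `lam *
  -- a * ‖x - z‖ ^ 2 > lam + Lam`, so the positive radial eigenvalue outweighs the negative
  -- tangential one.
  set a := (lam + Lam) / (lam * r ^ 2) with ha
  have hL0 : 0 < Lam := hl.trans hL
  have ha0 : 0 < a := by positivity
  set h : Plane → ℝ := fun x => m * (Real.exp (-a * ‖x - z‖ ^ 2) - Real.exp (-a * r' ^ 2)) with hh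
  have hhH : ∀ x, HasHessAt h (rankOneForm (4 * (m * (a ^ 2 * Real.exp (-a * ‖x - z‖ ^ 2))))
      (2 * (m * (-a * Real.exp (-a * ‖x - z‖ ^ 2)))) (x - z)) x := by
    intro x
    have hd : ∀ s : ℝ, HasDerivAt (fun s : ℝ => Real.exp (-a * s)) (-a * Real.exp (-a * s)) s :=
      fun s => by
        have := ((hasDerivAt_id s).const_mul (-a)).exp
        simpa [mul_comm] using this
    refine HasHessAt.of_normSq (k := fun s => m * (Real.exp (-a * s) - Real.exp (-a * r' ^ 2)))
      (k₁ := fun s => m * (-a * Real.exp (-a * s))) z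
      (Eventually.of_forall fun s => ((hd s).sub_const _).const_mul m) ?_
    have := ((hd (‖x - z‖ ^ 2)).const_mul (-a)).const_mul m
    exact this.congr_deriv (by ring)
  -- A negative minimum of `f - h` is not on the outer sphere, where `h = 0`, nor in the inner ball,
  -- where `h ≤ m ≤ f`. In the annulus a strict subsolution would touch the supersolution `f`, which
  -- ellipticity forbids.
  have hcomp : ∀ x ∈ Metric.closedBall z r', 0 ≤ f x - h x := by
    obtain ⟨x₀, hx₀, hmin₀⟩ := (isCompact_closedBall z r').exists_isMinOn
      (Metric.nonempty_closedBall.2 (hr.le.trans hrr.le))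
      (hc.sub (f := f) (g := h) (by simp only [hh]; fun_prop))
    by_contra hneg
    push Not at hneg
    obtain ⟨x, hx, hxn⟩ := hneg
    have hx₀n : f x₀ - h x₀ < 0 := lt_of_le_of_lt (hmin₀ hx) hxn
    have hout : ‖x₀ - z‖ < r' := by
      rcases lt_or_eq_of_le (mem_closedBall_iff_norm.1 hx₀) with h1 | h1
      · exact h1
      · have : h x₀ = 0 := by simp [hh, h1]
        have := hf0 x₀ hx₀
        linarith
    have hin : r < ‖x₀ - z‖ := by
      by_contra hle
      have h1 : x₀ ∈ Metric.closedBall z r := mem_closedBall_iff_norm.2 (not_lt.1 hle)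
      have h2 : m ≤ f x₀ := hmin h1
      have h3 : h x₀ ≤ m * 1 := by
        apply mul_le_mul_of_nonneg_left _ hm.le
        have e1 : Real.exp (-a * ‖x₀ - z‖ ^ 2) ≤ 1 := Real.exp_le_one_iff.2 (by
          have := mul_nonneg ha0.le (sq_nonneg ‖x₀ - z‖); linarith)
        have := Real.exp_pos (-a * r' ^ 2)
        linarith
      linarith
    have hloc : IsLocalMin (fun y => f y - h y) x₀ :=
      hmin₀.isLocalMin (Filter.mem_of_superset (Metric.isOpen_ball.mem_nhds
        (mem_ball_iff_norm.2 hout)) Metric.ball_subset_closedBall)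
    have h1 := pucciForm_le_of_touching hl.le hL.le (hB x₀ hx₀) (hhH x₀) hloc
    have h2 := hP x₀ hx₀
    rw [pucciForm_rankOne] at h1
    set E := Real.exp (-a * ‖x₀ - z‖ ^ 2)
    have hE : 0 < E := Real.exp_pos _
    have has : lam + Lam < lam * a * ‖x₀ - z‖ ^ 2 := by
      have e1 : lam * a * r ^ 2 = lam + Lam := by rw [ha]; field_simp
      rw [← e1]
      exact mul_lt_mul_of_pos_left (by gcongr) (by positivity)
    have hmE : 0 < m * (a * E) := by positivity
    have e2 : 4 * (m * (a ^ 2 * E)) * ‖x₀ - z‖ ^ 2 + 2 * (m * (-a * E))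
      = (m * (a * E)) * (4 * (a * ‖x₀ - z‖ ^ 2) - 2) := by ring
    have h1a : 1 ≤ a * ‖x₀ - z‖ ^ 2 := by
      by_contra hlt
      push Not at hlt
      nlinarith
    rw [e2, pucciWeight_of_nonneg (mul_nonneg hmE.le (by linarith)),
      pucciWeight_of_nonpos (by linarith)] at h1
    have : 0 < (m * (a * E)) * (4 * (lam * a * ‖x₀ - z‖ ^ 2) - 2 * lam - 2 * Lam) :=
      mul_pos hmE (by linarith)
    linarith
  intro x hx
  have h1 := hcomp x (Metric.ball_subset_closedBall hx)
  have h2 : 0 < h x := by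
    apply mul_pos hm
    have : ‖x - z‖ < r' := mem_ball_iff_norm.1 hx
    have h3 : ‖x - z‖ ^ 2 < r' ^ 2 := by gcongr
    have : Real.exp (-a * r' ^ 2) < Real.exp (-a * ‖x - z‖ ^ 2) := Real.exp_lt_exp.2 (by nlinarith)
    linarith
  linarith

/-- Strong minimum principle. -/
theorem strong_minimum_principle {lam Lam : ℝ} (hl : 0 < lam) (hL : lam < Lam) {f : Plane → ℝ}
    {B : Plane → BilinForm₂} {Om : Set Plane} (hO : IsOpen Om) (hcon : IsPreconnected Om)
    (hf0 : ∀ x ∈ Om, 0 ≤ f x) (hB : ∀ x ∈ Om, HasHessAt f (B x) x)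
    (hP : ∀ x ∈ Om, pucciForm lam Lam (B x) ≤ 0) (hc : ContinuousOn f Om)
    (hne : ∃ x ∈ Om, 0 < f x) : ∀ x ∈ Om, 0 < f x := by
  set V : Set Plane := Om ∩ f ⁻¹' (Ioi 0)
  have hV : IsOpen V := hc.isOpen_inter_preimage hO isOpen_Ioi
  -- The positivity set is relatively closed: near a point `y` of its closure there is `z` in it at
  -- distance less than `d / 4`, and positivity on a tiny ball around `z` spreads to the ball of
  -- radius `d / 2`, which contains `y`.
  have hsub : Om ⊆ V := by
    apply hcon.subset_of_closure_inter_subset hV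
    · obtain ⟨x, hx, hxp⟩ := hne
      exact ⟨x, hx, hx, hxp⟩
    · rintro y ⟨hy, hyO⟩
      obtain ⟨d, hd, hdO⟩ := Metric.isOpen_iff.1 hO y hyO
      obtain ⟨z, hzV, hzd⟩ := Metric.mem_closure_iff.1 hy (d / 4) (by linarith)
      obtain ⟨r, hr, hrV⟩ := Metric.isOpen_iff.1 hV z hzV
      have hbig : Metric.closedBall z (d / 2) ⊆ Om := by
        intro x hx
        apply hdO
        rw [Metric.mem_ball]
        calc dist x y ≤ dist x z + dist z y := dist_triangle _ _ _
          _ < d := by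
            have := Metric.mem_closedBall.1 hx
            rw [dist_comm z y]; linarith
      have hs : Metric.closedBall z (min (r / 2) (d / 4)) ⊆ V := by
        refine Subset.trans ?_ hrV
        apply (Metric.closedBall_subset_closedBall (min_le_left _ _)).trans
        exact Metric.closedBall_subset_ball (by linarith)
      refine ⟨hyO, ?_⟩
      refine pos_of_pos_on_closedBall hl hL (r := min (r / 2) (d / 4)) (r' := d / 2) (B := B)
        (lt_min (by linarith) (by linarith)) ((min_le_right _ _).trans_lt (by linarith))
        (fun x hx => hf0 x (hbig hx)) (fun x hx => hB x (hbig hx)) (fun x hx => hP x (hbig hx))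
        (hc.mono hbig) (fun x hx => (hs hx).2) y ?_
      rw [Metric.mem_ball]; linarith
  exact fun x hx => (hsub hx).2

/-- Reflection across the line `⟪e, x⟫ = μ`. -/
def reflectLine (e : Plane) (μ : ℝ) (x : Plane) : Plane := x + (2 * (μ - inner ℝ e x)) • e

/-- The linear part of `reflectLine`. -/
def reflectLin (e : Plane) : Plane →L[ℝ] Plane :=
  ContinuousLinearMap.id ℝ Plane - (2 : ℝ) • (innerSL ℝ e).smulRight e

theorem reflectLine_eq (e : Plane) (μ : ℝ) (x : Plane) :
    reflectLine e μ x = reflectLin e x + (2 * μ) • e := by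
  simp only [reflectLine, reflectLin, sub_apply, smul_apply, ContinuousLinearMap.smulRight_apply,
    ContinuousLinearMap.id_apply, innerSL_apply_apply]
  module

theorem continuous_reflectLine (e : Plane) (μ : ℝ) : Continuous (reflectLine e μ) := by
  unfold reflectLine; fun_prop

theorem inner_reflectLin {e : Plane} (he : ‖e‖ = 1) (v w : Plane) :
    inner ℝ (reflectLin e v) (reflectLin e w) = inner ℝ v w := by
  have h1 : inner ℝ e e = (1 : ℝ) := by rw [real_inner_self_eq_norm_sq, he]; norm_num
  simp only [reflectLin, sub_apply, smul_apply, ContinuousLinearMap.smulRight_apply,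
    ContinuousLinearMap.id_apply, innerSL_apply_apply, inner_sub_left, inner_sub_right,
    inner_smul_left, inner_smul_right, h1, real_inner_comm e v]
  simp
  ring

theorem norm_reflectLine_sq {e : Plane} (he : ‖e‖ = 1) (μ : ℝ) (x : Plane) :
    ‖reflectLine e μ x‖ ^ 2 = ‖x‖ ^ 2 - 4 * μ * (inner ℝ e x - μ) := by
  unfold reflectLine
  rw [norm_add_sq_real, norm_smul, he, inner_smul_right, real_inner_comm e x, Real.norm_eq_abs,
    mul_one, sq_abs]
  ring

theorem norm_reflectLine_le {e : Plane} (he : ‖e‖ = 1) {μ : ℝ} (hμ : 0 ≤ μ) {x : Plane}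
    (hx : μ ≤ inner ℝ e x) : ‖reflectLine e μ x‖ ≤ ‖x‖ := by
  have := norm_reflectLine_sq he μ x
  have h2 : 0 ≤ 4 * μ * (inner ℝ e x - μ) := by apply mul_nonneg <;> linarith
  exact (pow_le_pow_iff_left₀ (norm_nonneg _) (norm_nonneg _) two_ne_zero).1 (by linarith)

theorem reflectLine_of_mem {e : Plane} {μ : ℝ} {x : Plane} (hx : inner ℝ e x = μ) :
    reflectLine e μ x = x := by simp [reflectLine, hx]

/-- Bernoulli's inequality at `y / x`, that is, the tangent line of the convex power at `x`. -/
theorem rpow_sub_rpow_le {p x y : ℝ} (hp : 1 ≤ p) (hx : 0 < x) (hy : 0 ≤ y) :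
    x ^ p - y ^ p ≤ p * x ^ (p - 1) * (x - y) := by
  have h := one_add_mul_self_le_rpow_one_add (s := y / x - 1) (by
    have : 0 ≤ y / x := by positivity
    linarith) hp
  rw [add_sub_cancel, Real.div_rpow hy hx.le, le_div_iff₀ (by positivity)] at h
  have h2 : x ^ p = x ^ (p - 1) * x := by
    rw [← Real.rpow_add_one hx.ne', sub_add_cancel]
  have h3 : (1 + p * (y / x - 1)) * x ^ p = x ^ p + p * x ^ (p - 1) * (y - x) := by
    rw [h2]; field_simp
  rw [h3] at h
  linarith

namespace IsBallSolution
variable {lam Lam p R : ℝ} {u : Plane → ℝ}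

theorem nonneg (hu : IsBallSolution lam Lam p R u) {x : Plane} (hx : ‖x‖ ≤ R) : 0 ≤ u x := by
  rcases lt_or_eq_of_le hx with h | h
  · exact (hu.pos x (mem_ball_zero_iff.2 h)).le
  · exact (hu.boundary x (mem_sphere_zero_iff_norm.2 h)).ge

theorem hasHessAt (hu : IsBallSolution lam Lam p R u) {x : Plane} (hx : ‖x‖ < R) :
    HasHessAt u (fderiv ℝ (fderiv ℝ u) x) x :=
  .of_contDiffAt (hu.contDiffOn.contDiffAt (Metric.isOpen_ball.mem_nhds (mem_ball_zero_iff.2 hx)))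

theorem pucciForm_eq (hu : IsBallSolution lam Lam p R u) {x : Plane} (hx : ‖x‖ < R) :
    pucciForm lam Lam (fderiv ℝ (fderiv ℝ u) x) = -u x ^ p := by
  rw [← hu.equation x (mem_ball_zero_iff.2 hx), pucciMinus_hessian, neg_neg]

/-- The Hessian of the difference between the reflected solution and the solution. -/
theorem exists_hess_reflect_sub (hu : IsBallSolution lam Lam p R u) (hL : lam ≤ Lam) {e : Plane}
    (he : ‖e‖ = 1) {μ : ℝ} {x : Plane} (hx : ‖x‖ < R) (hx' : ‖reflectLine e μ x‖ < R) :
    ∃ B, HasHessAt (fun y => u (reflectLine e μ y) - u y) B x ∧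
      pucciForm lam Lam B ≤ u x ^ p - u (reflectLine e μ x) ^ p := by
  have h1 := hu.hasHessAt hx'
  have h1' : HasHessAt (fun y => u (reflectLine e μ y))
      (pullForm (fderiv ℝ (fderiv ℝ u) (reflectLine e μ x)) (reflectLin e)) x := by
    have hfun : (fun y => u (reflectLine e μ y)) =
        fun y => u (reflectLin e y + (2 * μ) • e) := funext fun y => by rw [reflectLine_eq]
    rw [hfun]
    rw [reflectLine_eq] at h1 ⊢
    exact h1.comp_affine
  have h2 := hu.hasHessAt hx
  refine ⟨_, h1'.sub h2, ?_⟩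
  -- Superadditivity in the form `M⁻(D²w) ≤ M⁻(D²(reflected u)) - M⁻(D²u)`.
  have h3 := pucciForm_add_le hL (h1'.sub h2).symm h2.symm
  rw [form_sub_add_cancel, pucciForm_pullForm _ _ _ _ (inner_reflectLin he), hu.pucciForm_eq hx,
    hu.pucciForm_eq hx'] at h3
  linarith

theorem continuousOn_reflect_sub (hu : IsBallSolution lam Lam p R u) {e : Plane}
    (he : ‖e‖ = 1) {μ : ℝ} (hμ : 0 ≤ μ) :
    ContinuousOn (fun y => u (reflectLine e μ y) - u y) {x | ‖x‖ ≤ R ∧ μ ≤ inner ℝ e x} := by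
  apply ContinuousOn.sub
  · refine hu.continuousOn.comp (continuous_reflectLine e μ).continuousOn ?_
    rintro x ⟨hx, hx2⟩
    exact mem_closedBall_zero_iff.2 ((norm_reflectLine_le he hμ hx2).trans hx)
  · exact hu.continuousOn.mono fun x hx => mem_closedBall_zero_iff.2 hx.1

theorem isOpen_lt_inner (e : Plane) (μ : ℝ) : IsOpen {y : Plane | μ < inner ℝ e y} :=
  isOpen_lt continuous_const (by fun_prop)

theorem isCompact_cap (e : Plane) (μ R : ℝ) :
    IsCompact {x : Plane | ‖x‖ ≤ R ∧ μ ≤ inner ℝ e x} := by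
  have : {x : Plane | ‖x‖ ≤ R ∧ μ ≤ inner ℝ e x} =
      Metric.closedBall 0 R ∩ {x | μ ≤ inner ℝ e x} := by ext; simp
  rw [this]
  exact (isCompact_closedBall _ _).inter_right (isClosed_le continuous_const (by fun_prop))

/-- Maximum principle in caps where the zero order coefficient is small against a concave
barrier. -/
theorem reflect_sub_nonneg_of_small (hu : IsBallSolution lam Lam p R u) (hl : 0 < lam)
    (hL : lam < Lam) (hp : 1 < p) {e : Plane} (he : ‖e‖ = 1) {μ b : ℝ} (hμ : 0 ≤ μ) (hb : 0 < b)
    (hsmall : ∀ x, ‖x‖ < R → μ < inner ℝ e x → u (reflectLine e μ x) < u x →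
      2 * p * u x ^ (p - 1) < lam * b ^ 2 * Real.exp (-b * (inner ℝ e x - μ)))
    {x : Plane} (hx : ‖x‖ ≤ R) (hxe : μ ≤ inner ℝ e x) : u x ≤ u (reflectLine e μ x) := by
  by_contra hlt
  push Not at hlt
  set w : Plane → ℝ := fun y => u (reflectLine e μ y) - u y with hw
  -- A concave barrier with values in `[1, 2]` on the cap. At a negative minimum of `w / φ`, equal
  -- to `-t`, the convex function `-t * φ` touches `w` from below.
  set φ : Plane → ℝ := fun y => 2 - Real.exp (-b * (inner ℝ e y - μ)) with hφ
  set K : Set Plane := {x | ‖x‖ ≤ R ∧ μ ≤ inner ℝ e x} with hK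
  have hφ1 : ∀ y ∈ K, 1 ≤ φ y := by
    rintro y ⟨-, hy⟩
    have : Real.exp (-b * (inner ℝ e y - μ)) ≤ 1 := Real.exp_le_one_iff.2 (by nlinarith)
    simp only [hφ]; linarith
  have hφc : Continuous φ := by simp only [hφ]; fun_prop
  obtain ⟨x₀, hx₀, hmin⟩ := (isCompact_cap e μ R).exists_isMinOn ⟨x, hx, hxe⟩
    ((hu.continuousOn_reflect_sub he hμ).div hφc.continuousOn
      (fun y hy => (lt_of_lt_of_le one_pos (hφ1 y hy)).ne'))
  have hq : w x₀ / φ x₀ < 0 := by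
    refine lt_of_le_of_lt (hmin (show x ∈ K from ⟨hx, hxe⟩)) ?_
    exact div_neg_of_neg_of_pos (by linarith)
      (lt_of_lt_of_le one_pos (hφ1 x ⟨hx, hxe⟩))
  set t := -(w x₀ / φ x₀) with ht
  have ht0 : 0 < t := by linarith
  have hφ0 : 0 < φ x₀ := lt_of_lt_of_le one_pos (hφ1 x₀ hx₀)
  have hwx : w x₀ = -t * φ x₀ := by rw [ht]; field_simp
  have hwneg : w x₀ < 0 := by rw [hwx]; nlinarith
  have hge : ∀ y ∈ K, 0 ≤ w y - (-t * φ y) := by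
    intro y hy
    have h1 : w x₀ / φ x₀ ≤ w y / φ y := hmin hy
    have h2 : 0 < φ y := lt_of_lt_of_le one_pos (hφ1 y hy)
    rw [le_div_iff₀ h2] at h1
    rw [ht]; linarith
  have hxe₀ : μ < inner ℝ e x₀ := by
    rcases lt_or_eq_of_le hx₀.2 with h | h
    · exact h
    · simp [hw, reflectLine_of_mem h.symm] at hwneg
  have hxR : ‖x₀‖ < R := by
    rcases lt_or_eq_of_le hx₀.1 with h | h
    · exact h
    · have h1 := hu.boundary x₀ (mem_sphere_zero_iff_norm.2 h)
      have h2 := hu.nonneg ((norm_reflectLine_le he hμ hx₀.2).trans hx₀.1)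
      simp only [hw] at hwneg
      linarith
  have hKn : K ∈ 𝓝 x₀ := by
    have ho : IsOpen {y : Plane | ‖y‖ < R ∧ μ < inner ℝ e y} :=
      (isOpen_lt continuous_norm continuous_const).inter (isOpen_lt_inner e μ)
    exact mem_of_superset (ho.mem_nhds ⟨hxR, hxe₀⟩) fun y hy => ⟨hy.1.le, hy.2.le⟩
  have hloc : IsLocalMin (fun y => w y - (-t * φ y)) x₀ := by
    filter_upwards [hKn] with y hy
    have := hge y hy
    rw [hwx]; simpa using this
  obtain ⟨B, hB, hPB⟩ := hu.exists_hess_reflect_sub hL.le he hxR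
    ((norm_reflectLine_le he hμ hx₀.2).trans_lt hxR)
  set E := Real.exp (-b * (inner ℝ e x₀ - μ)) with hE
  have hE0 : 0 < E := Real.exp_pos _
  have hφH : HasHessAt (fun y => -t * φ y) (rankOneForm (t * (b ^ 2 * E)) 0 e) x₀ := by
    have hd : ∀ s : ℝ, HasDerivAt (fun s : ℝ => Real.exp (-b * (s - μ)))
        (-b * Real.exp (-b * (s - μ))) s := fun s => by
      have := (((hasDerivAt_id s).sub_const μ).const_mul (-b)).exp
      simpa [mul_comm] using this
    refine HasHessAt.of_linear (k := fun s => -t * (2 - Real.exp (-b * (s - μ))))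
      (k₁ := fun s => -t * (-(-b * Real.exp (-b * (s - μ)))))
      (Eventually.of_forall fun s => ((hd s).const_sub 2).const_mul (-t)) ?_
    have := (((hd (inner ℝ e x₀)).const_mul (-b)).neg).const_mul (-t)
    exact this.congr_deriv (by ring)
  -- The touching function contributes `lam * t * b ^ 2 * E`, whereas the equation and the tangent
  -- line bound give at most `p * u ^ (p - 1) * t * φ`, with `φ ≤ 2`. This is where the factor `2 *
  -- p` in `hsmall` comes from.
  have h1 := pucciForm_le_of_touching hl.le hL.le hB hφH hloc
  rw [pucciForm_rankOne, he, pucciWeight_of_nonneg (by positivity),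
    pucciWeight_of_nonneg le_rfl] at h1
  have hux : 0 < u x₀ := hu.pos x₀ (mem_ball_zero_iff.2 hxR)
  have h2 := rpow_sub_rpow_le (y := u (reflectLine e μ x₀)) hp.le hux
    (hu.nonneg ((norm_reflectLine_le he hμ hx₀.2).trans hx₀.1))
  have h3 := hsmall x₀ hxR hxe₀ (by simp only [hw] at hwneg; linarith)
  have h4 : u x₀ - u (reflectLine e μ x₀) = t * φ x₀ := by simp only [hw] at hwx; linarith
  rw [h4] at h2
  have h5 : φ x₀ ≤ 2 := by simp only [hφ]; linarith
  have hq0 : 0 ≤ p * u x₀ ^ (p - 1) * t := by positivity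
  have h6 : p * u x₀ ^ (p - 1) * (t * φ x₀) ≤ p * u x₀ ^ (p - 1) * t * 2 := by
    rw [← mul_assoc]; exact mul_le_mul_of_nonneg_left h5 hq0
  have h7 : t * (2 * p * u x₀ ^ (p - 1)) < t * (lam * b ^ 2 * E) := mul_lt_mul_of_pos_left h3 ht0
  linarith

end IsBallSolution
end PucciLaneEmden
end

/-! ### Moving planes and radial symmetry. -/

noncomputable section
namespace PucciLaneEmden
open Filter Topology Set

namespace IsBallSolution
variable {lam Lam p R : ℝ} {u : Plane → ℝ}

/-- The difference is a nonnegative supersolution in the convex cap, so the strong minimum principle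
applies once it is positive somewhere. This happens near `R • e`: there `u` is close to zero, while
the mirror image of `R • e` lies inside the ball. -/
theorem reflect_sub_pos (hu : IsBallSolution lam Lam p R u) (hl : 0 < lam)
    (hL : lam < Lam) (hp : 1 < p) {e : Plane} (he : ‖e‖ = 1) {μ : ℝ} (hμ : 0 < μ) (hμR : μ < R)
    (hnn : ∀ x, ‖x‖ ≤ R → μ ≤ inner ℝ e x → u x ≤ u (reflectLine e μ x)) {x : Plane}
    (hx : ‖x‖ < R) (hxe : μ < inner ℝ e x) : u x < u (reflectLine e μ x) := by
  have hR : 0 < R := hμ.trans hμR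
  set w : Plane → ℝ := fun y => u (reflectLine e μ y) - u y with hw
  set Om : Set Plane := {y | ‖y‖ < R ∧ μ < inner ℝ e y} with hOm
  have hO : IsOpen Om := (isOpen_lt continuous_norm continuous_const).inter (isOpen_lt_inner e μ)
  have hconv : Convex ℝ Om := by
    have h1 : Convex ℝ (Metric.ball (0 : Plane) R) := convex_ball _ _
    have h2 : Convex ℝ {y : Plane | μ < innerSL ℝ e y} :=
      convex_halfSpace_gt (innerSL ℝ e).toLinearMap.isLinear μ
    have : Om = Metric.ball 0 R ∩ {y : Plane | μ < innerSL ℝ e y} := by ext; simp [hOm]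
    rw [this]; exact h1.inter h2
  have hlt : ∀ y ∈ Om, ‖reflectLine e μ y‖ < R := fun y hy =>
    (norm_reflectLine_le he hμ.le hy.2.le).trans_lt hy.1
  choose! B hB hPB using fun (y : Plane) (hy : y ∈ Om) =>
    hu.exists_hess_reflect_sub hL.le he hy.1 (hlt y hy)
  have hpow : ∀ y ∈ Om, pucciForm lam Lam (B y) ≤ 0 := by
    intro y hy
    have h1 := hnn y hy.1.le hy.2.le
    have h2 := Real.rpow_le_rpow (hu.nonneg hy.1.le) h1 (by linarith : 0 ≤ p)
    linarith [hPB y hy]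
  have hne : ∃ y ∈ Om, 0 < w y := by
    have hie : inner ℝ e e = (1 : ℝ) := by rw [real_inner_self_eq_norm_sq, he]; norm_num
    have hline : ContinuousOn (fun t : ℝ => w (t • e)) (Icc μ R) := by
      refine (hu.continuousOn_reflect_sub he hμ.le).comp (by fun_prop) ?_
      intro t ht
      refine ⟨?_, ?_⟩
      · rw [norm_smul, he, mul_one, Real.norm_eq_abs, abs_of_nonneg (hμ.le.trans ht.1)]; exact ht.2
      · rw [inner_smul_right, hie, mul_one]; exact ht.1
    have hRpos : 0 < w (R • e) := by
      have hn : ‖R • e‖ = R := by rw [norm_smul, he, mul_one, Real.norm_eq_abs, abs_of_pos hR]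
      have h0 := hu.boundary (R • e) (mem_sphere_zero_iff_norm.2 hn)
      have h1 := norm_reflectLine_sq he μ (R • e)
      rw [hn, inner_smul_right, hie, mul_one] at h1
      have h2 : 0 < 4 * μ * (R - μ) := by apply mul_pos <;> linarith
      have h3 : ‖reflectLine e μ (R • e)‖ < R :=
        (pow_lt_pow_iff_left₀ (norm_nonneg _) hR.le two_ne_zero).1 (by linarith)
      have := hu.pos _ (mem_ball_zero_iff.2 h3)
      simp only [hw, h0]; linarith
    have hev : ∀ᶠ t in 𝓝[Ioo μ R] R, 0 < w (t • e) := by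
      have := (hline R ⟨hμR.le, le_rfl⟩).mono Ioo_subset_Icc_self
      exact this.eventually (lt_mem_nhds hRpos)
    have : (𝓝[Ioo μ R] R).NeBot := by
      rw [← mem_closure_iff_nhdsWithin_neBot, closure_Ioo hμR.ne]; exact ⟨hμR.le, le_rfl⟩
    obtain ⟨t, ht1, ht2⟩ := (hev.and self_mem_nhdsWithin).exists
    refine ⟨t • e, ⟨?_, ?_⟩, ht1⟩
    · rw [norm_smul, he, mul_one, Real.norm_eq_abs, abs_of_pos (hμ.trans ht2.1)]; exact ht2.2
    · rw [inner_smul_right, hie, mul_one]; exact ht2.1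
  have := strong_minimum_principle hl hL hO hconv.isPreconnected
    (fun y hy => sub_nonneg.2 (hnn y hy.1.le hy.2.le)) hB hpow
    ((hu.continuousOn_reflect_sub he hμ.le).mono fun y hy => ⟨hy.1.le, hy.2.le⟩) hne x ⟨hx, hxe⟩
  simpa [hw] using this

/-- Moving planes: narrow caps start the process, positions where the inequality holds are closed
under decreasing limits, and a positive limiting position could still be lowered by `hstep`. -/
theorem reflect_le (hu : IsBallSolution lam Lam p R u) (hl : 0 < lam)
    (hL : lam < Lam) (hp : 1 < p) (hR : 0 < R) {e : Plane} (he : ‖e‖ = 1) {μ : ℝ} (hμ : 0 ≤ μ)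
    (hμR : μ < R) {x : Plane} (hx : ‖x‖ ≤ R) (hxe : μ ≤ inner ℝ e x) :
    u x ≤ u (reflectLine e μ x) := by
  set Pos : ℝ → Prop := fun μ => ∀ x, ‖x‖ ≤ R → μ ≤ inner ℝ e x → u x ≤ u (reflectLine e μ x)
    with hPos
  have hcomp := isCompact_closedBall (0 : Plane) R
  have hinR : ∀ x : Plane, ‖x‖ ≤ R → inner ℝ e x ≤ R := fun x hx => by
    have := real_inner_le_norm e x
    rw [he, one_mul] at this; linarith
  obtain ⟨M, hM⟩ := hcomp.bddAbove_image hu.continuousOn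
  have hM' : ∀ x, ‖x‖ ≤ R → u x ≤ M := fun x hx => hM ⟨x, mem_closedBall_zero_iff.2 hx, rfl⟩
  have hM0 : 0 < M := (hu.pos 0 (by simpa using hR)).trans_le (hM' 0 (by simpa using hR.le))
  -- For this `b` the smallness condition holds at every point within `1 / b` of the reflecting
  -- line, where the exponential is at least `exp (-1)`.
  obtain ⟨b, hb, hbM⟩ : ∃ b : ℝ, 0 < b ∧ 2 * p * M ^ (p - 1) < lam * b ^ 2 * Real.exp (-1) := by
    have : Tendsto (fun b : ℝ => lam * Real.exp (-1) * b ^ 2) atTop atTop :=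
      (tendsto_pow_atTop two_ne_zero).const_mul_atTop (by positivity)
    obtain ⟨b, h1, h2⟩ := ((this.eventually_gt_atTop (2 * p * M ^ (p - 1))).and
      (eventually_gt_atTop 0)).exists
    exact ⟨b, h2, by linarith⟩
  have hup : ∀ x, ‖x‖ ≤ R → 2 * p * u x ^ (p - 1) ≤ 2 * p * M ^ (p - 1) := fun x hx => by
    have := Real.rpow_le_rpow (hu.nonneg hx) (hM' x hx) (by linarith : 0 ≤ p - 1)
    exact mul_le_mul_of_nonneg_left this (by linarith)
  have hstart : ∀ μ, 0 ≤ μ → R - 1 / b ≤ μ → Pos μ := by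
    intro μ hμ hμb x hx hxe
    refine hu.reflect_sub_nonneg_of_small hl hL hp he hμ hb ?_ hx hxe
    intro y hy hye _
    refine (hup y hy.le).trans_lt (hbM.trans_le ?_)
    refine mul_le_mul_of_nonneg_left (Real.exp_le_exp.2 ?_) (by positivity)
    have h1 : inner ℝ e y - μ ≤ 1 / b := by linarith [hinR y hy.le]
    have h2 := mul_le_mul_of_nonneg_left h1 hb.le
    rw [mul_one_div_cancel hb.ne'] at h2
    linarith
  have hstep : ∀ μ₀, 0 < μ₀ → μ₀ < R → Pos μ₀ → ∃ ε > 0, ∀ μ, 0 ≤ μ → μ₀ - ε < μ → μ ≤ μ₀ →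
      Pos μ := by
    intro μ₀ h0 h0R hP0
    -- near the sphere the solution is small
    obtain ⟨η, hη, hηs⟩ : ∃ η > 0, ∀ y : Plane, R - η < ‖y‖ → ‖y‖ ≤ R →
        2 * p * u y ^ (p - 1) < lam * b ^ 2 * Real.exp (-b * R) := by
      have huc := hcomp.uniformContinuousOn_of_continuous
        (f := fun y => 2 * p * u y ^ (p - 1)) (continuousOn_const.mul
          (hu.continuousOn.rpow_const fun y _ => Or.inr (by linarith)))
      obtain ⟨δ, hδ, hδs⟩ := Metric.uniformContinuousOn_iff.1 huc
        (lam * b ^ 2 * Real.exp (-b * R)) (by positivity)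
      refine ⟨min δ R, lt_min hδ hR, fun y hy hyR => ?_⟩
      have hy0 : 0 < ‖y‖ := by linarith [min_le_right δ R]
      set z : Plane := (R / ‖y‖) • y with hz
      have hzn : ‖z‖ = R := by
        rw [hz, norm_smul, norm_div, norm_norm, Real.norm_eq_abs, abs_of_pos hR]; field_simp
      have hyz : dist y z < δ := by
        rw [dist_eq_norm, hz, show y - (R / ‖y‖) • y = (1 - R / ‖y‖) • y by module, norm_smul,
          Real.norm_eq_abs, abs_of_nonpos (by rw [sub_nonpos, le_div_iff₀ hy0]; linarith)]
        have : -(1 - R / ‖y‖) * ‖y‖ = R - ‖y‖ := by field_simp; ring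
        rw [this]; linarith [min_le_left δ R]
      have := hδs y (mem_closedBall_zero_iff.2 hyR) z (mem_closedBall_zero_iff.2 hzn.le) hyz
      have hz0 := hu.boundary z (mem_sphere_zero_iff_norm.2 hzn)
      simp only [hz0, Real.zero_rpow (by linarith : p - 1 ≠ 0), mul_zero, Real.dist_eq,
        sub_zero] at this
      exact (le_abs_self _).trans_lt this
    -- The cap is split in three: near the sphere `u ^ (p - 1)` is small because `p > 1`; near the
    -- line the barrier suffices; on the compact set `K` the strict inequality has a margin `m` that
    -- survives a small displacement, so no negative value occurs there. The slack `1 / (2 * b)`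
    -- leaves room for the displacement within the width `1 / b`.
    set K : Set Plane := {y | ‖y‖ ≤ R - η ∧ μ₀ + 1 / (2 * b) ≤ inner ℝ e y} with hK
    have hKc : IsCompact K := isCompact_cap e _ _
    have hb2 : 0 < 1 / (2 * b) := by positivity
    obtain ⟨m, hm, hmK⟩ : ∃ m > 0, ∀ y ∈ K, m ≤ u (reflectLine e μ₀ y) - u y := by
      rcases K.eq_empty_or_nonempty with hKe | hKne
      · exact ⟨1, one_pos, by simp [hKe]⟩
      · obtain ⟨y, hy, hmin⟩ := hKc.exists_isMinOn hKne
          ((hu.continuousOn_reflect_sub he h0.le).mono fun y hy => ⟨by linarith [hy.1],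
            by linarith [hy.2]⟩)
        refine ⟨_, sub_pos.2 (hu.reflect_sub_pos hl hL hp he h0 h0R hP0 (x := y)
          (by linarith [hy.1]) (by linarith [hy.2])), fun z hz => hmin hz⟩
    obtain ⟨δ, hδ, hδs⟩ := Metric.uniformContinuousOn_iff.1
      (hcomp.uniformContinuousOn_of_continuous hu.continuousOn) m hm
    refine ⟨min (1 / (2 * b)) (δ / 2), lt_min hb2 (by linarith), fun μ hμ hμ1 hμ2 => ?_⟩
    have hε1 := min_le_left (1 / (2 * b)) (δ / 2)
    have hε2 := min_le_right (1 / (2 * b)) (δ / 2)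
    intro x hx hxe
    refine hu.reflect_sub_nonneg_of_small hl hL hp he hμ hb ?_ hx hxe
    intro y hy hye hyw
    rcases lt_or_ge (R - η) ‖y‖ with hyη | hyη
    · refine (hηs y hyη hy.le).trans_le (mul_le_mul_of_nonneg_left (Real.exp_le_exp.2 ?_)
        (by positivity))
      have : inner ℝ e y - μ ≤ R := by linarith [hinR y hy.le]
      nlinarith
    rcases lt_or_ge (inner ℝ e y) (μ₀ + 1 / (2 * b)) with hyb | hyb
    · refine (hup y hy.le).trans_lt (hbM.trans_le ?_)
      refine mul_le_mul_of_nonneg_left (Real.exp_le_exp.2 ?_) (by positivity)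
      have h1 : inner ℝ e y - μ ≤ 1 / b := by
        have : 1 / b = 1 / (2 * b) + 1 / (2 * b) := by field_simp; norm_num
        linarith
      have h2 := mul_le_mul_of_nonneg_left h1 hb.le
      rw [mul_one_div_cancel hb.ne'] at h2
      linarith
    · exfalso
      have hyK : y ∈ K := ⟨hyη, hyb⟩
      have h1 := hmK y hyK
      have hd : dist (reflectLine e μ y) (reflectLine e μ₀ y) < δ := by
        rw [dist_eq_norm, reflectLine, reflectLine,
          show y + (2 * (μ - inner ℝ e y)) • e - (y + (2 * (μ₀ - inner ℝ e y)) • e) =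
            (2 * (μ - μ₀)) • e by module, norm_smul, he, mul_one, Real.norm_eq_abs,
          abs_of_nonpos (by linarith)]
        linarith
      have h2 := hδs _ (mem_closedBall_zero_iff.2 ((norm_reflectLine_le he hμ hye.le).trans hy.le))
        _ (mem_closedBall_zero_iff.2 ((norm_reflectLine_le he h0.le (by linarith)).trans hy.le)) hd
      rw [Real.dist_eq] at h2
      have := (abs_lt.1 h2).1
      linarith
  have hclosed : ∀ m, 0 ≤ m → m < R → (∀ μ, m < μ → μ < R → Pos μ) → Pos m := by
    intro m hm hmR hP x hx hxe
    rcases lt_or_eq_of_le hxe with h | h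
    · have hc : ContinuousWithinAt (fun μ => u (reflectLine e μ x)) (Ioo m (inner ℝ e x)) m := by
        have h1 := hu.continuousOn (reflectLine e m x)
          (mem_closedBall_zero_iff.2 ((norm_reflectLine_le he hm hxe).trans hx))
        refine ContinuousWithinAt.comp (f := fun μ => reflectLine e μ x) h1 ?_ ?_
        · unfold reflectLine; fun_prop
        · intro μ hμ
          exact mem_closedBall_zero_iff.2
            ((norm_reflectLine_le he (hm.trans hμ.1.le) hμ.2.le).trans hx)
      have : (𝓝[Ioo m (inner ℝ e x)] m).NeBot := by
        rw [← mem_closure_iff_nhdsWithin_neBot, closure_Ioo h.ne]; exact ⟨le_rfl, h.le⟩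
      refine ge_of_tendsto hc ?_
      filter_upwards [self_mem_nhdsWithin] with μ hμ
      exact hP μ hμ.1 (hμ.2.trans_le (hinR x hx)) x hx hμ.2.le
    · rw [reflectLine_of_mem h.symm]
  set S : Set ℝ := {m | 0 ≤ m ∧ m < R ∧ ∀ μ, m < μ → μ < R → Pos μ} with hS
  have hSne : S.Nonempty := by
    refine ⟨max 0 (R - 1 / b), le_max_left _ _, max_lt hR (by
      have : 0 < 1 / b := by positivity
      linarith), fun μ h1 _ => hstart μ ((le_max_left _ _).trans h1.le)
        ((le_max_right _ _).trans h1.le)⟩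
  have hSb : BddBelow S := ⟨0, fun m hm => hm.1⟩
  set m := sInf S with hm
  have hm0 : 0 ≤ m := le_csInf hSne fun x hx => hx.1
  have hmR : m < R := by
    obtain ⟨y, hy⟩ := hSne
    exact (csInf_le hSb hy).trans_lt hy.2.1
  have hPm : ∀ μ, m < μ → μ < R → Pos μ := by
    intro μ h1 h2
    obtain ⟨y, hy, hyμ⟩ := exists_lt_of_csInf_lt hSne h1
    exact hy.2.2 μ hyμ h2
  have hPm' := hclosed m hm0 hmR hPm
  have hmz : m = 0 := by
    by_contra hne
    have hmp : 0 < m := lt_of_le_of_ne hm0 (Ne.symm hne)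
    obtain ⟨ε, hε, hεP⟩ := hstep m hmp hmR hPm'
    have : max 0 (m - ε) ∈ S := by
      refine ⟨le_max_left _ _, max_lt hR (by linarith), fun μ h1 h2 => ?_⟩
      rcases lt_or_ge m μ with h | h
      · exact hPm μ h h2
      · exact hεP μ ((le_max_left _ _).trans h1.le) ((le_max_right _ _).trans_lt h1) h
    have := csInf_le hSb this
    have h3 : max 0 (m - ε) < m := max_lt hmp (by linarith)
    linarith
  have hfin : Pos μ := by
    rcases lt_or_eq_of_le hμ with h | h
    · exact hPm μ (by rw [hmz]; exact h) hμR
    · rw [← h, ← hmz]; exact hPm'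
  exact hfin x hx hxe

/-- Symmetry of positive solutions in a ball. -/
theorem radial (hu : IsBallSolution lam Lam p R u) (hl : 0 < lam) (hL : lam < Lam) (hp : 1 < p)
    (hR : 0 < R) {x y : Plane} (hx : ‖x‖ ≤ R) (hxy : ‖x‖ = ‖y‖) : u x = u y := by
  have key : ∀ x y : Plane, ‖x‖ ≤ R → ‖x‖ = ‖y‖ → u x ≤ u y := by
    intro x y hx hxy
    rcases eq_or_ne x y with rfl | hne
    · exact le_rfl
    have hd : 0 < ‖x - y‖ := norm_pos_iff.2 (sub_ne_zero.2 hne)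
    -- Since the norms agree, reflection in the line through the origin normal to `x - y` exchanges
    -- `x` and `y`.
    set e : Plane := (‖x - y‖)⁻¹ • (x - y) with he
    have he1 : ‖e‖ = 1 := by rw [he, norm_smul, norm_inv, norm_norm]; field_simp
    have h1 : inner ℝ (x - y) x = ‖x - y‖ ^ 2 / 2 := by
      rw [norm_sub_sq_real, inner_sub_left, real_inner_self_eq_norm_sq, real_inner_comm, ← hxy]; ring
    have h2 : inner ℝ e x = ‖x - y‖ / 2 := by
      rw [he, real_inner_smul_left, h1]; field_simp
    have h3 : reflectLine e 0 x = y := by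
      rw [reflectLine, h2, he, smul_smul,
        show 2 * (0 - ‖x - y‖ / 2) * (‖x - y‖)⁻¹ = -1 by field_simp; ring]
      module
    have := hu.reflect_le hl hL hp hR he1 le_rfl hR hx (by rw [h2]; positivity)
    rwa [h3] at this
  exact le_antisymm (key x y hx hxy) (key y x (hxy ▸ hx) hxy.symm)

theorem antitone_on_ray (hu : IsBallSolution lam Lam p R u) (hl : 0 < lam) (hL : lam < Lam)
    (hp : 1 < p) (hR : 0 < R) {e : Plane} (he : ‖e‖ = 1) {s t : ℝ} (hs : 0 ≤ s) (hst : s ≤ t)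
    (ht : t ≤ R) : u (t • e) ≤ u (s • e) := by
  rcases eq_or_lt_of_le hst with rfl | hlt
  · exact le_rfl
  have hie : inner ℝ e (t • e) = t := by
    rw [inner_smul_right, real_inner_self_eq_norm_sq, he]; norm_num
  have hn : ‖t • e‖ = t := by
    rw [norm_smul, he, mul_one, Real.norm_eq_abs, abs_of_nonneg (hs.trans hst)]
  -- Reflection in the line halfway between sends `t • e` to `s • e`.
  have := hu.reflect_le hl hL hp hR he (μ := (s + t) / 2) (x := t • e) (by linarith)
    (by linarith) (by rw [hn]; exact ht) (by rw [hie]; linarith)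
  rwa [reflectLine, hie, show t • e + (2 * ((s + t) / 2 - t)) • e = s • e by module] at this

end IsBallSolution
end PucciLaneEmden
end

/-! ### Absence of periodic orbits for large exponents. -/

noncomputable section
namespace PucciLaneEmden
open Filter Topology Set

theorem exists_primitive_of_continuousOn {f : ℝ → ℝ} {s : Set ℝ} (hs : IsOpen s)
    (hc : s.OrdConnected) (hf : ContinuousOn f s) : ∃ F : ℝ → ℝ, ∀ x ∈ s, HasDerivAt F (f x) x := by
  rcases s.eq_empty_or_nonempty with rfl | ⟨c, hcs⟩
  · exact ⟨0, by simp⟩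
  refine ⟨fun x => ∫ t in c..x, f t, fun x hx => ?_⟩
  have hsub : uIcc c x ⊆ s := hc.uIcc_subset hcs hx
  exact intervalIntegral.integral_hasDerivAt_right ((hf.mono hsub).intervalIntegrable)
    (hf.stronglyMeasurableAtFilter hs x hx) (hf.continuousAt (hs.mem_nhds hx))

/-- The common nonlinearity of the two components of the planar field. -/
def fieldM (lam Lam Z : ℝ) : ℝ := min (Z / Lam) (Z / lam - (Lam / lam - 1))

section
variable {lam Lam : ℝ}

theorem fieldM_of_le (hl : 0 < lam) (hL : lam < Lam) {Z : ℝ} (h : Lam ≤ Z) :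
    fieldM lam Lam Z = Z / Lam := by
  have hL0 := hl.trans hL
  apply min_eq_left
  have : Z / lam - (Lam / lam - 1) - Z / Lam = (Z - Lam) * (Lam - lam) / (lam * Lam) := by
    field_simp; ring
  have h2 : 0 ≤ (Z - Lam) * (Lam - lam) / (lam * Lam) :=
    div_nonneg (mul_nonneg (by linarith) (by linarith)) (by positivity)
  linarith

theorem fieldM_of_ge (hl : 0 < lam) (hL : lam < Lam) {Z : ℝ} (h : Z ≤ Lam) :
    fieldM lam Lam Z = Z / lam - (Lam / lam - 1) := by
  have hL0 := hl.trans hL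
  apply min_eq_right
  have : Z / Lam - (Z / lam - (Lam / lam - 1)) = (Lam - Z) * (Lam - lam) / (lam * Lam) := by
    field_simp; ring
  have h2 : 0 ≤ (Lam - Z) * (Lam - lam) / (lam * Lam) :=
    div_nonneg (mul_nonneg (by linarith) (by linarith)) (by positivity)
  linarith

theorem fieldX_eq (hl : 0 < lam) (hL : lam < Lam) (X Z : ℝ) :
    fieldX lam Lam X Z = X * (X + fieldM lam Lam Z) := by
  unfold fieldX dimMinus
  split_ifs with h
  · rw [fieldM_of_le hl hL h]
  · rw [fieldM_of_ge hl hL (not_le.1 h).le]; ring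

theorem fieldZ_eq (hl : 0 < lam) (hL : lam < Lam) (p X Z : ℝ) :
    fieldZ lam Lam p X Z = Z * (2 - p * X - fieldM lam Lam Z) := by
  unfold fieldZ dimMinus
  split_ifs with h
  · rw [fieldM_of_le hl hL h]
  · rw [fieldM_of_ge hl hL (not_le.1 h).le]; ring

theorem continuous_fieldM : Continuous (fieldM lam Lam) := by
  unfold fieldM
  exact (continuous_id.div_const _).min ((continuous_id.div_const _).sub continuous_const)

theorem neg_lt_fieldM (hl : 0 < lam) (hL : lam < Lam) {Z : ℝ} (hZ : 0 < Z) :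
    -(Lam / lam - 1) < fieldM lam Lam Z := by
  have hL0 := hl.trans hL
  have h1 : 1 < Lam / lam := by rwa [lt_div_iff₀ hl, one_mul]
  have h2 : 0 < Z / Lam := by positivity
  have h3 : 0 < Z / lam := by positivity
  exact lt_min (by linarith) (by linarith)

/-- In the quadrant `fieldM` is negative only below `Lam`, where it is affine; so the nullcline of
`X` is part of a straight line. -/
theorem eq_of_fieldM_neg (hl : 0 < lam) (hL : lam < Lam) {Z x : ℝ} (hZ : 0 < Z) (hx : 0 < x)
    (h : x + fieldM lam Lam Z = 0) : Z = lam * (Lam / lam - 1 - x) := by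
  have hL0 := hl.trans hL
  rcases le_total Lam Z with h1 | h1
  · rw [fieldM_of_le hl hL h1] at h
    have : 0 < Z / Lam := by positivity
    linarith
  · rw [fieldM_of_ge hl hL h1] at h
    have : Z / lam = Lam / lam - 1 - x := by linarith
    rw [← this]; field_simp

/-- The weight whose monotonicity drives the Lyapunov function. -/
theorem dulac_weight_lt (hl : 0 < lam) (hL : lam < Lam) {B : ℝ} (hB0 : 0 < B)
    (hB : 2 * B < (1 - 2 * B) * (Lam / lam - 1)) {K : ℝ → ℝ}
    (hK : ∀ Z ∈ Ioi (0 : ℝ), HasDerivAt K (Z ^ (B - 1) * fieldM lam Lam Z) Z) {Z₁ Z₂ : ℝ}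
    (h1 : 0 < Z₁) (h12 : Z₁ < Z₂) (h1L : Z₁ < Lam) :
    (1 - B) * K Z₂ + Z₂ ^ B * (2 - fieldM lam Lam Z₂) <
      (1 - B) * K Z₁ + Z₁ ^ B * (2 - fieldM lam Lam Z₁) := by
  have hL0 := hl.trans hL
  set k : ℝ → ℝ := fun Z => (1 - B) * K Z + Z ^ B * (2 - fieldM lam Lam Z) with hk
  have hkc : ContinuousOn k (Ioi 0) := by
    intro Z hZ
    have h2 : ContinuousAt (fun Z : ℝ => Z ^ B) Z :=
      Real.continuousAt_rpow_const _ _ (Or.inl (ne_of_gt hZ))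
    exact ((continuousAt_const.mul (hK Z hZ).continuousAt).add
      (h2.mul (continuousAt_const.sub continuous_fieldM.continuousAt))).continuousWithinAt
  have hpow : ∀ Z : ℝ, 0 < Z → HasDerivAt (fun Z : ℝ => Z ^ B) (B * Z ^ (B - 1)) Z := fun Z hZ =>
    Real.hasDerivAt_rpow_const (Or.inl hZ.ne')
  have hZB : ∀ Z : ℝ, 0 < Z → Z ^ B = Z ^ (B - 1) * Z := fun Z hZ => by
    rw [← Real.rpow_add_one hZ.ne', sub_add_cancel]
  -- Below `Lam`, `k' = Z^(B-1) (-2B Z/lam - (1-2B)(Lam/lam - 1) + 2B)`, which is negative by `hB`.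
  -- Above `Lam`, `k' = 2B Z^(B-1) (1 - Z/Lam)`, which is nonpositive for any `B > 0`.
  have hlow : StrictAntiOn k (Ioc 0 Lam) := by
    apply strictAntiOn_of_deriv_neg (convex_Ioc _ _) (hkc.mono fun x hx => hx.1)
    intro Z hZ
    rw [interior_Ioc] at hZ
    have hd : HasDerivAt k ((1 - B) * (Z ^ (B - 1) * fieldM lam Lam Z) +
        (B * Z ^ (B - 1) * (2 - (Z / lam - (Lam / lam - 1))) + Z ^ B * (-(1 / lam)))) Z := by
      have e : k =ᶠ[𝓝 Z] fun Z => (1 - B) * K Z + Z ^ B * (2 - (Z / lam - (Lam / lam - 1))) := by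
        filter_upwards [Ioo_mem_nhds hZ.1 hZ.2] with y hy
        simp only [hk]
        rw [fieldM_of_ge hl hL hy.2.le]
      refine HasDerivAt.congr_of_eventuallyEq ?_ e
      exact ((hK Z hZ.1).const_mul _).add ((hpow Z hZ.1).mul
        ((((hasDerivAt_id Z).div_const lam).sub_const _).const_sub 2))
    rw [hd.deriv, fieldM_of_ge hl hL hZ.2.le, hZB Z hZ.1]
    have hP : 0 < Z ^ (B - 1) := Real.rpow_pos_of_pos hZ.1 _
    have hZl : 0 < Z / lam := div_pos hZ.1 hl
    have : (1 - B) * (Z ^ (B - 1) * (Z / lam - (Lam / lam - 1))) +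
        (B * Z ^ (B - 1) * (2 - (Z / lam - (Lam / lam - 1))) + Z ^ (B - 1) * Z * (-(1 / lam))) =
        Z ^ (B - 1) * (-2 * B * (Z / lam) - (1 - 2 * B) * (Lam / lam - 1) + 2 * B) := by ring
    rw [this]
    apply mul_neg_of_pos_of_neg hP
    have := mul_pos hB0 hZl
    linarith
  have hhigh : AntitoneOn k (Ici Lam) := by
    have hdd : ∀ Z, Lam < Z → HasDerivAt k ((1 - B) * (Z ^ (B - 1) * (Z / Lam)) +
        (B * Z ^ (B - 1) * (2 - Z / Lam) + Z ^ B * (-(1 / Lam)))) Z := by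
      intro Z hZ
      have e : k =ᶠ[𝓝 Z] fun Z => (1 - B) * K Z + Z ^ B * (2 - Z / Lam) := by
        filter_upwards [Ioi_mem_nhds hZ] with y hy
        simp only [hk]
        rw [fieldM_of_le hl hL (le_of_lt hy)]
      refine HasDerivAt.congr_of_eventuallyEq ?_ e
      have h := ((hK Z (hL0.trans hZ)).const_mul (1 - B)).add ((hpow Z (hL0.trans hZ)).mul
        (((hasDerivAt_id Z).div_const Lam).const_sub 2))
      rw [fieldM_of_le hl hL hZ.le] at h
      exact h
    apply antitoneOn_of_deriv_nonpos (convex_Ici _) (hkc.mono fun x hx => hL0.trans_le hx)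
    · intro Z hZ
      rw [interior_Ici] at hZ
      exact (hdd Z hZ).differentiableAt.differentiableWithinAt
    · intro Z hZ
      rw [interior_Ici] at hZ
      have hZ0 : 0 < Z := hL0.trans hZ
      rw [(hdd Z hZ).deriv, hZB Z hZ0]
      have hP : 0 < Z ^ (B - 1) := Real.rpow_pos_of_pos hZ0 _
      have h1Z : 1 < Z / Lam := by rw [lt_div_iff₀ hL0, one_mul]; exact hZ
      have : (1 - B) * (Z ^ (B - 1) * (Z / Lam)) +
          (B * Z ^ (B - 1) * (2 - Z / Lam) + Z ^ (B - 1) * Z * (-(1 / Lam))) =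
          Z ^ (B - 1) * (2 * B * (1 - Z / Lam)) := by ring
      rw [this]
      exact mul_nonpos_of_nonneg_of_nonpos hP.le
        (mul_nonpos_of_nonneg_of_nonpos (by linarith) (by linarith))
  change k Z₂ < k Z₁
  rcases le_total Z₂ Lam with h2 | h2
  · exact hlow ⟨h1, h1L.le⟩ ⟨h1.trans h12, h2⟩ h12
  · calc k Z₂ ≤ k Lam := hhigh (mem_Ici.2 le_rfl) h2 h2
      _ < k Z₁ := hlow ⟨h1, h1L.le⟩ ⟨hL0, le_rfl⟩ h1L

/-- The planar system has no periodic orbits for large exponents. -/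
theorem not_hasPeriodicOrbit_of_large (hl : 0 < lam) (hL : lam < Lam) {p : ℝ} (hp : 1 < p)
    (hpl : 4 * (Lam / lam) < (p + 1) * (Lam / lam - 1)) : ¬ HasPeriodicOrbit lam Lam p := by
  rintro ⟨X, Z, hpos, hX, hZ, ⟨T, hT, hper⟩, hnc⟩
  have hL0 := hl.trans hL
  set N := Lam / lam - 1 with hN
  have hX0 : ∀ t, 0 < X t := fun t => (hpos t).1
  have hZ0 : ∀ t, 0 < Z t := fun t => (hpos t).2
  simp only [fieldX_eq hl hL] at hX
  simp only [fieldZ_eq hl hL] at hZ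
  set m : ℝ → ℝ := fieldM lam Lam with hm
  have hXc : Continuous X := continuous_iff_continuousAt.2 fun t => (hX t).continuousAt
  -- At the maximum of `X` over a period `X + m(Z) = 0`, and `m > -N` in the quadrant.
  have hXN : ∀ t, X t < N := by
    have hperX : Function.Periodic X T := fun t => (hper t).1
    obtain ⟨t₀, -, ht₀⟩ := isCompact_Icc.exists_isMaxOn (nonempty_Icc.2 hT.le)
      (hXc.continuousOn (s := Icc 0 T))
    have hmax : ∀ t, X t ≤ X t₀ := by
      intro t
      obtain ⟨y, hy, hy2⟩ := hperX.exists_mem_Ico₀ hT t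
      rw [hy2]; exact ht₀ ⟨hy.1, hy.2.le⟩
    have hd := (IsLocalMax.hasDerivAt_eq_zero (Eventually.of_forall hmax) (hX t₀))
    have h1 : X t₀ + m (Z t₀) = 0 := (mul_eq_zero.1 hd).resolve_left (hX0 t₀).ne'
    have h2 := neg_lt_fieldM hl hL (hZ0 t₀)
    intro t
    have := hmax t
    linarith
  -- The choice for which `2 - B = p * B`: the field multiplied by `X^(-B) Z^(B-1)` then has
  -- divergence `X^(-B) k'(Z)`, its remaining `X` terms cancelling.
  set B := 2 / (p + 1) with hBdef
  have hB0 : 0 < B := by positivity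
  have hB1 : B < 1 := by rw [hBdef, div_lt_one (by linarith)]; linarith
  have hBp : (2 - B) = p * B := by rw [hBdef]; field_simp; ring
  have hBN : 2 * B < (1 - 2 * B) * N := by
    have h1 : (p + 1) * B = 2 := by rw [hBdef]; field_simp
    have h2 : 4 * (N + 1) < (p + 1) * N := by rw [hN]; linarith
    have : 0 < (p + 1) * ((1 - 2 * B) * N - 2 * B) := by
      have e : (p + 1) * ((1 - 2 * B) * N - 2 * B) = (p + 1) * N - 4 * (N + 1) := by
        linear_combination (-2 * N - 2) * h1
      linarith
    have := pos_of_mul_pos_right (a := p + 1) (b := (1 - 2 * B) * N - 2 * B) this (by linarith)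
    linarith
  obtain ⟨K, hK⟩ := exists_primitive_of_continuousOn (f := fun Z => Z ^ (B - 1) * m Z)
    (s := Ioi 0) isOpen_Ioi ordConnected_Ioi
    (by
      intro Z hZ
      exact ((Real.continuousAt_rpow_const _ _ (Or.inl (ne_of_gt hZ))).mul
        continuous_fieldM.continuousAt).continuousWithinAt)
  set k : ℝ → ℝ := fun Z => (1 - B) * K Z + Z ^ B * (2 - m Z) with hk
  have hklt : ∀ {Z₁ Z₂ : ℝ}, 0 < Z₁ → Z₁ < Z₂ → Z₁ < Lam → k Z₂ < k Z₁ := fun h1 h2 h3 =>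
    dulac_weight_lt hl hL hB0 hBN hK h1 h2 h3
  have hkc : ∀ Z, 0 < Z → ContinuousAt k Z := by
    intro Z hZ
    exact (continuousAt_const.mul (hK Z hZ).continuousAt).add
      ((Real.continuousAt_rpow_const _ _ (Or.inl (ne_of_gt hZ))).mul
        (continuousAt_const.sub continuous_fieldM.continuousAt))
  have hlpos : ∀ {x}, x < N → 0 < lam * (N - x) := fun h => mul_pos hl (by linarith)
  obtain ⟨F, hF⟩ := exists_primitive_of_continuousOn (f := fun x => x ^ (-B) * k (lam * (N - x)))
    (s := Ioo 0 N) isOpen_Ioo ordConnected_Ioo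
    (by
      intro x hx
      refine ((Real.continuousAt_rpow_const _ _ (Or.inl (ne_of_gt hx.1))).mul ?_).continuousWithinAt
      exact ContinuousAt.comp (f := fun x => lam * (N - x)) (hkc _ (hlpos hx.2)) (by fun_prop))
  -- The first two terms form a `Z`-primitive of the weighted first component of the field.
  -- Subtracting `F` compares `k(Z)` with its value on the nullcline `Z = lam (N - X)`, so `V'` is a
  -- positive factor times the difference of `k` times `X + m(Z)`; the last two have opposite signs.
  set V : ℝ → ℝ := fun t => X t ^ (2 - B) * Z t ^ B / B + X t ^ (1 - B) * K (Z t) - F (X t) with hV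
  have hVd : ∀ t, HasDerivAt V (X t ^ (-B) * (k (Z t) - k (lam * (N - X t))) *
      (X t * (X t + m (Z t)))) t := by
    intro t
    have hx := hX0 t
    have hz := hZ0 t
    have h1 : HasDerivAt (fun t => X t ^ (2 - B)) _ t :=
      (hX t).rpow_const (p := 2 - B) (Or.inl hx.ne')
    have h2 : HasDerivAt (fun t => X t ^ (1 - B)) _ t :=
      (hX t).rpow_const (p := 1 - B) (Or.inl hx.ne')
    have h3 : HasDerivAt (fun t => Z t ^ B) _ t := (hZ t).rpow_const (p := B) (Or.inl hz.ne')
    have h4 : HasDerivAt (fun t => K (Z t)) _ t := (hK (Z t) hz).comp t (hZ t)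
    have h5 : HasDerivAt (fun t => F (X t)) _ t := (hF (X t) ⟨hx, hXN t⟩).comp t (hX t)
    have h := ((((h1.mul h3).div_const B)).add (h2.mul h4)).sub h5
    refine h.congr_deriv ?_
    have e1 : X t ^ (2 - B) = X t ^ (-B) * X t ^ 2 := by
      rw [← Real.rpow_natCast, ← Real.rpow_add hx]; congr 1; push_cast; ring
    have e2 : X t ^ (2 - B - 1) = X t ^ (-B) * X t := by
      rw [← Real.rpow_add_one hx.ne']; congr 1; ring
    have e3 : X t ^ (1 - B) = X t ^ (-B) * X t := by
      rw [← Real.rpow_add_one hx.ne']; congr 1; ring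
    have e4 : X t ^ (1 - B - 1) = X t ^ (-B) := by congr 1; ring
    have e5 : Z t ^ B = Z t ^ (B - 1) * Z t := by
      rw [← Real.rpow_add_one hz.ne']; congr 1; ring
    simp only [e1, e2, e3, e4, hk]
    rw [e5, hBp]
    field_simp
    ring
  have hsign : ∀ t, (k (Z t) - k (lam * (N - X t))) * (X t + m (Z t)) ≤ 0 ∧
      ((k (Z t) - k (lam * (N - X t))) * (X t + m (Z t)) = 0 → X t + m (Z t) = 0) := by
    intro t
    have hx := hX0 t
    have hlt : lam * (N - X t) < Lam := by
      have : lam * (N - X t) = Lam - lam - lam * X t := by rw [hN]; field_simp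
      have := mul_pos hl hx
      linarith
    rcases lt_trichotomy (Z t) (lam * (N - X t)) with h | h | h
    · have h1 := hklt (hZ0 t) h (h.trans hlt)
      have h2 : X t + m (Z t) < 0 := by
        rw [hm, fieldM_of_ge hl hL (h.trans hlt).le]
        have : Z t / lam < N - X t := by rw [div_lt_iff₀ hl]; linarith
        linarith
      have := mul_neg_of_pos_of_neg (sub_pos.2 h1) h2
      exact ⟨this.le, fun h => absurd h this.ne⟩
    · have h2 : X t + m (Z t) = 0 := by
        rw [hm, fieldM_of_ge hl hL (h ▸ hlt).le]
        have : Z t / lam = N - X t := by rw [h]; field_simp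
        linarith
      exact ⟨by simp [h2], fun _ => h2⟩
    · have h1 := hklt (hlpos (hXN t)) h hlt
      have h2 : 0 < X t + m (Z t) := by
        have h4 : 0 < Z t / Lam := div_pos (hZ0 t) hL0
        have h5 : N - X t < Z t / lam := by rw [lt_div_iff₀ hl]; linarith
        have : -X t < m (Z t) := lt_min (by linarith) (by linarith)
        linarith
      have := mul_neg_of_neg_of_pos (sub_neg.2 h1) h2
      exact ⟨this.le, fun h => absurd h this.ne⟩
  have hVanti : Antitone V := by
    apply antitone_of_deriv_nonpos (fun t => (hVd t).differentiableAt)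
    intro t
    rw [(hVd t).deriv]
    have := mul_nonpos_of_nonneg_of_nonpos
      (mul_nonneg (Real.rpow_nonneg (hX0 t).le (-B)) (hX0 t).le) (hsign t).1
    linarith
  have hVper : ∀ t, V (t + T) = V t := fun t => by simp only [hV, (hper t).1, (hper t).2]
  -- Being monotone and periodic, `V` is constant, so its derivative vanishes and the orbit lies on
  -- the nullcline.
  have hzero : ∀ t, X t + m (Z t) = 0 := by
    intro t
    have hconst : V =ᶠ[𝓝 t] fun _ => V t := by
      filter_upwards [Ioo_mem_nhds (show t - T < t by linarith) (show t < t + T by linarith)]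
        with s hs
      have h1 := hVper t
      have h2 := hVper (t - T)
      rw [sub_add_cancel] at h2
      exact le_antisymm ((hVanti hs.1.le).trans h2.ge) (h1.ge.trans (hVanti hs.2.le))
    have h0 := (hVd t).deriv
    rw [hconst.deriv_eq] at h0
    simp only [deriv_const] at h0
    apply (hsign t).2
    have hne : X t ^ (-B) * X t ≠ 0 :=
      (mul_pos (Real.rpow_pos_of_pos (hX0 t) _) (hX0 t)).ne'
    apply (mul_eq_zero.1 (_ : X t ^ (-B) * X t *
      ((k (Z t) - k (lam * (N - X t))) * (X t + m (Z t))) = 0)).resolve_left hne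
    rw [h0]; ring
  have hXconst : ∀ s t, X s = X t := by
    refine is_const_of_deriv_eq_zero (fun t => (hX t).differentiableAt) fun t => ?_
    rw [(hX t).deriv, hzero t, mul_zero]
  have hZe : ∀ t, Z t = lam * (N - X t) := fun t =>
    eq_of_fieldM_neg hl hL (hZ0 t) (hX0 t) (hzero t)
  obtain ⟨s, t, hst⟩ := hnc
  rcases hst with h | h
  · exact h (hXconst s t)
  · exact h (by rw [hZe s, hZe t, hXconst s t])

theorem noPeriodicSet_nonempty (hl : 0 < lam) (hL : lam < Lam) :
    (noPeriodicSet lam Lam).Nonempty := by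
  have hN : 0 < Lam / lam - 1 := by
    have : 1 < Lam / lam := by rwa [lt_div_iff₀ hl, one_mul]
    linarith
  set q := max (max 1 ((dimMinus lam Lam + 2) / (dimMinus lam Lam - 2)))
    (4 * (Lam / lam) / (Lam / lam - 1)) with hq
  refine ⟨q + 1, ?_, fun p' hp' => ?_⟩
  · have : (dimMinus lam Lam + 2) / (dimMinus lam Lam - 2) ≤ q :=
      (le_max_right _ _).trans (le_max_left _ _)
    linarith
  · have h1 : 1 ≤ q := (le_max_left _ _).trans (le_max_left _ _)
    have h2 : 4 * (Lam / lam) / (Lam / lam - 1) ≤ q := le_max_right _ _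
    apply not_hasPeriodicOrbit_of_large hl hL (by linarith)
    rw [div_le_iff₀ hN] at h2
    nlinarith

end
end PucciLaneEmden
end

/-! ### Sign and comparison lemmas on the line, crossing graphs, and global existence for ODEs. -/

noncomputable section
namespace PucciLaneEmden
open Filter Topology Set

section RealLemmas

theorem exists_last_zero {φ : ℝ → ℝ} {a b : ℝ} (hφ : ContinuousOn φ (Icc a b)) (hab : a ≤ b)
    (ha : φ a ≤ 0) (hb : 0 < φ b) : ∃ c ∈ Ico a b, φ c = 0 ∧ ∀ t ∈ Ioc c b, 0 < φ t := by
  set A : Set ℝ := Icc a b ∩ φ ⁻¹' (Iic 0) with hA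
  have hAc : IsClosed A := hφ.preimage_isClosed_of_isClosed isClosed_Icc isClosed_Iic
  have hAn : A.Nonempty := ⟨a, ⟨le_rfl, hab⟩, ha⟩
  have hAb : BddAbove A := ⟨b, fun x hx => hx.1.2⟩
  have hc : sSup A ∈ A := hAc.csSup_mem hAn hAb
  set c := sSup A
  have hcb : c < b := lt_of_le_of_ne hc.1.2 (by rintro h; exact absurd hc.2 (by rw [h]; simpa using hb))
  have hpos : ∀ t ∈ Ioc c b, 0 < φ t := by
    intro t ht
    by_contra hle
    exact absurd (le_csSup hAb (show t ∈ A from ⟨⟨hc.1.1.trans ht.1.le, ht.2⟩, not_lt.1 hle⟩))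
      (not_le.2 ht.1)
  refine ⟨c, ⟨hc.1.1, hcb⟩, le_antisymm hc.2 ?_, hpos⟩
  have hcw : ContinuousWithinAt φ (Ioc c b) c :=
    (hφ c hc.1).mono fun x hx => ⟨hc.1.1.trans hx.1.le, hx.2⟩
  have : (𝓝[Ioc c b] c).NeBot := by
    rw [← mem_closure_iff_nhdsWithin_neBot, closure_Ioc hcb.ne]; exact ⟨le_rfl, hcb.le⟩
  refine ge_of_tendsto hcw ?_
  filter_upwards [self_mem_nhdsWithin] with t ht using (hpos t ht).le

theorem exists_first_zero {φ : ℝ → ℝ} {a b : ℝ} (hφ : ContinuousOn φ (Icc a b)) (hab : a ≤ b)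
    (ha : 0 < φ a) (hb : φ b ≤ 0) : ∃ c ∈ Ioc a b, φ c = 0 ∧ ∀ t ∈ Ico a c, 0 < φ t := by
  have h : ContinuousOn (fun t => φ (-t)) (Icc (-b) (-a)) :=
    hφ.comp continuous_neg.continuousOn fun t ht => ⟨by linarith [ht.2], by linarith [ht.1]⟩
  obtain ⟨c, hc, hc0, hcp⟩ := exists_last_zero h (by linarith) (by simpa using hb) (by simpa using ha)
  refine ⟨-c, ⟨by linarith [hc.2], by linarith [hc.1]⟩, hc0, fun t ht => ?_⟩
  simpa using hcp (-t) ⟨by linarith [ht.2], by linarith [ht.1]⟩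

theorem deriv_nonneg_of_pos_right {φ : ℝ → ℝ} {c b d : ℝ} (hcb : c < b) (hd : HasDerivAt φ d c)
    (h0 : φ c = 0) (hpos : ∀ t ∈ Ioo c b, 0 < φ t) : 0 ≤ d := by
  have h := hd.hasDerivWithinAt (s := Ioi c)
  rw [hasDerivWithinAt_iff_tendsto_slope' self_notMem_Ioi] at h
  refine ge_of_tendsto h ?_
  filter_upwards [Ioo_mem_nhdsGT hcb] with t ht
  rw [slope_def_field, h0, sub_zero]
  exact div_nonneg (hpos t ht).le (by linarith [ht.1])

theorem deriv_nonpos_of_pos_left {φ : ℝ → ℝ} {a c d : ℝ} (hac : a < c) (hd : HasDerivAt φ d c)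
    (h0 : φ c = 0) (hpos : ∀ t ∈ Ioo a c, 0 < φ t) : d ≤ 0 := by
  have h1 : HasDerivAt (fun t => φ (-t)) (-d) (-c) := by
    have h2 : HasDerivAt φ d (-(-c)) := by simpa using hd
    simpa [Function.comp_def] using h2.comp (-c) (hasDerivAt_neg (-c))
  have := deriv_nonneg_of_pos_right (b := -a) (by linarith) h1 (by simpa using h0)
    (fun t ht => hpos (-t) ⟨by linarith [ht.2], by linarith [ht.1]⟩)
  linarith

theorem exists_pos_right_of_deriv_pos {φ : ℝ → ℝ} {c d : ℝ} (hd : HasDerivAt φ d c) (h0 : φ c = 0)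
    (hd0 : 0 < d) : ∃ ε > 0, (∀ t ∈ Ioo c (c + ε), 0 < φ t) ∧ ∀ t ∈ Ioo (c - ε) c, φ t < 0 := by
  have h := hd
  rw [hasDerivAt_iff_tendsto_slope] at h
  have h1 := h.eventually (lt_mem_nhds hd0)
  rw [eventually_nhdsWithin_iff, Metric.eventually_nhds_iff] at h1
  obtain ⟨ε, hε, h1⟩ := h1
  refine ⟨ε, hε, fun t ht => ?_, fun t ht => ?_⟩
  · have := h1 (y := t) (by rw [Real.dist_eq, abs_lt]; constructor <;> linarith [ht.1, ht.2])
      (ne_of_gt ht.1)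
    rw [slope_def_field, h0, sub_zero] at this
    exact (div_pos_iff_of_pos_right (by linarith [ht.1])).1 this
  · have := h1 (y := t) (by rw [Real.dist_eq, abs_lt]; constructor <;> linarith [ht.1, ht.2])
      (ne_of_lt ht.2)
    rw [slope_def_field, h0, sub_zero] at this
    by_contra hneg
    exact absurd this (not_lt.2 (div_nonpos_of_nonneg_of_nonpos (not_lt.1 hneg) (by linarith [ht.2])))

/-- Backward invariance of a superlevel set at whose boundary the derivative is negative. -/
theorem ge_of_deriv_neg_at_level {φ φ' : ℝ → ℝ} {a b m : ℝ} (hab : a ≤ b)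
    (hd : ∀ t ∈ Icc a b, HasDerivAt φ (φ' t) t) (hlev : ∀ t ∈ Icc a b, φ t = m → φ' t < 0)
    (hb : m ≤ φ b) : m ≤ φ a := by
  by_contra hlt
  push Not at hlt
  have hc : ContinuousOn (fun t => m - φ t) (Icc a b) := fun t ht =>
    (continuousAt_const.sub (hd t ht).continuousAt).continuousWithinAt
  obtain ⟨c, hc, hc0, hcp⟩ := exists_first_zero hc hab (by linarith) (by linarith)
  have h1 := deriv_nonpos_of_pos_left hc.1 ((hd c ⟨hc.1.le, hc.2⟩).const_sub m) hc0
    (fun t ht => hcp t ⟨ht.1.le, ht.2⟩)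
  have := hlev c ⟨hc.1.le, hc.2⟩ (by linarith)
  linarith

theorem le_of_deriv_pos_at_level {φ φ' : ℝ → ℝ} {a b m : ℝ} (hab : a ≤ b)
    (hd : ∀ t ∈ Icc a b, HasDerivAt φ (φ' t) t) (hlev : ∀ t ∈ Icc a b, φ t = m → 0 < φ' t)
    (hb : φ b ≤ m) : φ a ≤ m := by
  have := ge_of_deriv_neg_at_level (φ := fun t => -φ t) (φ' := fun t => -φ' t) (m := -m) hab
    (fun t ht => (hd t ht).neg) (fun t ht h => by linarith [hlev t ht (by linarith)]) (by linarith)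
  linarith

theorem mul_sub_le_of_le_deriv {φ φ' : ℝ → ℝ} {a b r : ℝ} (hab : a ≤ b)
    (hd : ∀ t ∈ Icc a b, HasDerivAt φ (φ' t) t) (hr : ∀ t ∈ Icc a b, r ≤ φ' t) :
    r * (b - a) ≤ φ b - φ a := by
  refine (convex_Icc a b).mul_sub_le_image_sub_of_le_deriv
    (fun t ht => (hd t ht).continuousAt.continuousWithinAt)
    (fun t ht => (hd t (interior_subset ht)).differentiableAt.differentiableWithinAt)
    (fun t ht => ?_) a ⟨le_rfl, hab⟩ b ⟨hab, le_rfl⟩ hab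
  rw [(hd t (interior_subset ht)).deriv]
  exact hr t (interior_subset ht)

theorem sub_le_mul_of_deriv_le {φ φ' : ℝ → ℝ} {a b r : ℝ} (hab : a ≤ b)
    (hd : ∀ t ∈ Icc a b, HasDerivAt φ (φ' t) t) (hr : ∀ t ∈ Icc a b, φ' t ≤ r) :
    φ b - φ a ≤ r * (b - a) := by
  have := mul_sub_le_of_le_deriv (φ := fun t => -φ t) (φ' := fun t => -φ' t) (r := -r) hab
    (fun t ht => (hd t ht).neg) (fun t ht => by linarith [hr t ht])
  linarith

/-- Extended with slope one outside `[a, b]`, `s` becomes an increasing homeomorphism of the line,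
whose inverse is continuous everywhere. -/
theorem exists_continuous_inverse {s : ℝ → ℝ} {a b : ℝ} (hab : a ≤ b)
    (hs : ContinuousOn s (Icc a b)) (hm : StrictMonoOn s (Icc a b)) :
    ∃ g : ℝ → ℝ, Continuous g ∧ ∀ y ∈ Icc (s a) (s b), g y ∈ Icc a b ∧ s (g y) = y := by
  set P : ℝ → ℝ := fun t => max a (min b t) with hP
  have hPm : ∀ t, P t ∈ Icc a b := fun t => ⟨le_max_left _ _, max_le hab (min_le_left _ _)⟩
  have hPid : ∀ t ∈ Icc a b, P t = t := fun t ht => by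
    rw [hP]; simp only [min_eq_right ht.2, max_eq_right ht.1]
  have hPc : Continuous P := by rw [hP]; fun_prop
  have hPmono : Monotone P := fun x y h => max_le_max le_rfl (min_le_min le_rfl h)
  have hPid' : Monotone fun t => t - P t := by
    intro x y h
    simp only [hP]
    rcases max_cases a (min b x) with h1 | h1 <;> rcases max_cases a (min b y) with h2 | h2 <;>
    rcases min_cases b x with h3 | h3 <;> rcases min_cases b y with h4 | h4 <;> linarith
  set h : ℝ → ℝ := fun t => s (P t) + (t - P t) with hh
  have hhc : Continuous h :=
    (hs.comp_continuous hPc hPm).add (continuous_id.sub hPc)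
  have hhm : StrictMono h := by
    intro x y hxy
    rcases lt_or_eq_of_le (hPmono hxy.le) with h1 | h1
    · have := hm (hPm x) (hPm y) h1
      have := hPid' hxy.le
      simp only [hh] at *; linarith
    · simp only [hh, h1]; linarith
  have hsur : Function.Surjective h := by
    apply hhc.surjective
    · refine tendsto_atTop_mono (fun t => ?_) (tendsto_atTop_add_const_left _ (s a - b) tendsto_id)
      have h1 := hm.monotoneOn ⟨le_rfl, hab⟩ (hPm t) (hPm t).1
      have h2 := (hPm t).2
      simp only [hh, id]; linarith
    · refine tendsto_atBot_mono (fun t => ?_) (tendsto_atBot_add_const_left _ (s b - a) tendsto_id)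
      have h1 := hm.monotoneOn (hPm t) ⟨hab, le_rfl⟩ (hPm t).2
      have h2 := (hPm t).1
      simp only [hh, id]; linarith
  set e := hhm.orderIsoOfSurjective h hsur
  refine ⟨e.symm, e.symm.continuous, fun y hy => ?_⟩
  have hey : h (e.symm y) = y := e.apply_symm_apply y
  have hmem : e.symm y ∈ Icc a b := by
    constructor
    · rw [← hhm.le_iff_le, hey]
      simp only [hh, hPid a ⟨le_rfl, hab⟩]; linarith [hy.1]
    · rw [← hhm.le_iff_le, hey]
      simp only [hh, hPid b ⟨hab, le_rfl⟩]; linarith [hy.2]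
  refine ⟨hmem, ?_⟩
  have := hey
  simp only [hh, hPid _ hmem] at this
  linarith

/-- Two graphs over a common interval whose order changes have a common point. -/
theorem exists_graphs_meet {s₁ x₁ s₂ x₂ : ℝ → ℝ} {a₁ b₁ a₂ b₂ c d : ℝ} (h1 : a₁ ≤ b₁)
    (h2 : a₂ ≤ b₂) (hs1 : ContinuousOn s₁ (Icc a₁ b₁)) (hs2 : ContinuousOn s₂ (Icc a₂ b₂))
    (hx1 : ContinuousOn x₁ (Icc a₁ b₁)) (hx2 : ContinuousOn x₂ (Icc a₂ b₂))
    (hm1 : StrictMonoOn s₁ (Icc a₁ b₁)) (hm2 : StrictMonoOn s₂ (Icc a₂ b₂)) (hcd : c ≤ d)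
    {tc₁ tc₂ td₁ td₂ : ℝ} (htc1 : tc₁ ∈ Icc a₁ b₁) (htc2 : tc₂ ∈ Icc a₂ b₂)
    (htd1 : td₁ ∈ Icc a₁ b₁) (htd2 : td₂ ∈ Icc a₂ b₂) (ec1 : s₁ tc₁ = c) (ec2 : s₂ tc₂ = c)
    (ed1 : s₁ td₁ = d) (ed2 : s₂ td₂ = d) (hc : x₁ tc₁ ≤ x₂ tc₂) (hd : x₂ td₂ ≤ x₁ td₁) :
    ∃ τ₁ ∈ Icc a₁ b₁, ∃ τ₂ ∈ Icc a₂ b₂, s₁ τ₁ = s₂ τ₂ ∧ x₁ τ₁ = x₂ τ₂ := by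
  obtain ⟨g₁, hg1, hg1'⟩ := exists_continuous_inverse h1 hs1 hm1
  obtain ⟨g₂, hg2, hg2'⟩ := exists_continuous_inverse h2 hs2 hm2
  have r1 : ∀ y ∈ Icc c d, y ∈ Icc (s₁ a₁) (s₁ b₁) := fun y hy =>
    ⟨(hm1.monotoneOn ⟨le_rfl, h1⟩ htc1 htc1.1).trans (ec1.le.trans hy.1),
      (hy.2.trans ed1.ge).trans (hm1.monotoneOn htd1 ⟨h1, le_rfl⟩ htd1.2)⟩
  have r2 : ∀ y ∈ Icc c d, y ∈ Icc (s₂ a₂) (s₂ b₂) := fun y hy =>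
    ⟨(hm2.monotoneOn ⟨le_rfl, h2⟩ htc2 htc2.1).trans (ec2.le.trans hy.1),
      (hy.2.trans ed2.ge).trans (hm2.monotoneOn htd2 ⟨h2, le_rfl⟩ htd2.2)⟩
  have hcont : ContinuousOn (fun y => x₁ (g₁ y) - x₂ (g₂ y)) (Icc c d) :=
    (hx1.comp hg1.continuousOn fun y hy => (hg1' y (r1 y hy)).1).sub
      (hx2.comp hg2.continuousOn fun y hy => (hg2' y (r2 y hy)).1)
  have i1 : ∀ t ∈ Icc a₁ b₁, s₁ t ∈ Icc c d → g₁ (s₁ t) = t := fun t ht h =>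
    hm1.injOn (hg1' _ (r1 _ h)).1 ht (hg1' _ (r1 _ h)).2
  have i2 : ∀ t ∈ Icc a₂ b₂, s₂ t ∈ Icc c d → g₂ (s₂ t) = t := fun t ht h =>
    hm2.injOn (hg2' _ (r2 _ h)).1 ht (hg2' _ (r2 _ h)).2
  have hcm : c ∈ Icc c d := ⟨le_rfl, hcd⟩
  have hdm : d ∈ Icc c d := ⟨hcd, le_rfl⟩
  obtain ⟨y, hy, hy0⟩ := intermediate_value_Icc hcd hcont (show (0 : ℝ) ∈ Icc _ _ from by
    have e1 := i1 tc₁ htc1 (ec1 ▸ hcm)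
    have e2 := i2 tc₂ htc2 (ec2 ▸ hcm)
    have e3 := i1 td₁ htd1 (ed1 ▸ hdm)
    have e4 := i2 td₂ htd2 (ed2 ▸ hdm)
    rw [ec1] at e1; rw [ec2] at e2; rw [ed1] at e3; rw [ed2] at e4
    constructor
    · simp only [e1, e2]; linarith
    · simp only [e3, e4]; linarith)
  refine ⟨g₁ y, (hg1' y (r1 y hy)).1, g₂ y, (hg2' y (r2 y hy)).1, ?_, sub_eq_zero.1 hy0⟩
  rw [(hg1' y (r1 y hy)).2, (hg2' y (r2 y hy)).2]

end RealLemmas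

/-- Global existence for bounded, globally Lipschitz, time dependent fields. -/
theorem exists_global_solution {E : Type*} [NormedAddCommGroup E] [NormedSpace ℝ E]
    [CompleteSpace E] {v : ℝ → E → E} {K : NNReal} {C : ℝ} (hK : ∀ t, LipschitzWith K (v t))
    (hcont : ∀ x, Continuous fun t => v t x) (hC : ∀ t x, ‖v t x‖ ≤ C) (t₀ : ℝ) (x₀ : E) :
    ∃ γ : ℝ → E, γ t₀ = x₀ ∧ ∀ t, HasDerivAt γ (v t (γ t)) t := by
  have hC0 : 0 ≤ C := (norm_nonneg _).trans (hC t₀ x₀)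
  have hloc : ∀ n : ℕ, ∃ γ : ℝ → E, γ t₀ = x₀ ∧
      ∀ t ∈ Ioo (t₀ - (n + 1)) (t₀ + (n + 1)), HasDerivAt γ (v t (γ t)) t := by
    intro n
    have hn : (0 : ℝ) < n + 1 := by positivity
    have hpl : IsPicardLindelof v (tmin := t₀ - (n + 1)) (tmax := t₀ + (n + 1))
        ⟨t₀, by constructor <;> linarith⟩ x₀ (C.toNNReal * (n + 1)) 0 C.toNNReal K :=
      { lipschitzOnWith := fun t _ => (hK t).lipschitzOnWith
        continuousOn := fun x _ => (hcont x).continuousOn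
        norm_le := fun t _ x _ => by rw [Real.coe_toNNReal _ hC0]; exact hC t x
        mul_max_le := by simp }
    obtain ⟨γ, h1, h2⟩ := hpl.exists_eq_forall_mem_Icc_hasDerivWithinAt₀
    exact ⟨γ, h1, fun t ht => (h2 t ⟨ht.1.le, ht.2.le⟩).hasDerivAt (Icc_mem_nhds ht.1 ht.2)⟩
  choose γ hγ0 hγ using hloc
  have hagree : ∀ m n : ℕ, m ≤ n → EqOn (γ m) (γ n) (Ioo (t₀ - (m + 1)) (t₀ + (m + 1))) := by
    intro m n hmn
    have hmn' : (m : ℝ) ≤ n := by exact_mod_cast hmn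
    have hm : (0 : ℝ) < m + 1 := by positivity
    exact ODE_solution_unique_of_mem_Ioo (v := v) (s := fun _ => univ) (K := K) (t₀ := t₀)
      (fun t _ => (hK t).lipschitzOnWith) (by constructor <;> linarith)
      (fun t ht => ⟨hγ m t ht, mem_univ _⟩)
      (fun t ht => ⟨hγ n t ⟨by linarith [ht.1], by linarith [ht.2]⟩, mem_univ _⟩)
      (by rw [hγ0, hγ0])
  -- The local solutions agree on overlaps, so each time may be assigned any interval that contains
  -- it in its interior.
  set idx : ℝ → ℕ := fun t => ⌈|t - t₀|⌉₊ with hidx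
  have hidx' : ∀ t, t ∈ Ioo (t₀ - (idx t + 1)) (t₀ + (idx t + 1)) := by
    intro t
    have := abs_le.1 (Nat.le_ceil |t - t₀|)
    constructor <;> linarith [this.1, this.2]
  refine ⟨fun t => γ (idx t) t, by simp [hγ0], fun t => ?_⟩
  have hev : (fun t => γ (idx t) t) =ᶠ[𝓝 t] γ (idx t) := by
    filter_upwards [Ioo_mem_nhds (hidx' t).1 (hidx' t).2] with r hr
    rcases le_total (idx r) (idx t) with h | h
    · exact hagree _ _ h (hidx' r)
    · exact (hagree _ _ h hr).symm
  exact (hγ (idx t) t (hidx' t)).congr_of_eventuallyEq hev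

end PucciLaneEmden
end

/-! ### The truncated flow in logarithmic Emden-Fowler coordinates. -/

noncomputable section
namespace PucciLaneEmden
open Filter Topology Set

/-- Parameters of the planar system in logarithmic Emden-Fowler coordinates, with a truncation
level `S` for the first coordinate. -/
structure FlowData where
  lam : ℝ
  Lam : ℝ
  p : ℝ
  S : ℝ
  lam_pos : 0 < lam
  lam_lt : lam < Lam
  p_large : (Lam / lam - 1 + 4) / (Lam / lam - 1) < p

namespace FlowData
variable (d : FlowData)

/-- The dimension-like number minus two. -/
def N : ℝ := d.Lam / d.lam - 1
/-- The scaling exponent. -/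
def al : ℝ := 2 / (d.p - 1)
/-- The value of `exp s / lam` at the stationary point. -/
def b : ℝ := d.al * (d.N - d.al)
/-- The first coordinate of the stationary point. -/
def s₀ : ℝ := Real.log (d.lam * d.b)
/-- The second component of the field. -/
def f (s x : ℝ) : ℝ := x ^ 2 + min (Real.exp s / d.Lam) (Real.exp s / d.lam - d.N * x)
/-- Truncation of the second coordinate. -/
def cl (x : ℝ) : ℝ := max 0 (min x d.N)

theorem Lam_pos : 0 < d.Lam := d.lam_pos.trans d.lam_lt

theorem N_pos : 0 < d.N := by
  have : 1 < d.Lam / d.lam := by rw [lt_div_iff₀ d.lam_pos, one_mul]; exact d.lam_lt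
  unfold N; linarith

theorem p_gt : 1 + 4 / d.N < d.p := by
  have h := d.p_large
  have hN := d.N_pos
  have : (d.Lam / d.lam - 1 + 4) / (d.Lam / d.lam - 1) = 1 + 4 / d.N := by
    change (d.N + 4) / d.N = _; field_simp
  rwa [this] at h

theorem p_gt_one : 1 < d.p := by
  have := d.p_gt
  have : 0 < 4 / d.N := div_pos (by norm_num) d.N_pos
  linarith

theorem al_pos : 0 < d.al := div_pos two_pos (by linarith [d.p_gt_one])

theorem p_mul_al : (d.p - 1) * d.al = 2 := by
  have := d.p_gt_one
  unfold al; field_simp [show d.p - 1 ≠ 0 by linarith]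

theorem two_al_lt : 2 * d.al < d.N := by
  have h1 := d.p_gt
  have hN := d.N_pos
  have h2 : 4 < (d.p - 1) * d.N := by
    have : 4 / d.N < d.p - 1 := by linarith
    rwa [div_lt_iff₀ hN] at this
  have h3 := d.p_mul_al
  have h4 := d.p_gt_one
  have : 0 < (d.p - 1) * (d.N - 2 * d.al) := by nlinarith
  have := (pos_iff_pos_of_mul_pos this).1 (by linarith)
  linarith

theorem al_lt_N : d.al < d.N := by linarith [d.two_al_lt, d.al_pos]

theorem b_pos : 0 < d.b := mul_pos d.al_pos (by linarith [d.al_lt_N])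

theorem exp_s₀ : Real.exp d.s₀ = d.lam * d.b :=
  Real.exp_log (mul_pos d.lam_pos d.b_pos)

theorem exp_div_lam (s : ℝ) : Real.exp s / d.lam = d.b * Real.exp (s - d.s₀) := by
  have hl := d.lam_pos
  have hb := d.b_pos
  rw [Real.exp_sub, d.exp_s₀]; field_simp

theorem cl_mem (x : ℝ) : d.cl x ∈ Icc 0 d.N :=
  ⟨le_max_left _ _, max_le d.N_pos.le (min_le_right _ _)⟩

theorem cl_of_mem {x : ℝ} (h0 : 0 ≤ x) (h1 : x ≤ d.N) : d.cl x = x := by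
  unfold cl; rw [min_eq_left h1, max_eq_right h0]

theorem cl_lt {x : ℝ} (h : x < d.al) : d.cl x < d.al :=
  max_lt d.al_pos ((min_le_left _ _).trans_lt h)

theorem lt_cl {x : ℝ} (h : d.al < x) : d.al < d.cl x :=
  lt_max_of_lt_right (lt_min h d.al_lt_N)

theorem abs_cl_sub_le (x y : ℝ) : |d.cl x - d.cl y| ≤ |x - y| := by
  unfold cl
  have h1 := abs_max_sub_max_le_max 0 (min x d.N) 0 (min y d.N)
  have h2 := abs_min_sub_min_le_max x d.N y d.N
  simp only [sub_self, abs_zero] at h1 h2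
  rw [max_eq_right (abs_nonneg (min x d.N - min y d.N))] at h1
  rw [max_eq_left (abs_nonneg (x - y))] at h2
  exact h1.trans h2

/-- A global orbit of the truncated system. -/
structure IsOrbit (s x : ℝ → ℝ) : Prop where
  s_deriv : ∀ t, HasDerivAt s ((d.p - 1) * (d.al - d.cl (x t))) t
  x_deriv : ∀ t, HasDerivAt x (d.f (min (s t) d.S) (d.cl (x t))) t

/-- The truncated field. -/
def fld (q : ℝ × ℝ) : ℝ × ℝ := ((d.p - 1) * (d.al - d.cl q.2), d.f (min q.1 d.S) (d.cl q.2))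

theorem abs_exp_min_sub_le (S x y : ℝ) :
    |Real.exp (min x S) - Real.exp (min y S)| ≤ Real.exp S * |x - y| := by
  have key : ∀ a b : ℝ, a ≤ b → b ≤ S → Real.exp b - Real.exp a ≤ Real.exp S * (b - a) := by
    intro a b hab hb
    have h1 : 1 - (b - a) ≤ Real.exp (-(b - a)) := by linarith [Real.add_one_le_exp (-(b - a))]
    have h2 : Real.exp a = Real.exp b * Real.exp (-(b - a)) := by rw [← Real.exp_add]; ring_nf
    have h3 : Real.exp b ≤ Real.exp S := Real.exp_le_exp.2 hb
    have h4 := Real.exp_pos b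
    rw [h2]
    nlinarith
  have hmin := abs_min_sub_min_le_max x S y S
  simp only [sub_self, abs_zero] at hmin
  rw [max_eq_left (abs_nonneg (x - y))] at hmin
  refine le_trans ?_ (mul_le_mul_of_nonneg_left hmin (Real.exp_pos S).le)
  rcases le_total (min x S) (min y S) with h | h
  · rw [abs_of_nonpos (by linarith [Real.exp_le_exp.2 h]), abs_of_nonpos (by linarith)]
    linarith [key _ _ h (min_le_right _ _)]
  · rw [abs_of_nonneg (by linarith [Real.exp_le_exp.2 h]), abs_of_nonneg (by linarith)]
    exact key _ _ h (min_le_right _ _)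

theorem abs_f_sub_le (s t x y : ℝ) : |d.f s x - d.f t y| ≤
    |x ^ 2 - y ^ 2| + max (|Real.exp s - Real.exp t| / d.Lam)
      (|Real.exp s - Real.exp t| / d.lam + d.N * |x - y|) := by
  have h1 := abs_min_sub_min_le_max (Real.exp s / d.Lam) (Real.exp s / d.lam - d.N * x)
    (Real.exp t / d.Lam) (Real.exp t / d.lam - d.N * y)
  have e1 : |Real.exp s / d.Lam - Real.exp t / d.Lam| = |Real.exp s - Real.exp t| / d.Lam := by
    rw [← sub_div, abs_div, abs_of_pos d.Lam_pos]
  have e2 : |Real.exp s / d.lam - d.N * x - (Real.exp t / d.lam - d.N * y)| ≤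
      |Real.exp s - Real.exp t| / d.lam + d.N * |x - y| := by
    rw [show Real.exp s / d.lam - d.N * x - (Real.exp t / d.lam - d.N * y) =
      (Real.exp s - Real.exp t) / d.lam - d.N * (x - y) by ring]
    refine (abs_sub _ _).trans ?_
    rw [abs_div, abs_mul, abs_of_pos d.lam_pos, abs_of_pos d.N_pos]
  unfold f
  rw [show x ^ 2 + min (Real.exp s / d.Lam) (Real.exp s / d.lam - d.N * x) -
    (y ^ 2 + min (Real.exp t / d.Lam) (Real.exp t / d.lam - d.N * y)) = (x ^ 2 - y ^ 2) +
    (min (Real.exp s / d.Lam) (Real.exp s / d.lam - d.N * x) -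
      min (Real.exp t / d.Lam) (Real.exp t / d.lam - d.N * y)) by ring]
  refine (abs_add_le _ _).trans (add_le_add le_rfl (h1.trans (max_le_max e1.le e2)))

theorem exists_lipschitz : ∃ K : NNReal, LipschitzWith K d.fld := by
  have hN := d.N_pos
  have hl := d.lam_pos
  have hL := d.Lam_pos
  have hp := d.p_gt_one
  set A : ℝ := Real.exp d.S / d.Lam + Real.exp d.S / d.lam + 3 * d.N + (d.p - 1) with hA
  have hA0 : 0 ≤ A := by
    have := Real.exp_pos d.S
    have : 0 < d.p - 1 := by linarith
    positivity
  refine ⟨A.toNNReal, LipschitzWith.of_dist_le_mul fun q r => ?_⟩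
  rw [Real.coe_toNNReal _ hA0]
  have hq1 : |q.1 - r.1| ≤ dist q r := by rw [Prod.dist_eq, ← Real.dist_eq]; exact le_max_left _ _
  have hq2 : |q.2 - r.2| ≤ dist q r := by rw [Prod.dist_eq, ← Real.dist_eq]; exact le_max_right _ _
  have hD : 0 ≤ dist q r := dist_nonneg
  have hc := (d.abs_cl_sub_le q.2 r.2).trans hq2
  have hE := (abs_exp_min_sub_le d.S q.1 r.1).trans
    (mul_le_mul_of_nonneg_left hq1 (Real.exp_pos d.S).le)
  have hES := Real.exp_pos d.S
  have t1 : 0 ≤ Real.exp d.S / d.Lam * dist q r := by positivity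
  have t2 : 0 ≤ Real.exp d.S / d.lam * dist q r := by positivity
  have t3 : 0 ≤ d.N * dist q r := by positivity
  have t4 : 0 ≤ (d.p - 1) * dist q r := mul_nonneg (by linarith) hD
  rw [Prod.dist_eq]
  apply max_le
  · simp only [fld]
    rw [Real.dist_eq, ← mul_sub, abs_mul, abs_of_pos (by linarith : 0 < d.p - 1)]
    have : |d.al - d.cl q.2 - (d.al - d.cl r.2)| = |d.cl q.2 - d.cl r.2| := by
      rw [← abs_neg]; congr 1; ring
    rw [this]
    have := mul_le_mul_of_nonneg_left hc (by linarith : 0 ≤ d.p - 1)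
    rw [hA]; nlinarith
  · simp only [fld]
    rw [Real.dist_eq]
    refine (d.abs_f_sub_le _ _ _ _).trans ?_
    have h1 : |d.cl q.2 ^ 2 - d.cl r.2 ^ 2| ≤ 2 * d.N * dist q r := by
      rw [sq_sub_sq, abs_mul]
      have a1 := d.cl_mem q.2
      have a2 := d.cl_mem r.2
      rw [abs_of_nonneg (add_nonneg a1.1 a2.1)]
      exact mul_le_mul (by linarith [a1.2, a2.2]) hc (abs_nonneg _) (by linarith)
    have h2 : |Real.exp (min q.1 d.S) - Real.exp (min r.1 d.S)| / d.Lam ≤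
        Real.exp d.S / d.Lam * dist q r := by
      rw [div_mul_eq_mul_div]; exact div_le_div_of_nonneg_right hE hL.le
    have h3 : |Real.exp (min q.1 d.S) - Real.exp (min r.1 d.S)| / d.lam ≤
        Real.exp d.S / d.lam * dist q r := by
      rw [div_mul_eq_mul_div]; exact div_le_div_of_nonneg_right hE hl.le
    have h4 := mul_le_mul_of_nonneg_left hc hN.le
    have h5 : max (|Real.exp (min q.1 d.S) - Real.exp (min r.1 d.S)| / d.Lam)
      (|Real.exp (min q.1 d.S) - Real.exp (min r.1 d.S)| / d.lam + d.N * |d.cl q.2 - d.cl r.2|) ≤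
      Real.exp d.S / d.Lam * dist q r + (Real.exp d.S / d.lam * dist q r + d.N * dist q r) :=
      max_le (by linarith) (by linarith)
    rw [hA]; nlinarith

theorem exists_bound : ∃ C : ℝ, ∀ q, ‖d.fld q‖ ≤ C := by
  have hc : ContinuousOn (fun r : ℝ × ℝ => (((d.p - 1) * (d.al - r.2),
      r.2 ^ 2 + min (r.1 / d.Lam) (r.1 / d.lam - d.N * r.2)) : ℝ × ℝ))
      (Icc 0 (Real.exp d.S) ×ˢ Icc 0 d.N) := by
    apply Continuous.continuousOn
    fun_prop
  obtain ⟨C, hC⟩ := (isCompact_Icc.prod isCompact_Icc).exists_bound_of_continuousOn hc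
  refine ⟨C, fun q => hC (Real.exp (min q.1 d.S), d.cl q.2) ⟨⟨(Real.exp_pos _).le, ?_⟩, d.cl_mem _⟩⟩
  exact Real.exp_le_exp.2 (min_le_right _ _)

/-- Truncation makes the field bounded and Lipschitz, so orbits are defined for all times; where `0
≤ x ≤ N` and `s ≤ S` the truncation changes nothing. -/
theorem exists_orbit (t₀ a c : ℝ) : ∃ s x : ℝ → ℝ, d.IsOrbit s x ∧ s t₀ = a ∧ x t₀ = c := by
  obtain ⟨K, hK⟩ := d.exists_lipschitz
  obtain ⟨C, hC⟩ := d.exists_bound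
  obtain ⟨γ, h0, h1⟩ := exists_global_solution (v := fun _ => d.fld) (fun _ => hK)
    (fun _ => continuous_const) (fun _ x => hC x) t₀ ((a, c) : ℝ × ℝ)
  exact ⟨fun t => (γ t).1, fun t => (γ t).2, ⟨fun t => (h1 t).fst, fun t => (h1 t).snd⟩,
    by simp [h0], by simp [h0]⟩

namespace IsOrbit
variable {d} {s x s' x' : ℝ → ℝ}

theorem pair (h : d.IsOrbit s x) (t : ℝ) :
    HasDerivAt (fun t => (s t, x t)) (d.fld (s t, x t)) t := (h.s_deriv t).prodMk (h.x_deriv t)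

theorem continuous_s (h : d.IsOrbit s x) : Continuous s :=
  continuous_iff_continuousAt.2 fun t => (h.s_deriv t).continuousAt

theorem continuous_x (h : d.IsOrbit s x) : Continuous x :=
  continuous_iff_continuousAt.2 fun t => (h.x_deriv t).continuousAt

theorem shift (h : d.IsOrbit s x) (c : ℝ) :
    d.IsOrbit (fun t => s (t + c)) (fun t => x (t + c)) :=
  ⟨fun t => (h.s_deriv (t + c)).comp_add_const t c, fun t => (h.x_deriv (t + c)).comp_add_const t c⟩

/-- The system is autonomous: orbits with a common point are time translates of each other. All
barrier arguments below end with this fact. -/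
theorem unique (h : d.IsOrbit s x) (h' : d.IsOrbit s' x') {a b : ℝ} (hs : s a = s' b)
    (hx : x a = x' b) (t : ℝ) : s (a + t) = s' (b + t) ∧ x (a + t) = x' (b + t) := by
  obtain ⟨K, hK⟩ := d.exists_lipschitz
  have e := ODE_solution_unique_univ (v := fun _ => d.fld) (s := fun _ => univ) (K := K) (t₀ := 0)
    (fun t => hK.lipschitzOnWith)
    (fun t => ⟨(h.shift a).pair t, mem_univ _⟩) (fun t => ⟨(h'.shift b).pair t, mem_univ _⟩)
    (by simp [hs, hx])
  have := congrFun e t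
  simp only [Prod.mk.injEq] at this
  rwa [add_comm t a, add_comm t b] at this

theorem dist_le (d : FlowData) : ∃ K : ℝ, 0 ≤ K ∧ ∀ {s x s' x' : ℝ → ℝ}, d.IsOrbit s x →
    d.IsOrbit s' x' → ∀ {a b τ : ℝ}, 0 ≤ τ → dist (s (a + τ), x (a + τ)) (s' (b + τ), x' (b + τ)) ≤
      dist (s a, x a) (s' b, x' b) * Real.exp (K * τ) := by
  obtain ⟨K, hK⟩ := d.exists_lipschitz
  refine ⟨K, K.2, fun {s x s' x'} h h' {a b τ} hτ => ?_⟩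
  have := dist_le_of_trajectories_ODE (v := fun _ => d.fld) (K := K) (a := 0) (b := τ)
    (f := fun t => (s (t + a), x (t + a))) (g := fun t => (s' (t + b), x' (t + b)))
    (fun _ => hK) (fun t _ => ((h.shift a).pair t).continuousAt.continuousWithinAt)
    (fun t _ => ((h.shift a).pair t).hasDerivWithinAt)
    (fun t _ => ((h'.shift b).pair t).continuousAt.continuousWithinAt)
    (fun t _ => ((h'.shift b).pair t).hasDerivWithinAt) le_rfl τ ⟨hτ, le_rfl⟩
  simp only [zero_add, sub_zero] at this
  rwa [add_comm τ a, add_comm τ b] at this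

end IsOrbit
end FlowData
end PucciLaneEmden
end

/-! ### Signs of the field, and backward return through the half plane `x < al`. -/

noncomputable section
namespace PucciLaneEmden
open Filter Topology Set

namespace FlowData
variable (d : FlowData)

theorem f_le (s x : ℝ) : d.f s x ≤ x ^ 2 + (Real.exp s / d.lam - d.N * x) :=
  add_le_add le_rfl (min_le_right _ _)

/-- The second branch of the field centred at the stationary point. The linear coefficient `N - 2
al` is positive because `p` is supercritical, and the sign of the last term is that of `s - s₀`. -/
theorem second_branch (s A : ℝ) : (d.al + A) ^ 2 + (Real.exp s / d.lam - d.N * (d.al + A)) =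
    A ^ 2 - (d.N - 2 * d.al) * A + d.b * (Real.exp (s - d.s₀) - 1) := by
  rw [d.exp_div_lam]; unfold b; ring

theorem lt_f {s x c : ℝ} (h1 : c < x ^ 2 + Real.exp s / d.Lam)
    (h2 : c < x ^ 2 + (Real.exp s / d.lam - d.N * x)) : c < d.f s x := by
  unfold f
  have := lt_min (a := c - x ^ 2) (b := Real.exp s / d.Lam) (c := Real.exp s / d.lam - d.N * x)
    (by linarith) (by linarith)
  linarith

theorem f_pos_of_left {s x : ℝ} (hs : d.s₀ ≤ s) (hx : x < d.al) : 0 < d.f s x := by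
  have hL := d.Lam_pos
  apply d.lt_f
  · have := Real.exp_pos s
    positivity
  · have h := d.second_branch s (x - d.al)
    rw [add_sub_cancel] at h
    rw [h]
    have h1 : 1 ≤ Real.exp (s - d.s₀) := Real.one_le_exp (by linarith)
    have h2 := mul_nonneg d.b_pos.le (sub_nonneg.2 h1)
    have h3 := d.two_al_lt
    nlinarith [sq_nonneg (x - d.al)]

theorem f_neg_of_right {s x : ℝ} (hs : s ≤ d.s₀) (hx : d.al < x) (hx' : x < d.N - d.al) :
    d.f s x < 0 := by
  refine (d.f_le s x).trans_lt ?_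
  have h := d.second_branch s (x - d.al)
  rw [add_sub_cancel] at h
  rw [h]
  have h1 : Real.exp (s - d.s₀) ≤ 1 := Real.exp_le_one_iff.2 (by linarith)
  have h2 := mul_nonneg d.b_pos.le (sub_nonneg.2 h1)
  nlinarith

theorem f_al_neg {s : ℝ} (hs : s < d.s₀) : d.f s d.al < 0 := by
  refine (d.f_le s d.al).trans_lt ?_
  have h := d.second_branch s 0
  rw [add_zero] at h
  rw [h]
  have h1 : Real.exp (s - d.s₀) < 1 := Real.exp_lt_one_iff.2 (by linarith)
  have h2 := mul_pos d.b_pos (sub_pos.2 h1)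
  linarith

theorem f_al_pos {s : ℝ} (hs : d.s₀ < s) : 0 < d.f s d.al := by
  have hL := d.Lam_pos
  apply d.lt_f
  · have := Real.exp_pos s
    positivity
  · have h := d.second_branch s 0
    rw [add_zero] at h
    rw [h]
    have h1 : 1 < Real.exp (s - d.s₀) := Real.one_lt_exp_iff.2 (by linarith)
    have h2 := mul_pos d.b_pos (sub_pos.2 h1)
    linarith

/-- On `x = N` the second branch reduces to `e^s / lam`. Hence this line is crossed only upwards,
and backward orbits cannot leave through it. -/
theorem f_N_pos (s : ℝ) : 0 < d.f s d.N := by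
  have hL := d.Lam_pos
  have hl := d.lam_pos
  have := Real.exp_pos s
  have := d.N_pos
  apply d.lt_f
  · positivity
  · have : 0 < Real.exp s / d.lam := by positivity
    nlinarith

theorem f_s₀_al : d.f d.s₀ d.al = 0 := by
  have h := d.second_branch d.s₀ 0
  simp only [add_zero, sub_self, Real.exp_zero, mul_zero] at h
  have hL := d.Lam_pos
  have : 0 < Real.exp d.s₀ / d.Lam := div_pos (Real.exp_pos _) hL
  unfold f
  rw [min_eq_right (by nlinarith [sq_nonneg d.al])]
  linarith

/-- Below `s₀` the field is bounded away from zero next to the line `x = al`. This keeps a backward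
orbit that never returns to the line from lingering beside it. -/
theorem exists_left_zone {s₁ : ℝ} (hs : s₁ < d.s₀) : ∃ η > 0, ∃ r > 0, ∀ s x, s ≤ s₁ →
    d.al - η ≤ x → x ≤ d.al → d.f s x ≤ -r := by
  set k := d.b * (1 - Real.exp (s₁ - d.s₀)) with hk
  have hk0 : 0 < k := mul_pos d.b_pos (sub_pos.2 (Real.exp_lt_one_iff.2 (by linarith)))
  have ha : 0 < d.N - 2 * d.al := by linarith [d.two_al_lt]
  set a := d.N - 2 * d.al
  refine ⟨min 1 (k / (2 * (1 + a))), lt_min one_pos (by positivity), k / 2, by positivity,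
    fun s x h1 h2 h3 => (d.f_le s x).trans ?_⟩
  have h := d.second_branch s (x - d.al)
  rw [add_sub_cancel] at h
  rw [h]
  have e1 : Real.exp (s - d.s₀) ≤ Real.exp (s₁ - d.s₀) := Real.exp_le_exp.2 (by linarith)
  have e2 := mul_le_mul_of_nonneg_left e1 d.b_pos.le
  have m1 := min_le_left 1 (k / (2 * (1 + a)))
  have m2 := min_le_right 1 (k / (2 * (1 + a)))
  set A := d.al - x with hA
  have hA0 : 0 ≤ A := by linarith
  have hA1 : A ≤ 1 := by linarith
  have hA2 : A * (2 * (1 + a)) ≤ k := by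
    rw [← le_div_iff₀ (by positivity)]; linarith
  have e3 : (x - d.al) ^ 2 = A ^ 2 := by rw [hA]; ring
  have e4 : x - d.al = -A := by rw [hA]; ring
  have e5 : A ^ 2 ≤ A := by nlinarith
  rw [e3, e4]
  nlinarith

theorem exists_right_zone {s₁ : ℝ} (hs : d.s₀ < s₁) : ∃ η > 0, ∃ r > 0, ∀ s x, s₁ ≤ s →
    d.al ≤ x → x ≤ d.al + η → r ≤ d.f s x := by
  set k := d.b * (Real.exp (s₁ - d.s₀) - 1) with hk
  have hk0 : 0 < k := mul_pos d.b_pos (sub_pos.2 (Real.one_lt_exp_iff.2 (by linarith)))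
  have ha : 0 < d.N - 2 * d.al := by linarith [d.two_al_lt]
  set a := d.N - 2 * d.al
  have hal := d.al_pos
  refine ⟨k / (2 * a), by positivity, min (d.al ^ 2 / 2) (k / 4),
    lt_min (by positivity) (by positivity), fun s x h1 h2 h3 => le_of_lt ?_⟩
  have e1 : Real.exp (s₁ - d.s₀) ≤ Real.exp (s - d.s₀) := Real.exp_le_exp.2 (by linarith)
  have e2 := mul_le_mul_of_nonneg_left e1 d.b_pos.le
  apply d.lt_f
  · refine (min_le_left _ _).trans_lt ?_
    have : 0 < Real.exp s / d.Lam := div_pos (Real.exp_pos _) d.Lam_pos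
    nlinarith
  · refine (min_le_right _ _).trans_lt ?_
    have h := d.second_branch s (x - d.al)
    rw [add_sub_cancel] at h
    rw [h]
    have hA2 : (x - d.al) * (2 * a) ≤ k := by
      rw [← le_div_iff₀ (by positivity)]; linarith
    nlinarith [sq_nonneg (x - d.al)]

namespace IsOrbit
variable {d} {s x s' x' : ℝ → ℝ}

theorem s_deriv' (h : d.IsOrbit s x) {t : ℝ} (h0 : 0 ≤ x t) (h1 : x t ≤ d.N) :
    HasDerivAt s ((d.p - 1) * (d.al - x t)) t := by
  simpa only [d.cl_of_mem h0 h1] using h.s_deriv t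

theorem x_deriv' (h : d.IsOrbit s x) {t : ℝ} (h0 : 0 ≤ x t) (h1 : x t ≤ d.N) (h2 : s t ≤ d.S) :
    HasDerivAt x (d.f (s t) (x t)) t := by
  simpa only [d.cl_of_mem h0 h1, min_eq_left h2] using h.x_deriv t

theorem x_deriv_al (h : d.IsOrbit s x) {t : ℝ} (h0 : x t = d.al) (h2 : s t ≤ d.S) :
    HasDerivAt x (d.f (s t) d.al) t := by
  have := h.x_deriv' (t := t) (by rw [h0]; exact d.al_pos.le) (by rw [h0]; exact d.al_lt_N.le) h2
  rwa [h0] at this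

theorem strictMonoOn (h : d.IsOrbit s x) {a b : ℝ} (hx : ∀ t ∈ Ioo a b, x t < d.al) :
    StrictMonoOn s (Icc a b) := by
  apply strictMonoOn_of_deriv_pos (convex_Icc _ _) h.continuous_s.continuousOn
  intro t ht
  rw [interior_Icc] at ht
  rw [(h.s_deriv t).deriv]
  exact mul_pos (by linarith [d.p_gt_one]) (by linarith [d.cl_lt (hx t ht)])

theorem strictAntiOn (h : d.IsOrbit s x) {a b : ℝ} (hx : ∀ t ∈ Ioo a b, d.al < x t) :
    StrictAntiOn s (Icc a b) := by
  apply strictAntiOn_of_deriv_neg (convex_Icc _ _) h.continuous_s.continuousOn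
  intro t ht
  rw [interior_Icc] at ht
  rw [(h.s_deriv t).deriv]
  exact mul_neg_of_pos_of_neg (by linarith [d.p_gt_one]) (by linarith [d.lt_cl (hx t ht)])

theorem eq_al_of_stationary (h : d.IsOrbit s x) (hS : d.s₀ ≤ d.S) {t : ℝ} (hs : s t = d.s₀)
    (hx : x t = d.al) (r : ℝ) : x r = d.al := by
  have hc : d.IsOrbit (fun _ => d.s₀) (fun _ => d.al) :=
    ⟨fun t => by
      simpa [d.cl_of_mem d.al_pos.le d.al_lt_N.le] using hasDerivAt_const t d.s₀,
    fun t => by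
      simpa [d.cl_of_mem d.al_pos.le d.al_lt_N.le, min_eq_left hS, d.f_s₀_al] using
        hasDerivAt_const t d.al⟩
  have := (h.unique hc (a := t) (b := 0) hs hx (r - t)).2
  simpa using this

/-- At the beginning of a piece with `x < al` the first coordinate is below `s₀`. -/
theorem s_lt_of_left_start (h : d.IsOrbit s x) (hS : d.s₀ ≤ d.S) {a b : ℝ} (hab : a < b)
    (ha : x a = d.al) (hs : s a ≤ d.S) (hx : ∀ t ∈ Ioo a b, x t < d.al) : s a < d.s₀ := by
  have h1 := deriv_nonneg_of_pos_right hab ((h.x_deriv_al ha hs).const_sub d.al)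
    (by simp [ha]) (fun t ht => sub_pos.2 (hx t ht))
  by_contra hge
  rcases lt_or_eq_of_le (not_lt.1 hge) with h2 | h2
  · linarith [d.f_al_pos h2]
  · have := h.eq_al_of_stationary hS h2.symm ha ((a + b) / 2)
    exact absurd this (hx _ ⟨by linarith, by linarith⟩).ne

/-- At the beginning of a piece with `al < x` the first coordinate is above `s₀`. -/
theorem lt_s_of_right_start (h : d.IsOrbit s x) (hS : d.s₀ ≤ d.S) {a b : ℝ} (hab : a < b)
    (ha : x a = d.al) (hs : s a ≤ d.S) (hx : ∀ t ∈ Ioo a b, d.al < x t) : d.s₀ < s a := by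
  have h1 := deriv_nonneg_of_pos_right hab ((h.x_deriv_al ha hs).sub_const d.al)
    (by simp [ha]) (fun t ht => sub_pos.2 (hx t ht))
  by_contra hge
  rcases lt_or_eq_of_le (not_lt.1 hge) with h2 | h2
  · linarith [d.f_al_neg h2]
  · have := h.eq_al_of_stationary hS h2 ha ((a + b) / 2)
    exact absurd this (hx _ ⟨by linarith, by linarith⟩).ne'

/-- At the end of a piece with `x < al` the first coordinate is above `s₀`. -/
theorem lt_s_of_left_end (h : d.IsOrbit s x) (hS : d.s₀ ≤ d.S) {a b : ℝ} (hab : a < b)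
    (hb : x b = d.al) (hs : s b ≤ d.S) (hx : ∀ t ∈ Ioo a b, x t < d.al) : d.s₀ < s b := by
  have h1 := deriv_nonpos_of_pos_left hab ((h.x_deriv_al hb hs).const_sub d.al)
    (by simp [hb]) (fun t ht => sub_pos.2 (hx t ht))
  by_contra hge
  rcases lt_or_eq_of_le (not_lt.1 hge) with h2 | h2
  · linarith [d.f_al_neg h2]
  · have := h.eq_al_of_stationary hS h2 hb ((a + b) / 2)
    exact absurd this (hx _ ⟨by linarith, by linarith⟩).ne

/-- Orbits staying to the left of `al` for all negative times have `x = O(exp s)`. -/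
theorem x_le_mul_exp (h : d.IsOrbit s x) {t₀ : ℝ}
    (hx : ∀ t ≤ t₀, 0 < x t ∧ x t < d.al ∧ s t ≤ d.S) {t : ℝ} (ht : t ≤ t₀) :
    x t ≤ 4 / (d.lam * d.N) * Real.exp (s t) := by
  have hN := d.N_pos
  have hl := d.lam_pos
  have hal := d.al_lt_N
  have h2al := d.two_al_lt
  have hp := d.p_gt_one
  set K := 4 / (d.lam * d.N) with hK
  have hK0 : 0 < K := by positivity
  have hxd : ∀ r ≤ t₀, HasDerivAt x (d.f (s r) (x r)) r := fun r hr =>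
    h.x_deriv' (hx r hr).1.le (by linarith [(hx r hr).2.1]) (hx r hr).2.2
  have hsd : ∀ r ≤ t₀, HasDerivAt s ((d.p - 1) * (d.al - x r)) r := fun r hr =>
    h.s_deriv' (hx r hr).1.le (by linarith [(hx r hr).2.1])
  have hf : ∀ r ≤ t₀, K * Real.exp (s r) ≤ x r → d.f (s r) (x r) ≤ -(d.N / 4 * x r) := by
    intro r hr hle
    refine (d.f_le _ _).trans ?_
    have e1 : Real.exp (s r) / d.lam ≤ d.N / 4 * x r := by
      have : Real.exp (s r) / d.lam = d.N / 4 * (K * Real.exp (s r)) := by rw [hK]; field_simp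
      rw [this]; exact mul_le_mul_of_nonneg_left hle (by positivity)
    nlinarith [hx r hr]
  -- Above the curve `x = K e^s` one has `x' ≤ -(N/4) x`, because `x < al < N/2`. An orbit above it
  -- at one time is above it at all earlier times, and its `x` grows backwards at least linearly,
  -- past `al`.
  by_contra hlt
  push Not at hlt
  have hge : ∀ r ≤ t, K * Real.exp (s r) ≤ x r := by
    intro r hr
    have := ge_of_deriv_neg_at_level (φ := fun r => x r - K * Real.exp (s r)) (m := 0) hr
      (fun q hq => (hxd q (hq.2.trans ht)).sub (((hsd q (hq.2.trans ht)).exp).const_mul K))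
      (fun q hq hq0 => by
        have h1 := hf q (hq.2.trans ht) (by linarith)
        have h2 := hx q (hq.2.trans ht)
        have h3 : 0 < d.N / 4 * x q := mul_pos (by positivity) h2.1
        have h4 : 0 ≤ K * (Real.exp (s q) * ((d.p - 1) * (d.al - x q))) := by
          have : 0 ≤ (d.p - 1) * (d.al - x q) := mul_nonneg (by linarith) (by linarith)
          have := Real.exp_pos (s q)
          positivity
        linarith) (by linarith)
    linarith
  have hxge : ∀ r ≤ t, x t ≤ x r := by
    intro r hr
    have := sub_le_mul_of_deriv_le (r := 0) hr (fun q hq => hxd q (hq.2.trans ht)) (fun q hq => by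
      have h1 := hf q (hq.2.trans ht) (hge q hq.2)
      have h3 : 0 < d.N / 4 * x q := mul_pos (by positivity) (hx q (hq.2.trans ht)).1
      linarith)
    linarith
  have hxt := hx t ht
  set c := d.N / 4 * x t with hc
  have hc0 : 0 < c := mul_pos (by positivity) hxt.1
  have := sub_le_mul_of_deriv_le (r := -c) (a := t - d.al / c) (b := t)
    (by have : 0 < d.al / c := div_pos d.al_pos hc0
        linarith)
    (fun q hq => hxd q (hq.2.trans ht)) (fun q hq => by
      have h1 := hf q (hq.2.trans ht) (hge q hq.2)
      have h3 := mul_le_mul_of_nonneg_left (hxge q hq.2) (by positivity : 0 ≤ d.N / 4)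
      linarith)
  have e : -c * (t - (t - d.al / c)) = -d.al := by field_simp; ring
  rw [e] at this
  have := hx (t - d.al / c) (by have : 0 < d.al / c := div_pos d.al_pos hc0
                                linarith)
  linarith

end IsOrbit

/-- The regular orbit up to its first arrival at `al`. -/
structure IsRegular (s x : ℝ → ℝ) (t₁ : ℝ) : Prop where
  orbit : d.IsOrbit s x
  left : ∀ t < t₁, 0 < x t ∧ x t < d.al
  at_end : x t₁ = d.al
  tendsto : Tendsto s atBot atBot
  le_S : s t₁ ≤ d.S

namespace IsRegular
variable {d} {sg xg s x : ℝ → ℝ} {t₁ : ℝ}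

theorem strictMonoOn (hg : d.IsRegular sg xg t₁) : StrictMonoOn sg (Iic t₁) := by
  intro a ha b hb hab
  exact hg.orbit.strictMonoOn (a := a) (b := t₁) (fun t ht => (hg.left t ht.2).2)
    ⟨le_rfl, ha⟩ ⟨hab.le, hb⟩ hab

theorem s_le (hg : d.IsRegular sg xg t₁) {t : ℝ} (ht : t ≤ t₁) : sg t ≤ d.S :=
  (hg.strictMonoOn.monotoneOn ht (mem_Iic.2 le_rfl) ht).trans hg.le_S

theorem exists_eq (hg : d.IsRegular sg xg t₁) {y : ℝ} (hy : y < sg t₁) : ∃ τ < t₁, sg τ = y := by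
  obtain ⟨a, ha1, ha2⟩ := ((hg.tendsto.eventually (eventually_lt_atBot y)).and
    (eventually_lt_atBot t₁)).exists
  obtain ⟨τ, hτ, hτy⟩ := intermediate_value_Icc ha2.le hg.orbit.continuous_s.continuousOn
    (show y ∈ Icc (sg a) (sg t₁) from ⟨ha1.le, hy.le⟩)
  refine ⟨τ, lt_of_le_of_ne hτ.2 ?_, hτy⟩
  rintro rfl
  exact hy.ne' hτy

/-- Orbits arriving at `al` below the regular orbit stay to its right in backward time. -/
theorem barrier (hg : d.IsRegular sg xg t₁) (h : d.IsOrbit s x) {t₀ : ℝ} (hx0 : x t₀ = d.al)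
    (hs1 : s t₀ < sg t₁) {t : ℝ} (ht : t < t₀)
    (hx : ∀ r ∈ Ico t t₀, x r < d.al) : ∃ τ < t₁, sg τ = s t ∧ xg τ < x t := by
  have hmono := h.strictMonoOn (a := t) (b := t₀) fun r hr => hx r ⟨hr.1.le, hr.2⟩
  have hst : s t < s t₀ := hmono ⟨le_rfl, ht.le⟩ ⟨ht.le, le_rfl⟩ ht
  obtain ⟨τ, hτ, hτs⟩ := hg.exists_eq (hst.trans hs1)
  refine ⟨τ, hτ, hτs, ?_⟩
  by_contra hle
  obtain ⟨τ', hτ', hτs'⟩ := hg.exists_eq hs1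
  have hττ' : τ < τ' := by
    rw [← hg.strictMonoOn.lt_iff_lt hτ.le hτ'.le, hτs, hτs']; exact hst
  obtain ⟨r₁, hr1, r₂, hr2, e1, e2⟩ := exists_graphs_meet ht.le hτ.le h.continuous_s.continuousOn
    hg.orbit.continuous_s.continuousOn h.continuous_x.continuousOn
    hg.orbit.continuous_x.continuousOn hmono (hg.strictMonoOn.mono fun r hr => hr.2) hst.le
    (tc₁ := t) (tc₂ := τ) (td₁ := t₀) (td₂ := τ') ⟨le_rfl, ht.le⟩ ⟨le_rfl, hτ.le⟩ ⟨ht.le, le_rfl⟩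
    ⟨hττ'.le, hτ'.le⟩ rfl hτs rfl hτs' (not_lt.1 hle) (by rw [hx0]; exact (hg.left τ' hτ').2.le)
  have hu := h.unique hg.orbit e1 e2
  -- A meeting point makes the two orbits translates. Neither can reach `al` while the other is
  -- still to its left, and reaching it together contradicts the different arrival heights.
  rcases lt_trichotomy (r₂ + (t₀ - r₁)) t₁ with h1 | h1 | h1
  · have := (hu (t₀ - r₁)).2
    rw [add_sub_cancel, hx0] at this
    exact absurd this (hg.left _ h1).2.ne'
  · have := (hu (t₀ - r₁)).1
    rw [add_sub_cancel, h1] at this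
    exact hs1.ne this
  · have := (hu (t₁ - r₂)).2
    rw [add_sub_cancel, hg.at_end] at this
    exact absurd this (hx _ ⟨by linarith [hr1.1, hr2.2], by linarith⟩).ne

set_option maxHeartbeats 1000000 in
/-- Two distinct regular orbits cannot coexist. -/
theorem not_ordered (hg : d.IsRegular sg xg t₁) (h : d.IsOrbit s x) {t₀ : ℝ}
    (hx : ∀ t < t₀, 0 < x t ∧ x t < d.al ∧ s t ≤ d.S) (hst : Tendsto s atBot atBot)
    (hord : ∀ t < t₀, ∃ τ < t₁, sg τ = s t ∧ xg τ < x t) : False := by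
  have hN := d.N_pos
  have hl := d.lam_pos
  have hL := d.Lam_pos
  have hal := d.al_pos
  have halN := d.al_lt_N
  have hp := d.p_gt_one
  have hpal := d.p_mul_al
  set K := 4 / (d.lam * d.N) with hK
  have hK0 : 0 < K := by positivity
  have hxK : ∀ t < t₀, x t ≤ K * Real.exp (s t) := fun t ht =>
    h.x_le_mul_exp (t₀ := t) (fun r hr => hx r (hr.trans_lt ht)) le_rfl
  have hgK : ∀ t < t₁, xg t ≤ K * Real.exp (sg t) := fun t ht =>
    hg.orbit.x_le_mul_exp (t₀ := t) (fun r hr => ⟨(hg.left r (hr.trans_lt ht)).1,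
      (hg.left r (hr.trans_lt ht)).2, hg.s_le (hr.trans ht.le)⟩) le_rfl
  have hY : Tendsto (fun t => Real.exp (s t)) atBot (𝓝 0) := Real.tendsto_exp_atBot.comp hst
  have hev : ∀ c C : ℝ, 0 < c → ∀ᶠ t in atBot, C * Real.exp (s t) < c := fun c C hc => by
    have := (hY.const_mul C)
    rw [mul_zero] at this
    exact this.eventually (gt_mem_nhds hc)
  have hsmall : ∀ᶠ t in atBot, K * Real.exp (s t) ≤ 1 / 8 ∧ (d.p - 1) * K * Real.exp (s t) ≤ 1 / 4 ∧
      K * Real.exp (s t) ≤ d.al / 2 ∧ K * Real.exp (s t) ≤ d.al / 2 ∧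
      Real.exp (s t) / d.Lam ≤ d.al / 16 := by
    filter_upwards [hev (1 / 8) K (by norm_num), hev (1 / 4) ((d.p - 1) * K) (by norm_num),
      hev (d.al / 2) K (by positivity), hev (d.al / 16) (1 / d.Lam) (by positivity)]
      with t a1 a2 a3 a4
    refine ⟨a1.le, a2.le, a3.le, a3.le, ?_⟩
    rw [div_eq_inv_mul, ← one_div]; exact a4.le
  obtain ⟨T, hT⟩ := eventually_atBot.1 hsmall
  set ta := min T (t₀ - 1) with hta
  have hta0 : ta < t₀ := (min_le_right _ _).trans_lt (by linarith)
  have htaT : ta ≤ T := min_le_left _ _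
  obtain ⟨τa, hτa, hτas, hτax⟩ := hord ta hta0
  set Da := (x ta - xg τa) * Real.exp (-s ta) with hDa
  have hDa0 : 0 < Da := mul_pos (by linarith) (Real.exp_pos _)
  -- Below, `D ≤ K` and `D' ≤ -D`. As `D ≥ Da` at earlier times, going back by `K / Da` adds at
  -- least `K` to `D`, too much for the bound.
  set tb := ta - K / Da with htb
  have htba : tb ≤ ta := by
    have : 0 ≤ K / Da := by positivity
    linarith
  obtain ⟨τb, hτb, hτbs, -⟩ := hord tb (htba.trans_lt hta0)
  have hmono := h.strictMonoOn (a := tb) (b := ta) fun r hr => (hx r (hr.2.trans hta0)).2.1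
  obtain ⟨g, hgc, hgi⟩ := exists_continuous_inverse (s := sg) (a := τb - 1) (b := t₁)
    (by linarith) hg.orbit.continuous_s.continuousOn (hg.strictMonoOn.mono fun r hr => hr.2)
  have hlow : sg (τb - 1) < s tb := by
    rw [← hτbs]
    exact hg.strictMonoOn (mem_Iic.2 (by linarith)) hτb.le (by linarith)
  have hmem : ∀ t ∈ Icc tb ta, s t ∈ Ioo (sg (τb - 1)) (sg t₁) := by
    intro t ht
    refine ⟨hlow.trans_le (hmono.monotoneOn ⟨le_rfl, htba⟩ ht ht.1), ?_⟩
    obtain ⟨τ, hτ, hτs, -⟩ := hord t (ht.2.trans_lt hta0)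
    rw [← hτs]
    exact hg.strictMonoOn hτ.le (mem_Iic.2 le_rfl) hτ
  have hgs : ∀ t ∈ Icc tb ta, ∀ τ < t₁, sg τ = s t → g (s t) = τ := by
    intro t ht τ hτ he
    have := hgi (s t) ⟨(hmem t ht).1.le, (hmem t ht).2.le⟩
    exact hg.strictMonoOn.injOn (mem_Iic.2 this.1.2) hτ.le (this.2.trans he.symm)
  -- The gap between the two orbits at the same height `s`, rescaled by `e^s`, the order at which
  -- both first components of the solution vanish.
  set D : ℝ → ℝ := fun t => (x t - xg (g (s t))) * Real.exp (-s t) with hD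
  have hDd : ∀ t ∈ Icc tb ta, ∃ D', HasDerivAt D D' t ∧ 0 < D t ∧ D t ≤ K ∧ D' ≤ -D t := by
    intro t ht
    have htt := ht.2.trans_lt hta0
    obtain ⟨τ, hτ, hτs, hτx⟩ := hord t htt
    have hgt := hgs t ht τ hτ hτs
    obtain ⟨hx0, hxal, hsS⟩ := hx t htt
    obtain ⟨hy0, hyal⟩ := hg.left τ hτ
    have hsd := h.s_deriv' hx0.le (hxal.le.trans halN.le)
    have hxd := h.x_deriv' hx0.le (hxal.le.trans halN.le) hsS
    have hsgd := hg.orbit.s_deriv' hy0.le (hyal.le.trans halN.le)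
    have hxgd := hg.orbit.x_deriv' hy0.le (hyal.le.trans halN.le) (hg.s_le hτ.le)
    have hne : (d.p - 1) * (d.al - xg τ) ≠ 0 := (mul_pos (by linarith) (by linarith)).ne'
    have hgd : HasDerivAt g ((d.p - 1) * (d.al - xg τ))⁻¹ (s t) := by
      apply HasDerivAt.of_local_left_inverse (f := sg) hgc.continuousAt (by rw [hgt]; exact hsgd) hne
      filter_upwards [Ioo_mem_nhds (hmem t ht).1 (hmem t ht).2] with y hy
      exact (hgi y ⟨hy.1.le, hy.2.le⟩).2
    have hcomp : HasDerivAt (fun t => xg (g (s t)))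
        (d.f (sg τ) (xg τ) * (((d.p - 1) * (d.al - xg τ))⁻¹ * ((d.p - 1) * (d.al - x t)))) t := by
      have h1 : HasDerivAt xg (d.f (sg τ) (xg τ)) (g (s t)) := by rw [hgt]; exact hxgd
      exact HasDerivAt.comp t h1 (hgd.comp t hsd)
    have hE := Real.exp_pos (-s t)
    have hDt : D t = (x t - xg τ) * Real.exp (-s t) := by simp only [hD, hgt]
    refine ⟨_, (hxd.sub hcomp).mul hsd.neg.exp, ?_, ?_, ?_⟩
    · rw [hDt]; exact mul_pos (by linarith) hE
    · rw [hDt]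
      have e : K = K * Real.exp (s t) * Real.exp (-s t) := by
        rw [mul_assoc, ← Real.exp_add]; simp
      rw [e]
      exact mul_le_mul_of_nonneg_right (by linarith [hxK t htt]) hE.le
    · rw [hDt]
      obtain ⟨k1, k2, k3, k4, k5⟩ := hT t (ht.2.trans htaT)
      have hxk := hxK t htt
      have hyk : xg τ ≤ K * Real.exp (s t) := by rw [← hτs]; exact hgK τ hτ
      set y := xg τ
      set X := x t
      have hq : 0 < X - y := by linarith
      have hfd : d.f (s t) X - d.f (s t) y ≤ X ^ 2 - y ^ 2 := by
        have : min (Real.exp (s t) / d.Lam) (Real.exp (s t) / d.lam - d.N * X) ≤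
            min (Real.exp (s t) / d.Lam) (Real.exp (s t) / d.lam - d.N * y) :=
          min_le_min le_rfl (by nlinarith)
        unfold f; linarith
      have hF : d.f (s t) y ≤ (d.al - y) / 4 := by
        have : d.f (s t) y ≤ y ^ 2 + Real.exp (s t) / d.Lam :=
          add_le_add le_rfl (min_le_left _ _)
        nlinarith
      have hratio : ((d.p - 1) * (d.al - y))⁻¹ * ((d.p - 1) * (d.al - X)) =
          1 - (X - y) / (d.al - y) := by
        have h1 : d.al - y ≠ 0 := by linarith
        have h2 : d.p - 1 ≠ 0 := by linarith
        field_simp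
        ring
      have hFq : d.f (s t) y * ((X - y) / (d.al - y)) ≤ (X - y) / 4 := by
        have h1 : 0 < (X - y) / (d.al - y) := div_pos hq (by linarith)
        have h2 := mul_le_mul_of_nonneg_right hF h1.le
        have h3 : (d.al - y) / 4 * ((X - y) / (d.al - y)) = (X - y) / 4 := by
          have h1 : d.al - y ≠ 0 := by linarith
          field_simp
        linarith
      have hpx : (d.p - 1) * X ≤ 1 / 4 := by
        have := mul_le_mul_of_nonneg_left hxk (by linarith : 0 ≤ d.p - 1)
        linarith
      -- With `q = X - y`: the rescaling contributes `-(2 - (p-1) X) q ≤ -(7/4) q` since `(p-1) al =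
      -- 2`, while the difference of the fields and the change of speed contribute at most `q / 4`
      -- each.
      have hmain : d.f (s t) X - d.f (s t) y * (1 - (X - y) / (d.al - y)) -
          (X - y) * ((d.p - 1) * (d.al - X)) ≤ -(X - y) := by
        have e1 : (X - y) * ((d.p - 1) * (d.al - X)) = (X - y) * (2 - (d.p - 1) * X) := by
          rw [← hpal]; ring
        rw [e1]
        nlinarith
      simp only [Pi.sub_apply, Pi.neg_apply, hgt]
      rw [hτs, hratio]
      have := mul_le_mul_of_nonneg_right hmain hE.le
      linarith
  choose! D' hDd using hDd
  have hData : D ta = Da := by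
    simp only [hD, hDa, hgs ta ⟨htba, le_rfl⟩ τa hτa hτas]
  have hge : ∀ t ∈ Icc tb ta, Da ≤ D t := by
    intro t ht
    exact ge_of_deriv_neg_at_level ht.2 (fun r hr => (hDd r ⟨ht.1.trans hr.1, hr.2⟩).1)
      (fun r hr _ => by
        have := hDd r ⟨ht.1.trans hr.1, hr.2⟩
        linarith [this.2.1, this.2.2.2]) hData.ge
  have hfin := sub_le_mul_of_deriv_le (r := -Da) htba (fun t ht => (hDd t ht).1)
    (fun t ht => by linarith [(hDd t ht).2.2.2, hge t ht])
  have e : -Da * (ta - tb) = -K := by rw [htb]; field_simp; ring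
  rw [e, hData] at hfin
  have := (hDd tb ⟨le_rfl, htba⟩).2.2.1
  linarith

/-- Backward return through the left half plane. -/
theorem left_return (hg : d.IsRegular sg xg t₁) (h : d.IsOrbit s x) {t₀ : ℝ} (hx0 : x t₀ = d.al)
    (hs0 : d.s₀ < s t₀) (hs1 : s t₀ < sg t₁) :
    ∃ τ < t₀, x τ = d.al ∧ (∀ t ∈ Ioo τ t₀, 0 < x t ∧ x t < d.al) ∧ s τ < d.s₀ := by
  have hS : d.s₀ ≤ d.S := (hs0.trans hs1).le.trans hg.le_S
  have hp := d.p_gt_one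
  have hd0 := h.x_deriv_al hx0 (hs1.le.trans hg.le_S)
  obtain ⟨ε, hε, -, hεx⟩ := exists_pos_right_of_deriv_pos (hd0.sub_const d.al) (by simp [hx0])
    (d.f_al_pos hs0)
  set t' := t₀ - ε / 2 with ht'
  have hnear : ∀ t ∈ Ico t' t₀, x t < d.al := fun t ht => by
    have := hεx t ⟨by linarith [ht.1], ht.2⟩
    linarith
  -- If the backward orbit meets the line again, its latest such time is the return. Otherwise it
  -- stays in the left half plane, tends to `s = -∞`, and is a second regular orbit, excluded by
  -- `not_ordered`.
  by_cases hret : ∃ t < t₀, d.al ≤ x t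
  · obtain ⟨t, ht, htx⟩ := hret
    have htt' : t < t' := by
      by_contra hge
      linarith [hnear t ⟨not_lt.1 hge, ht⟩]
    obtain ⟨c, hc, hc0, hcp⟩ := exists_last_zero (φ := fun r => d.al - x r) (a := t) (b := t')
      (continuous_const.sub h.continuous_x).continuousOn htt'.le (by linarith)
      (by linarith [hnear t' ⟨le_rfl, by linarith⟩])
    have hcx : x c = d.al := by linarith
    have hct : c < t₀ := by linarith [hc.2]
    have hin : ∀ r ∈ Ioo c t₀, x r < d.al := fun r hr => by
      rcases le_total r t' with h1 | h1
      · linarith [hcp r ⟨hr.1, h1⟩]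
      · exact hnear r ⟨h1, hr.2⟩
    have hsc : s c ≤ s t₀ := (h.strictMonoOn hin).monotoneOn ⟨le_rfl, hct.le⟩ ⟨hct.le, le_rfl⟩ hct.le
    refine ⟨c, hct, hcx, fun r hr => ⟨?_, hin r hr⟩, ?_⟩
    · obtain ⟨τ, hτ, -, hτx⟩ := hg.barrier h hx0 hs1 hr.2
        (fun q hq => hin q ⟨hr.1.trans_le hq.1, hq.2⟩)
      exact (hg.left τ hτ).1.trans hτx
    · exact h.s_lt_of_left_start hS hct hcx (hsc.trans (hs1.le.trans hg.le_S)) hin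
  · exfalso
    push Not at hret
    have hbar : ∀ t < t₀, ∃ τ < t₁, sg τ = s t ∧ xg τ < x t := fun t ht =>
      hg.barrier h hx0 hs1 ht fun r hr => hret r hr.2
    have hpos : ∀ t < t₀, 0 < x t := fun t ht => by
      obtain ⟨τ, hτ, -, hτx⟩ := hbar t ht
      exact (hg.left τ hτ).1.trans hτx
    have hsS : ∀ t < t₀, s t ≤ d.S := fun t ht => by
      obtain ⟨τ, hτ, hτs, -⟩ := hbar t ht
      rw [← hτs]; exact hg.s_le hτ.le
    have halN := d.al_lt_N
    have hxd : ∀ t < t₀, HasDerivAt x (d.f (s t) (x t)) t := fun t ht =>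
      h.x_deriv' (hpos t ht).le ((hret t ht).le.trans halN.le) (hsS t ht)
    have hsd : ∀ t < t₀, HasDerivAt s ((d.p - 1) * (d.al - x t)) t := fun t ht =>
      h.s_deriv' (hpos t ht).le ((hret t ht).le.trans halN.le)
    have ht't : t' < t₀ := by linarith
    -- the orbit reaches the left lower quadrant
    obtain ⟨t₂, ht2, ht2s⟩ : ∃ t₂ < t₀, s t₂ < d.s₀ := by
      by_contra hcon
      push Not at hcon
      have hxle : ∀ t ≤ t', x t ≤ x t' := fun t ht => by
        have := mul_sub_le_of_le_deriv (r := 0) ht (fun q hq => hxd q (hq.2.trans_lt ht't))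
          (fun q hq => (d.f_pos_of_left (hcon q (hq.2.trans_lt ht't))
            (hret q (hq.2.trans_lt ht't))).le)
        linarith
      set r := (d.p - 1) * (d.al - x t') with hr
      have hr0 : 0 < r := mul_pos (by linarith) (by linarith [hret t' ht't])
      have hle : t' - (s t' - d.s₀ + 1) / r ≤ t' := by
        have : 0 ≤ (s t' - d.s₀ + 1) / r := div_nonneg (by linarith [hcon t' ht't]) hr0.le
        linarith
      have := mul_sub_le_of_le_deriv (r := r) hle (fun q hq => hsd q (hq.2.trans_lt ht't))
        (fun q hq => mul_le_mul_of_nonneg_left (by linarith [hxle q hq.2]) (by linarith))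
      have e : r * (t' - (t' - (s t' - d.s₀ + 1) / r)) = s t' - d.s₀ + 1 := by field_simp; ring
      rw [e] at this
      linarith [hcon _ (hle.trans_lt ht't)]
    have hsle : ∀ t ≤ t₂, s t ≤ s t₂ := fun t ht =>
      (h.strictMonoOn (a := t) (b := t₂) fun r hr => hret r (hr.2.trans ht2)).monotoneOn
        ⟨le_rfl, ht⟩ ⟨ht, le_rfl⟩ ht
    obtain ⟨η, hη, r, hr, hzone⟩ := d.exists_left_zone ht2s
    have hfar : ∀ t ≤ t₂, x t < d.al - η := by
      intro t ht
      by_contra hge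
      push Not at hge
      have hge' : ∀ q ≤ t, d.al - η ≤ x q := fun q hq =>
        ge_of_deriv_neg_at_level hq (fun w hw => hxd w ((hw.2.trans ht).trans_lt ht2))
          (fun w hw hwe => by
            have := hzone (s w) (x w) (hsle w (hw.2.trans ht)) hwe.ge (by linarith)
            linarith) hge
      have hle : t - (η + 1) / r ≤ t := by
        have : 0 ≤ (η + 1) / r := by positivity
        linarith
      have := sub_le_mul_of_deriv_le (r := -r) hle
        (fun q hq => hxd q ((hq.2.trans ht).trans_lt ht2))
        (fun q hq => hzone _ _ (hsle q (hq.2.trans ht)) (hge' q hq.2)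
          (hret q ((hq.2.trans ht).trans_lt ht2)).le)
      have e : -r * (t - (t - (η + 1) / r)) = -(η + 1) := by field_simp; ring
      rw [e] at this
      linarith [hret _ ((hle.trans ht).trans_lt ht2)]
    have htend : Tendsto s atBot atBot := by
      have hc : 0 < (d.p - 1) * η := mul_pos (by linarith) hη
      have hlin : Tendsto (fun t => s t₂ - (d.p - 1) * η * (t₂ - t)) atBot atBot := by
        have : Tendsto (fun t : ℝ => (d.p - 1) * η * t + (s t₂ - (d.p - 1) * η * t₂)) atBot atBot :=
          tendsto_atBot_add_const_right _ _ (tendsto_id.const_mul_atBot hc)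
        exact this.congr fun t => by ring
      refine tendsto_atBot_mono' _ ?_ hlin
      filter_upwards [eventually_le_atBot t₂] with t ht
      have := mul_sub_le_of_le_deriv (r := (d.p - 1) * η) ht
        (fun q hq => hsd q (hq.2.trans_lt ht2))
        (fun q hq => mul_le_mul_of_nonneg_left (by linarith [hfar q hq.2]) (by linarith))
      linarith
    exact hg.not_ordered h (fun t ht => ⟨hpos t ht, hret t ht, hsS t ht⟩) htend hbar

end IsRegular
end FlowData
end PucciLaneEmden
end

/-! ### Nested arcs, the regular orbit that reaches `x = N`, and return through `x > al`. -/

noncomputable section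
namespace PucciLaneEmden
open Filter Topology Set

/-- Two arcs of trajectories with ends on a common line are nested. -/
theorem arcs_nested {s₁ x₁ s₂ x₂ : ℝ → ℝ} {a₁ b₁ a₂ b₂ m : ℝ} (h1 : a₁ < b₁) (h2 : a₂ < b₂)
    (hs1 : Continuous s₁) (hs2 : Continuous s₂) (hx1 : Continuous x₁) (hx2 : Continuous x₂)
    (hm1 : StrictMonoOn s₁ (Icc a₁ b₁)) (hm2 : StrictMonoOn s₂ (Icc a₂ b₂))
    (ha1 : x₁ a₁ = m) (hb1 : x₁ b₁ = m) (ha2 : x₂ a₂ = m)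
    (hi1 : ∀ t ∈ Ioo a₁ b₁, x₁ t < m) (hi2 : ∀ t ∈ Ioo a₂ b₂, x₂ t < m)
    (huniq : ∀ r₁ r₂, s₁ r₁ = s₂ r₂ → x₁ r₁ = x₂ r₂ → ∀ t, s₁ (r₁ + t) = s₂ (r₂ + t) ∧
      x₁ (r₁ + t) = x₂ (r₂ + t))
    (hlev : s₂ a₂ < s₁ b₁) (htop : s₁ b₁ ≤ s₂ b₂) : s₂ a₂ ≤ s₁ a₁ := by
  by_contra hlt
  push Not at hlt
  obtain ⟨c, hc, hcs⟩ := intermediate_value_Icc h1.le hs1.continuousOn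
    (show s₂ a₂ ∈ Icc (s₁ a₁) (s₁ b₁) from ⟨hlt.le, hlev.le⟩)
  obtain ⟨e, he, hes⟩ := intermediate_value_Icc h2.le hs2.continuousOn
    (show s₁ b₁ ∈ Icc (s₂ a₂) (s₂ b₂) from ⟨hlev.le, htop⟩)
  have hxc : x₁ c ≤ m := by
    rcases eq_or_lt_of_le hc.1 with h | h
    · rw [← h, ha1]
    · rcases eq_or_lt_of_le hc.2 with h' | h'
      · rw [h', hb1]
      · exact (hi1 c ⟨h, h'⟩).le
  have hxe : x₂ e ≤ m := by
    have hcl : x₂ '' Icc a₂ b₂ ⊆ Iic m := by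
      rw [← closure_Ioo h2.ne]
      refine (image_closure_subset_closure_image hx2).trans (closure_minimal ?_ isClosed_Iic)
      rintro _ ⟨t, ht, rfl⟩
      exact (hi2 t ht).le
    exact hcl ⟨e, he, rfl⟩
  obtain ⟨r₁, hr1, r₂, hr2, e1, e2⟩ := exists_graphs_meet h1.le h2.le hs1.continuousOn
    hs2.continuousOn hx1.continuousOn hx2.continuousOn hm1 hm2 hlev.le hc ⟨le_rfl, h2.le⟩
    ⟨h1.le, le_rfl⟩ he hcs rfl rfl hes (hxc.trans_eq ha2.symm) (hxe.trans_eq hb1.symm)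
  have hu := huniq r₁ r₂ e1 e2
  -- Both arcs now lie on one orbit. Aligned in time, the later starting point, where `x = m`, falls
  -- inside the other arc, where `x < m`, or at its end, which the heights exclude; a common start
  -- is excluded by `hlt`.
  rcases lt_trichotomy (r₂ - (r₁ - a₁)) a₂ with h | h | h
  · have h3 := hu (a₂ - r₂)
    rw [add_sub_cancel, ha2] at h3
    rcases eq_or_lt_of_le (show r₁ + (a₂ - r₂) ≤ b₁ by linarith [hr1.2, hr2.1]) with h4 | h4
    · rw [h4] at h3; exact hlev.ne' h3.1
    · exact (hi1 _ ⟨by linarith, h4⟩).ne h3.2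
  · have h3 := (hu (a₁ - r₁)).1
    rw [add_sub_cancel, show r₂ + (a₁ - r₁) = a₂ by linarith] at h3
    exact hlt.ne h3
  · have h3 := hu (a₁ - r₁)
    rw [add_sub_cancel, ha1, show r₂ + (a₁ - r₁) = r₂ - (r₁ - a₁) by ring] at h3
    rcases eq_or_lt_of_le (show r₂ - (r₁ - a₁) ≤ b₂ by linarith [hr1.1, hr2.2]) with h4 | h4
    · rw [h4] at h3; linarith [h3.1]
    · exact (hi2 _ ⟨h, h4⟩).ne h3.2.symm

namespace FlowData
variable {d : FlowData}

namespace IsOrbit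
variable {s x s' x' : ℝ → ℝ}

/-- After its last visit to `x = N` the orbit would have to go down, while the field points up on
this line, also after truncation. -/
theorem lt_N_of_le (h : d.IsOrbit s x) {a b : ℝ} (hab : a ≤ b) (hb : x b < d.N) : x a < d.N := by
  by_contra hge
  obtain ⟨c, hc, hc0, hcp⟩ := exists_last_zero (φ := fun r => d.N - x r) (a := a) (b := b)
    (continuous_const.sub h.continuous_x).continuousOn hab (by linarith) (by linarith)
  have hxc : x c = d.N := by linarith
  have h1 := deriv_nonneg_of_pos_right hc.2 ((h.x_deriv c).const_sub d.N) hc0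
    (fun t ht => hcp t ⟨ht.1, ht.2.le⟩)
  rw [hxc, d.cl_of_mem d.N_pos.le le_rfl] at h1
  linarith [d.f_N_pos (min (s c) d.S)]

theorem left_arcs (h : d.IsOrbit s x) (h' : d.IsOrbit s' x') {a b a' b' : ℝ} (hab : a < b)
    (hab' : a' < b') (ha : x a = d.al) (hb : x b = d.al) (ha' : x' a' = d.al)
    (hx : ∀ t ∈ Ioo a b, x t < d.al) (hx' : ∀ t ∈ Ioo a' b', x' t < d.al)
    (hlev : s' a' < s b) (htop : s b ≤ s' b') : s' a' ≤ s a :=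
  arcs_nested hab hab' h.continuous_s h'.continuous_s h.continuous_x h'.continuous_x
    (h.strictMonoOn hx) (h'.strictMonoOn hx') ha hb ha' hx hx' (fun _ _ => h.unique h') hlev htop

/-- The left case after the central symmetry `(s, x) ↦ (-s, -x)`. -/
theorem right_arcs (h : d.IsOrbit s x) (h' : d.IsOrbit s' x') {a b a' b' : ℝ} (hab : a < b)
    (hab' : a' < b') (ha : x a = d.al) (hb : x b = d.al) (ha' : x' a' = d.al)
    (hx : ∀ t ∈ Ioo a b, d.al < x t) (hx' : ∀ t ∈ Ioo a' b', d.al < x' t)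
    (hlev : s b < s' a') (hbot : s' b' ≤ s b) : s a ≤ s' a' :=
  neg_le_neg_iff.1 <| arcs_nested (s₁ := fun t => -s t) (s₂ := fun t => -s' t)
    (x₁ := fun t => -x t) (x₂ := fun t => -x' t) (m := -d.al) hab hab' h.continuous_s.neg
    h'.continuous_s.neg h.continuous_x.neg h'.continuous_x.neg
    (fun _ hp _ hq hpq => neg_lt_neg (h.strictAntiOn hx hp hq hpq))
    (fun _ hp _ hq hpq => neg_lt_neg (h'.strictAntiOn hx' hp hq hpq))
    (by rw [ha]) (by rw [hb]) (by rw [ha']) (fun t ht => neg_lt_neg (hx t ht))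
    (fun t ht => neg_lt_neg (hx' t ht))
    (fun r₁ r₂ e1 e2 t => by
      have := h.unique h' (neg_injective e1) (neg_injective e2) t
      simp [this.1, this.2])
    (neg_lt_neg hlev) (neg_le_neg hbot)

end IsOrbit

variable (d) in
/-- The regular orbit up to the time `t₂` at which it reaches `N`; the time `tl` is its last
passage through `al`. -/
structure IsBlowup (s x : ℝ → ℝ) (t₁ tl t₂ : ℝ) : Prop where
  reg : d.IsRegular s x t₁
  le : t₁ ≤ tl
  lt : tl < t₂
  at_tl : x tl = d.al
  right : ∀ t ∈ Ioo tl t₂, d.al < x t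
  at_end : x t₂ = d.N
  le_S : s tl ≤ d.S

namespace IsBlowup
variable {sg xg s x : ℝ → ℝ} {t₁ tl t₂ : ℝ}

theorem orbit (hg : d.IsBlowup sg xg t₁ tl t₂) : d.IsOrbit sg xg := hg.reg.orbit

theorem s₀_le_S (hg : d.IsBlowup sg xg t₁ tl t₂) : d.s₀ ≤ d.S := by
  by_contra hlt
  push Not at hlt
  have h1 := deriv_nonneg_of_pos_right hg.lt
    ((hg.orbit.x_deriv_al hg.at_tl hg.le_S).sub_const d.al) (by simp [hg.at_tl])
    (fun t ht => sub_pos.2 (hg.right t ht))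
  linarith [d.f_al_neg (hg.le_S.trans_lt hlt)]

theorem s₀_lt (hg : d.IsBlowup sg xg t₁ tl t₂) : d.s₀ < sg tl :=
  hg.orbit.lt_s_of_right_start hg.s₀_le_S hg.lt hg.at_tl hg.le_S hg.right

theorem strictAntiOn (hg : d.IsBlowup sg xg t₁ tl t₂) : StrictAntiOn sg (Icc tl t₂) :=
  hg.orbit.strictAntiOn hg.right

/-- If the last passage were strictly higher than the first, the left arc just before it would start
below `s₀` and have to cross the initial arc, which uniqueness forbids. -/
theorem s_le (hg : d.IsBlowup sg xg t₁ tl t₂) : sg tl ≤ sg t₁ := by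
  rcases eq_or_lt_of_le hg.le with h | h
  · rw [h]
  by_contra hlt
  push Not at hlt
  have h0 : d.s₀ < sg t₁ := hg.orbit.lt_s_of_left_end hg.s₀_le_S (sub_one_lt t₁) hg.reg.at_end
    hg.reg.le_S fun t ht => (hg.reg.left t ht.2).2
  obtain ⟨ε, hε, -, hεx⟩ := exists_pos_right_of_deriv_pos
    ((hg.orbit.x_deriv_al hg.at_tl hg.le_S).sub_const d.al) (by simp [hg.at_tl])
    (d.f_al_pos hg.s₀_lt)
  set t' := max (tl - ε / 2) ((t₁ + tl) / 2) with ht'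
  have ht'1 : t₁ < t' := (by linarith : t₁ < (t₁ + tl) / 2).trans_le (le_max_right _ _)
  have ht'2 : t' < tl := max_lt (by linarith) (by linarith)
  have hnear : ∀ t ∈ Ico t' tl, xg t < d.al := fun t ht => by
    have := hεx t ⟨by linarith [ht.1, le_max_left (tl - ε / 2) ((t₁ + tl) / 2)], ht.2⟩
    linarith
  obtain ⟨c, hc, hc0, hcp⟩ := exists_last_zero (φ := fun r => d.al - xg r) (a := t₁) (b := t')
    (continuous_const.sub hg.orbit.continuous_x).continuousOn ht'1.le (by linarith [hg.reg.at_end])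
    (by linarith [hnear t' ⟨le_rfl, ht'2⟩])
  have hcx : xg c = d.al := by linarith
  have hctl : c < tl := hc.2.trans ht'2
  have hin : ∀ r ∈ Ioo c tl, xg r < d.al := fun r hr => by
    rcases le_total r t' with h1 | h1
    · linarith [hcp r ⟨hr.1, h1⟩]
    · exact hnear r ⟨h1, hr.2⟩
  have hmono := hg.orbit.strictMonoOn hin
  have hsc : sg c < d.s₀ := hg.orbit.s_lt_of_left_start hg.s₀_le_S hctl hcx
    ((hmono.monotoneOn ⟨le_rfl, hctl.le⟩ ⟨hctl.le, le_rfl⟩ hctl.le).trans hg.le_S) hin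
  obtain ⟨τ, hτ, hτs⟩ := hg.reg.exists_eq (hsc.trans h0)
  obtain ⟨e, he, hes⟩ := intermediate_value_Icc hctl.le hg.orbit.continuous_s.continuousOn
    (show sg t₁ ∈ Icc (sg c) (sg tl) from ⟨(hsc.trans h0).le, hlt.le⟩)
  have hxe : xg e ≤ d.al := by
    rcases eq_or_lt_of_le he.1 with h1 | h1
    · rw [← h1, hcx]
    · rcases eq_or_lt_of_le he.2 with h2 | h2
      · rw [h2, hg.at_tl]
      · exact (hin e ⟨h1, h2⟩).le
  obtain ⟨r₁, hr1, r₂, hr2, e1, e2⟩ := exists_graphs_meet hτ.le hctl.le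
    hg.orbit.continuous_s.continuousOn hg.orbit.continuous_s.continuousOn
    hg.orbit.continuous_x.continuousOn hg.orbit.continuous_x.continuousOn
    (hg.reg.strictMonoOn.mono fun r hr => hr.2) hmono (hsc.trans h0).le
    (tc₁ := τ) (tc₂ := c) (td₁ := t₁) (td₂ := e) ⟨le_rfl, hτ.le⟩ ⟨le_rfl, hctl.le⟩
    ⟨hτ.le, le_rfl⟩ he hτs rfl rfl hes (by rw [hcx]; exact (hg.reg.left τ hτ).2.le)
    (by rw [hg.reg.at_end]; exact hxe)
  have hu := hg.orbit.unique hg.orbit e1 e2 (c - r₂)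
  rw [add_sub_cancel] at hu
  rcases eq_or_lt_of_le (show r₁ + (c - r₂) ≤ t₁ by linarith [hr1.2, hr2.1]) with h4 | h4
  · rw [h4] at hu; linarith [hu.1]
  · exact (hg.reg.left _ h4).2.ne (hu.2.trans hcx)

/-- In backward time, orbits to the right of `al` stay below the last arc of the regular orbit. -/
theorem barrier (hg : d.IsBlowup sg xg t₁ tl t₂) (h : d.IsOrbit s x) {t₀ : ℝ} (hx0 : x t₀ = d.al)
    (hs0 : s t₀ < d.s₀) {t : ℝ} (ht : t < t₀) (hx : ∀ r ∈ Ico t t₀, d.al < x r) :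
    s t < sg tl := by
  by_contra hge
  push Not at hge
  have hN : ∀ r ≤ t₀, x r < d.N := fun r hr => h.lt_N_of_le hr (hx0.trans_lt d.al_lt_N)
  have hsl := hg.s₀_lt
  obtain ⟨t', ht', hts⟩ := intermediate_value_Icc' ht.le h.continuous_s.continuousOn
    (show sg tl ∈ Icc (s t₀) (s t) from ⟨by linarith, hge⟩)
  have ht't : t' < t₀ := lt_of_le_of_ne ht'.2 (by rintro rfl; linarith)
  have hx' : ∀ r ∈ Ico t' t₀, d.al < x r := fun r hr => hx r ⟨ht'.1.trans hr.1, hr.2⟩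
  have hanti := h.strictAntiOn (a := t') (b := t₀) fun r hr => hx' r ⟨hr.1.le, hr.2⟩
  have hx2 : ∀ r ∈ Icc tl t₂, d.al ≤ xg r := by
    intro r hr
    rcases eq_or_lt_of_le hr.1 with h1 | h1
    · rw [← h1, hg.at_tl]
    · rcases eq_or_lt_of_le hr.2 with h2 | h2
      · rw [h2, hg.at_end]; exact d.al_lt_N.le
      · exact (hg.right r ⟨h1, h2⟩).le
  obtain ⟨r₁, hr1, r₂, hr2, e1, e2⟩ : ∃ r₁ ∈ Icc t' t₀, ∃ r₂ ∈ Icc tl t₂, s r₁ = sg r₂ ∧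
      x r₁ = xg r₂ := by
    -- At height `sg tl` the backward orbit lies to the right of the last arc; it suffices to find a
    -- height with the opposite order. The higher of the two lower ends serves: there either the
    -- regular orbit is at `N`, or the other orbit is at `al`.
    have key : ∀ τ₁ ∈ Icc t' t₀, ∀ τ₂ ∈ Icc tl t₂, s τ₁ = sg τ₂ → x τ₁ ≤ xg τ₂ →
        ∃ r₁ ∈ Icc t' t₀, ∃ r₂ ∈ Icc tl t₂, s r₁ = sg r₂ ∧ x r₁ = xg r₂ := by
      intro τ₁ h1 τ₂ h2 hs hx
      obtain ⟨r₂, hr2, r₁, hr1, e1, e2⟩ := exists_graphs_meet (s₂ := fun t => -s t)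
        (s₁ := fun t => -sg t) hg.lt.le ht't.le hg.orbit.continuous_s.neg.continuousOn
        h.continuous_s.neg.continuousOn hg.orbit.continuous_x.continuousOn
        h.continuous_x.continuousOn
        (fun _ hp _ hq hpq => neg_lt_neg (hg.strictAntiOn hp hq hpq))
        (fun _ hp _ hq hpq => neg_lt_neg (hanti hp hq hpq))
        (c := -sg tl) (d := -sg τ₂) (tc₁ := tl) (tc₂ := t') (td₁ := τ₂) (td₂ := τ₁)
        (neg_le_neg (hg.strictAntiOn.antitoneOn ⟨le_rfl, hg.lt.le⟩ h2 h2.1))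
        ⟨le_rfl, hg.lt.le⟩ ⟨le_rfl, ht't.le⟩ h2 h1 rfl (by rw [hts]) rfl (by rw [hs])
        (by rw [hg.at_tl]; exact (hx' t' ⟨le_rfl, ht't⟩).le) hx
      exact ⟨r₁, hr1, r₂, hr2, (neg_injective e1).symm, e2.symm⟩
    rcases le_total (s t₀) (sg t₂) with hc | hc
    · obtain ⟨e, he, hes⟩ := intermediate_value_Icc' ht't.le h.continuous_s.continuousOn
        (show sg t₂ ∈ Icc (s t₀) (s t') from ⟨hc, by
          rw [hts]
          exact hg.strictAntiOn.antitoneOn ⟨le_rfl, hg.lt.le⟩ ⟨hg.lt.le, le_rfl⟩ hg.lt.le⟩)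
      exact key e he t₂ ⟨hg.lt.le, le_rfl⟩ hes (by rw [hg.at_end]; exact (hN e he.2).le)
    · obtain ⟨e, he, hes⟩ := intermediate_value_Icc' hg.lt.le hg.orbit.continuous_s.continuousOn
        (show s t₀ ∈ Icc (sg t₂) (sg tl) from ⟨hc, by linarith⟩)
      exact key t₀ ⟨ht't.le, le_rfl⟩ e he hes.symm (by rw [hx0]; exact hx2 e he)
  have hu := h.unique hg.orbit e1 e2
  rcases le_or_gt t' (r₁ + (tl - r₂)) with h1 | h1
  · have h2 := hu (tl - r₂)
    rw [add_sub_cancel, hg.at_tl] at h2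
    rcases eq_or_lt_of_le (show r₁ + (tl - r₂) ≤ t₀ by linarith [hr1.2, hr2.1]) with h3 | h3
    · rw [h3] at h2; linarith [h2.1]
    · exact (hx' _ ⟨h1, h3⟩).ne' h2.2
  · have h2 := (hu (t' - r₁)).1
    rw [add_sub_cancel, hts] at h2
    have := hg.strictAntiOn (a := tl) (b := r₂ + (t' - r₁)) ⟨le_rfl, hg.lt.le⟩
      ⟨by linarith, by linarith [hr1.1, hr2.2]⟩ (by linarith)
    linarith

/-- Backward return through the right half plane. -/
theorem right_return (hg : d.IsBlowup sg xg t₁ tl t₂) (h : d.IsOrbit s x) {t₀ : ℝ}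
    (hx0 : x t₀ = d.al) (hs0 : s t₀ < d.s₀) :
    ∃ τ < t₀, x τ = d.al ∧ (∀ t ∈ Ioo τ t₀, d.al < x t ∧ x t < d.N) ∧ d.s₀ < s τ ∧ s τ < sg tl := by
  have hp := d.p_gt_one
  have hSs := hg.s₀_le_S
  have hd0 := h.x_deriv_al hx0 (hs0.le.trans hSs)
  obtain ⟨ε, hε, -, hεx⟩ := exists_pos_right_of_deriv_pos (φ := fun t => d.al - x t)
    (hd0.const_sub d.al) (by simp [hx0]) (by linarith [d.f_al_neg hs0])
  set t' := t₀ - ε / 2 with ht'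
  have hnear : ∀ t ∈ Ico t' t₀, d.al < x t := fun t ht => by
    have := hεx t ⟨by linarith [ht.1], ht.2⟩
    linarith
  have hN : ∀ r ≤ t₀, x r < d.N := fun r hr => h.lt_N_of_le hr (hx0.trans_lt d.al_lt_N)
  by_cases hret : ∃ t < t₀, x t ≤ d.al
  · obtain ⟨t, ht, htx⟩ := hret
    have htt' : t < t' := by
      by_contra hge
      linarith [hnear t ⟨not_lt.1 hge, ht⟩]
    obtain ⟨c, hc, hc0, hcp⟩ := exists_last_zero (φ := fun r => x r - d.al) (a := t) (b := t')
      (h.continuous_x.sub continuous_const).continuousOn htt'.le (by linarith)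
      (by linarith [hnear t' ⟨le_rfl, by linarith⟩])
    have hcx : x c = d.al := by linarith
    have hct : c < t₀ := by linarith [hc.2]
    have hin : ∀ r ∈ Ioo c t₀, d.al < x r := fun r hr => by
      rcases le_total r t' with h1 | h1
      · linarith [hcp r ⟨hr.1, h1⟩]
      · exact hnear r ⟨h1, hr.2⟩
    have hle : s c ≤ sg tl := by
      have hcl : s '' Icc c t₀ ⊆ Iic (sg tl) := by
        rw [← closure_Ioo hct.ne]
        refine (image_closure_subset_closure_image h.continuous_s).trans
          (closure_minimal ?_ isClosed_Iic)
        rintro _ ⟨r, hr, rfl⟩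
        exact (hg.barrier h hx0 hs0 hr.2 fun q hq => hin q ⟨hr.1.trans_le hq.1, hq.2⟩).le
      exact hcl ⟨c, ⟨le_rfl, hct.le⟩, rfl⟩
    refine ⟨c, hct, hcx, fun r hr => ⟨hin r hr, hN r hr.2.le⟩,
      h.lt_s_of_right_start hSs hct hcx (hle.trans hg.le_S) hin, lt_of_le_of_ne hle fun heq => ?_⟩
    -- Returning exactly at height `sg tl` would identify the orbit with the last arc, which goes on
    -- to `N` without coming back to `al`.
    have hu := h.unique hg.orbit heq (hcx.trans hg.at_tl.symm)
    rcases le_or_gt (t₀ - c) (t₂ - tl) with h1 | h1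
    · have h2 := hu (t₀ - c)
      rw [add_sub_cancel, hx0] at h2
      rcases eq_or_lt_of_le h1 with h3 | h3
      · rw [h3, add_sub_cancel, hg.at_end] at h2
        exact d.al_lt_N.ne h2.2
      · exact (hg.right (tl + (t₀ - c)) ⟨by linarith, by linarith⟩).ne h2.2
    · have h2 := (hu (t₂ - tl)).2
      rw [add_sub_cancel, hg.at_end] at h2
      exact (hN _ (by linarith)).ne h2
  · exfalso
    push Not at hret
    have hsl : ∀ t < t₀, s t < sg tl := fun t ht =>
      hg.barrier h hx0 hs0 ht fun r hr => hret r hr.2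
    have hal := d.al_pos
    have h2al := d.two_al_lt
    have hxd : ∀ t < t₀, HasDerivAt x (d.f (s t) (x t)) t := fun t ht =>
      h.x_deriv' (hal.trans (hret t ht)).le (hN t ht.le).le ((hsl t ht).le.trans hg.le_S)
    have hsd : ∀ t < t₀, HasDerivAt s ((d.p - 1) * (d.al - x t)) t := fun t ht =>
      h.s_deriv' (hal.trans (hret t ht)).le (hN t ht.le).le
    have ht't : t' < t₀ := by linarith
    -- As long as `s ≤ s₀`, the level `A` with `al < A < N - al` cannot be crossed downwards in
    -- backward time; so `s` increases backwards at a fixed rate and exceeds `s₀`.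
    obtain ⟨q₀, hq0, hq0s⟩ : ∃ q < t₀, d.s₀ < s q := by
      by_contra hcon
      push Not at hcon
      set A := min (x t') (d.al + (d.N - 2 * d.al) / 2) with hA
      have hA0 : d.al < A := lt_min (hret t' ht't) (by linarith)
      have hAN : A < d.N - d.al := (min_le_right _ _).trans_lt (by linarith)
      have hxge : ∀ t ≤ t', A ≤ x t := fun t ht =>
        ge_of_deriv_neg_at_level ht (fun q hq => hxd q (hq.2.trans_lt ht't))
          (fun q hq he => d.f_neg_of_right (hcon q (hq.2.trans_lt ht't)) (by rw [he]; exact hA0)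
            (by rw [he]; exact hAN)) (min_le_left _ _)
      set r := (d.p - 1) * (A - d.al) with hr
      have hr0 : 0 < r := mul_pos (by linarith) (by linarith)
      have hle : t' - (d.s₀ - s t' + 1) / r ≤ t' := by
        have : 0 ≤ (d.s₀ - s t' + 1) / r := div_nonneg (by linarith [hcon t' ht't]) hr0.le
        linarith
      have := sub_le_mul_of_deriv_le (r := -r) hle (fun q hq => hsd q (hq.2.trans_lt ht't))
        (fun q hq => by
          have := mul_le_mul_of_nonneg_left (hxge q hq.2) (by linarith : 0 ≤ d.p - 1)
          rw [hr]; linarith)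
      have e : -r * (t' - (t' - (d.s₀ - s t' + 1) / r)) = -(d.s₀ - s t' + 1) := by
        field_simp; ring
      rw [e] at this
      linarith [hcon _ (hle.trans_lt ht't)]
    have hsge : ∀ t ≤ q₀, s q₀ ≤ s t := fun t ht =>
      (h.strictAntiOn (a := t) (b := q₀) fun r hr => hret r (hr.2.trans hq0)).antitoneOn
        ⟨le_rfl, ht⟩ ⟨ht, le_rfl⟩ ht
    obtain ⟨η, hη, r, hr, hzone⟩ := d.exists_right_zone hq0s
    have hfar : ∀ t ≤ q₀, d.al + η < x t := by
      intro t ht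
      by_contra hge
      push Not at hge
      have hge' : ∀ q ≤ t, x q ≤ d.al + η := fun q hq =>
        le_of_deriv_pos_at_level hq (fun w hw => hxd w ((hw.2.trans ht).trans_lt hq0))
          (fun w hw hwe => by
            have := hzone (s w) (x w) (hsge w (hw.2.trans ht)) (by linarith) hwe.le
            linarith) hge
      have hle : t - (η + 1) / r ≤ t := by
        have : 0 ≤ (η + 1) / r := by positivity
        linarith
      have := mul_sub_le_of_le_deriv (r := r) hle
        (fun q hq => hxd q ((hq.2.trans ht).trans_lt hq0))
        (fun q hq => hzone _ _ (hsge q (hq.2.trans ht))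
          (hret q ((hq.2.trans ht).trans_lt hq0)).le (hge' q hq.2))
      have e : r * (t - (t - (η + 1) / r)) = η + 1 := by field_simp; ring
      rw [e] at this
      linarith [hret _ ((hle.trans ht).trans_lt hq0)]
    set c := (d.p - 1) * η with hc
    have hc0 : 0 < c := mul_pos (by linarith) hη
    have hle : q₀ - (sg tl - s q₀) / c ≤ q₀ := by
      have : 0 ≤ (sg tl - s q₀) / c := div_nonneg (by linarith [hsl q₀ hq0]) hc0.le
      linarith
    have := sub_le_mul_of_deriv_le (r := -c) hle (fun q hq => hsd q (hq.2.trans_lt hq0))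
      (fun q hq => by
        have := mul_le_mul_of_nonneg_left (hfar q hq.2).le (by linarith : 0 ≤ d.p - 1)
        rw [hc]; linarith)
    have e : -c * (q₀ - (q₀ - (sg tl - s q₀) / c)) = -(sg tl - s q₀) := by field_simp; ring
    rw [e] at this
    linarith [hsl _ (hle.trans_lt hq0)]

end IsBlowup
end FlowData
end PucciLaneEmden
end

/-! ### The backward return map, the energy, and its fixed point. -/

noncomputable section
namespace PucciLaneEmden
open Filter Topology Set

namespace FlowData

/-- A piece of orbit that starts on the line `x = al` at height `w`, makes one turn around the
stationary point and comes back to this line at height `z`. -/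
def HasLoop (d : FlowData) (z w : ℝ) : Prop :=
  ∃ s x : ℝ → ℝ, ∃ τ₂ τ₁ τ₀ : ℝ, d.IsOrbit s x ∧ τ₂ < τ₁ ∧ τ₁ < τ₀ ∧ x τ₂ = d.al ∧ x τ₁ = d.al ∧
    x τ₀ = d.al ∧ (∀ t ∈ Ioo τ₂ τ₁, d.al < x t ∧ x t < d.N) ∧
    (∀ t ∈ Ioo τ₁ τ₀, 0 < x t ∧ x t < d.al) ∧ s τ₂ = w ∧ s τ₀ = z ∧ s τ₁ < d.s₀ ∧ d.s₀ < z ∧ d.s₀ < w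

variable {d : FlowData}

namespace HasLoop
variable {z w z' w' : ℝ}

/-- Nesting of the left arcs reverses the order at the lower crossings, and nesting of the right
arcs reverses it again. With `z = z'`, used both ways, it shows that `w` is determined by `z`. -/
theorem mono (h : d.HasLoop z w) (h' : d.HasLoop z' w') (hz : z ≤ z') : w ≤ w' := by
  obtain ⟨s, x, τ₂, τ₁, τ₀, ho, h21, h10, hx2, hx1, hx0, hr, hl, rfl, rfl, hb, hz0, hw0⟩ := h
  obtain ⟨s', x', τ₂', τ₁', τ₀', ho', h21', h10', hx2', hx1', hx0', hr', hl', rfl, rfl, hb', hz0',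
    hw0'⟩ := h'
  have hbot : s' τ₁' ≤ s τ₁ := ho.left_arcs ho' h10 h10' hx1 hx0 hx1' (fun t ht => (hl t ht).2)
    (fun t ht => (hl' t ht).2) (hb'.trans hz0) hz
  exact ho.right_arcs ho' h21 h21' hx2 hx1 hx2' (fun t ht => (hr t ht).1)
    (fun t ht => (hr' t ht).1) (hb.trans hw0') hbot

/-- A closed loop is a periodic orbit. -/
theorem hasPeriodicOrbit (h : d.HasLoop z z) (hzS : z ≤ d.S) :
    HasPeriodicOrbit d.lam d.Lam d.p := by
  obtain ⟨s, x, τ₂, τ₁, τ₀, ho, h21, h10, hx2, hx1, hx0, hr, hl, hs2, hs0, hb, hz0, -⟩ := h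
  have hal := d.al_pos
  have halN := d.al_lt_N
  set T := τ₀ - τ₂ with hT
  have hT0 : 0 < T := by linarith
  have hper : ∀ t, s (t + T) = s t ∧ x (t + T) = x t := by
    intro t
    have := ho.unique ho (a := τ₀) (b := τ₂) (hs0.trans hs2.symm) (hx0.trans hx2.symm) (t - τ₂)
    rw [add_sub_cancel, show τ₀ + (t - τ₂) = t + T by rw [hT]; ring] at this
    exact this
  have hsanti := ho.strictAntiOn (a := τ₂) (b := τ₁) fun t ht => (hr t ht).1
  have hsmono := ho.strictMonoOn (a := τ₁) (b := τ₀) fun t ht => (hl t ht).2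
  have hbase : ∀ t ∈ Ico τ₂ (τ₂ + T), 0 < x t ∧ x t ≤ d.N ∧ s t ≤ d.S := by
    intro t ht
    have ht2 : t < τ₀ := by linarith [ht.2]
    rcases le_total t τ₁ with h1 | h1
    · have hs : s t ≤ d.S := ((hsanti.antitoneOn ⟨le_rfl, h21.le⟩ ⟨ht.1, h1⟩ ht.1).trans
        hs2.le).trans hzS
      rcases eq_or_lt_of_le ht.1 with h2 | h2
      · rw [← h2] at hs ⊢
        rw [hx2]; exact ⟨hal, halN.le, hs⟩
      · rcases eq_or_lt_of_le h1 with h3 | h3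
        · rw [h3] at hs ⊢
          rw [hx1]; exact ⟨hal, halN.le, hs⟩
        · have := hr t ⟨h2, h3⟩
          exact ⟨by linarith, this.2.le, hs⟩
    · have hs : s t ≤ d.S := ((hsmono.monotoneOn ⟨h1, ht2.le⟩ ⟨h10.le, le_rfl⟩ ht2.le).trans
        hs0.le).trans hzS
      rcases eq_or_lt_of_le h1 with h3 | h3
      · rw [← h3] at hs ⊢
        rw [hx1]; exact ⟨hal, halN.le, hs⟩
      · have := hl t ⟨h3, ht2⟩
        exact ⟨this.1, by linarith, hs⟩
  have hall : ∀ t, 0 < x t ∧ x t ≤ d.N ∧ s t ≤ d.S := by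
    intro t
    have hp1 : Function.Periodic x T := fun t => (hper t).2
    have hp2 : Function.Periodic s T := fun t => (hper t).1
    have hp : Function.Periodic (fun t => (s t, x t)) T := fun t => by
      simp [(hper t).1, (hper t).2]
    obtain ⟨r, hr, hre⟩ := hp.exists_mem_Ico hT0 t τ₂
    simp only [Prod.mk.injEq] at hre
    rw [hre.1, hre.2]
    exact hbase r hr
  have hX : ∀ t, HasDerivAt x (d.f (s t) (x t)) t := fun t =>
    ho.x_deriv' (hall t).1.le (hall t).2.1 (hall t).2.2
  have hs : ∀ t, HasDerivAt s ((d.p - 1) * (d.al - x t)) t := fun t =>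
    ho.s_deriv' (hall t).1.le (hall t).2.1
  -- Passage to the original unknowns `X = x`, `Z = e^s / x`; pulling `x > 0` out of the minimum
  -- produces `fieldM`.
  have hf : ∀ t, d.f (s t) (x t) = x t * (x t + fieldM d.lam d.Lam (Real.exp (s t) / x t)) := by
    intro t
    have hx := (hall t).1
    have hL := d.Lam_pos
    have hlp := d.lam_pos
    unfold f fieldM
    rw [mul_add, mul_min_of_nonneg _ _ hx.le]
    congr 2
    · ring
    · field_simp
    · change _ = x t * (_ - d.N)
      field_simp
  refine ⟨x, fun t => Real.exp (s t) / x t, fun t => ⟨(hall t).1, div_pos (Real.exp_pos _)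
    (hall t).1⟩, fun t => ?_, fun t => ?_, ⟨T, hT0, fun t => ?_⟩, (τ₁ + τ₀) / 2, τ₁, Or.inl ?_⟩
  · rw [fieldX_eq d.lam_pos d.lam_lt, ← hf]
    exact hX t
  · rw [fieldZ_eq d.lam_pos d.lam_lt]
    have hx := (hall t).1
    have := (hs t).exp.div (hX t) hx.ne'
    refine this.congr_deriv ?_
    rw [hf]
    have hpal := d.p_mul_al
    generalize fieldM d.lam d.Lam (Real.exp (s t) / x t) = m
    rw [mul_sub, hpal]
    field_simp
    ring
  · simp only [(hper t).1, (hper t).2, and_self]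
  · rw [hx1]
    exact (hl _ ⟨by linarith, by linarith⟩).2.ne

end HasLoop

theorem p_eq : d.p = 1 + 2 / d.al := by
  have := d.p_mul_al
  have := d.al_pos
  field_simp
  linarith

/-- The energy, nonincreasing along orbits in the region of the second branch. -/
def energy (d : FlowData) (s x : ℝ) : ℝ :=
  Real.exp (d.al * s) * ((d.al - x) ^ 2 / 2 - d.b / 2 + Real.exp s / (d.lam * (d.p + 1)))

/-- The condition `e^s ≤ Lam x`, that is `Z ≤ Lam`, selects the second branch: the Emden-Fowler
equation in dimension `Ñ`. Its damping coefficient `N - 2 al` is positive exactly in the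
supercritical range. -/
theorem energy_deriv {s x : ℝ → ℝ} {t : ℝ} (hs : HasDerivAt s ((d.p - 1) * (d.al - x t)) t)
    (hx : HasDerivAt x (d.f (s t) (x t)) t) (hreg : Real.exp (s t) ≤ d.Lam * x t) :
    HasDerivAt (fun t => d.energy (s t) (x t))
      (-((d.N - 2 * d.al) * Real.exp (d.al * s t) * (d.al - x t) ^ 2)) t := by
  have hlp := d.lam_pos
  have hL := d.Lam_pos
  have hp := d.p_gt_one
  have hf : d.f (s t) (x t) = x t ^ 2 + (Real.exp (s t) / d.lam - d.N * x t) := by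
    unfold f
    rw [min_eq_right]
    have h1 : d.N = d.Lam / d.lam - 1 := rfl
    rw [h1, div_sub' hlp.ne', div_le_div_iff₀ hlp hL]
    have : 0 < d.Lam - d.lam := by linarith [d.lam_lt]
    have h2 : d.lam * ((d.Lam / d.lam - 1) * x t) = (d.Lam - d.lam) * x t := by field_simp
    rw [h2]
    nlinarith
  have e := ((hs.const_mul d.al).exp).mul ((((hx.const_sub d.al).pow 2).div_const 2 |>.sub_const
    (d.b / 2)).add (hs.exp.div_const (d.lam * (d.p + 1))))
  refine (e.congr_deriv ?_)
  simp only [Pi.add_apply, Pi.pow_apply]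
  rw [hf]
  have hb : d.b = d.al * (d.N - d.al) := rfl
  rw [hb, d.p_eq]
  generalize d.N = N
  generalize Real.exp (d.al * s t) = E₁
  generalize Real.exp (s t) = E₂
  have hal := d.al_pos
  generalize d.al = a at *
  have h2 : 1 + 2 / a + 1 ≠ 0 := by positivity
  have h3 : a + 1 ≠ 0 := by positivity
  field_simp
  norm_num
  field_simp
  ring

theorem energy_al_deriv (s : ℝ) : HasDerivAt (fun s => d.energy s d.al)
    (Real.exp (d.al * s) * (d.al / 2) * (d.b * (Real.exp (s - d.s₀) - 1))) s := by
  have e := (((hasDerivAt_id s).const_mul d.al).exp).mul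
    (((Real.hasDerivAt_exp s).div_const (d.lam * (d.p + 1))).const_add
      ((d.al - d.al) ^ 2 / 2 - d.b / 2))
  refine e.congr_deriv ?_
  have hlp := d.lam_pos
  have h := d.exp_div_lam s
  have h' : Real.exp s = d.lam * (d.b * Real.exp (s - d.s₀)) := by rw [← h]; field_simp
  rw [h', d.p_eq]
  generalize Real.exp (s - d.s₀) = E
  generalize d.b = b
  have hal := d.al_pos
  simp only [id]
  generalize d.al = a at *
  have h3 : a + 1 ≠ 0 := by positivity
  have h2 : 1 + 2 / a + 1 ≠ 0 := by positivity
  field_simp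
  norm_num
  field_simp
  ring

theorem energy_al_strictMonoOn : StrictMonoOn (fun s => d.energy s d.al) (Ici d.s₀) := by
  apply strictMonoOn_of_deriv_pos (convex_Ici _)
  · exact fun s _ => (energy_al_deriv s).continuousAt.continuousWithinAt
  · intro s hs
    rw [interior_Ici] at hs
    rw [(energy_al_deriv s).deriv]
    have h1 : 1 < Real.exp (s - d.s₀) := Real.one_lt_exp_iff.2 (sub_pos.2 hs)
    exact mul_pos (mul_pos (Real.exp_pos _) (half_pos d.al_pos))
      (mul_pos d.b_pos (sub_pos.2 h1))

theorem energy_al_strictAntiOn : StrictAntiOn (fun s => d.energy s d.al) (Iic d.s₀) := by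
  apply strictAntiOn_of_deriv_neg (convex_Iic _)
  · exact fun s _ => (energy_al_deriv s).continuousAt.continuousWithinAt
  · intro s hs
    rw [interior_Iic] at hs
    rw [(energy_al_deriv s).deriv]
    have h1 : Real.exp (s - d.s₀) < 1 := Real.exp_lt_one_iff.2 (sub_neg.2 hs)
    exact mul_neg_of_pos_of_neg (mul_pos (Real.exp_pos _) (half_pos d.al_pos))
      (mul_neg_of_pos_of_neg d.b_pos (sub_neg.2 h1))

/-- On the line `x = al` the energy decreases up to `s₀` and increases after it, and off the line a
positive square is added. So the stationary point is its strict minimum. -/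
theorem energy_lt {s x : ℝ} (h : ¬(s = d.s₀ ∧ x = d.al)) : d.energy d.s₀ d.al < d.energy s x := by
  have e : d.energy s x = d.energy s d.al + Real.exp (d.al * s) * ((d.al - x) ^ 2 / 2) := by
    unfold energy; ring
  have hE := Real.exp_pos (d.al * s)
  have h0 : 0 ≤ Real.exp (d.al * s) * ((d.al - x) ^ 2 / 2) := by positivity
  rcases lt_trichotomy s d.s₀ with h1 | h1 | h1
  · have := energy_al_strictAntiOn h1.le (mem_Iic.2 le_rfl) h1
    dsimp only at this
    linarith
  · have hx : d.al - x ≠ 0 := fun h2 => h ⟨h1, by linarith⟩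
    have : 0 < Real.exp (d.al * s) * ((d.al - x) ^ 2 / 2) := by positivity
    rw [e, h1] at *
    linarith
  · have := energy_al_strictMonoOn (mem_Ici.2 le_rfl) h1.le h1
    dsimp only at this
    linarith

theorem continuous_energy : Continuous fun q : ℝ × ℝ => d.energy q.1 q.2 := by
  unfold energy; fun_prop

/-- Orbits starting near the stationary point stay in the region of the second branch. -/
theorem exists_trapping (hS : d.s₀ < d.S) : ∃ δ > 0, ∀ s x : ℝ → ℝ, d.IsOrbit s x → ∀ a,
    x a = d.al → d.s₀ < s a → s a < d.s₀ + δ → ∀ t ≥ a,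
    (0 ≤ x t ∧ x t ≤ d.N) ∧ s t ≤ d.S ∧ Real.exp (s t) ≤ d.Lam * x t := by
  have hal := d.al_pos
  have hreg : ∀ᶠ q : ℝ × ℝ in 𝓝 (d.s₀, d.al), (0 < q.2 ∧ q.2 < d.N) ∧ q.1 < d.S ∧
      Real.exp q.1 < d.Lam * q.2 := by
    have c1 : Continuous fun q : ℝ × ℝ => q.1 := continuous_fst
    have c2 : Continuous fun q : ℝ × ℝ => q.2 := continuous_snd
    have h3 : Real.exp d.s₀ < d.Lam * d.al := by
      rw [d.exp_s₀]
      have h1 : d.lam * d.b = d.al * (d.Lam - d.lam - d.lam * d.al) := by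
        have hlp := d.lam_pos
        unfold b N; field_simp
      rw [h1]
      have := d.lam_pos
      nlinarith [mul_pos this hal]
    refine ((c2.continuousAt.eventually (lt_mem_nhds hal)).and
      (c2.continuousAt.eventually (gt_mem_nhds d.al_lt_N))).and
      ((c1.continuousAt.eventually (gt_mem_nhds hS)).and ?_)
    exact (c1.rexp.continuousAt).eventually_lt ((continuous_const.mul c2).continuousAt) h3
  obtain ⟨δ, hδ, hbox⟩ := Metric.nhds_basis_closedBall.eventually_iff.1 hreg
  have hcpt : IsCompact (Metric.sphere ((d.s₀, d.al) : ℝ × ℝ) δ) := isCompact_sphere _ _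
  -- Lyapunov stability: the least energy on the small sphere exceeds the energy of the centre, so
  -- an orbit that starts with less energy cannot reach the sphere.
  obtain ⟨q₀, hq0, hmin⟩ := hcpt.exists_isMinOn
    ⟨(d.s₀ + δ, d.al), by simp [abs_of_pos hδ, hδ.le]⟩ continuous_energy.continuousOn
  have hm : d.energy d.s₀ d.al < d.energy q₀.1 q₀.2 := by
    apply energy_lt
    rintro ⟨h1, h2⟩
    have : q₀ = (d.s₀, d.al) := Prod.ext h1 h2
    rw [this, Metric.mem_sphere, dist_self] at hq0
    exact hδ.ne hq0
  have hcont := (energy_al_deriv (d := d) d.s₀).continuousAt.eventually (gt_mem_nhds hm)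
  obtain ⟨δ', hδ', hsm⟩ := Metric.eventually_nhds_iff.1 hcont
  refine ⟨min δ δ', lt_min hδ hδ', fun s x ho a hxa hsa hsa' t ht => ?_⟩
  have hin : ∀ t ≥ a, 0 < δ - dist (s t, x t) (d.s₀, d.al) := by
    intro t ht
    by_contra hle
    have hda : dist (s a, x a) (d.s₀, d.al) = s a - d.s₀ := by
      rw [Prod.dist_eq, hxa, dist_self, Real.dist_eq, abs_of_pos (sub_pos.2 hsa),
        max_eq_left (sub_pos.2 hsa).le]
    obtain ⟨c, hc, hc0, hcp⟩ := exists_first_zero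
      (φ := fun t => δ - dist (s t, x t) (d.s₀, d.al)) (a := a) (b := t)
      (continuous_const.sub ((ho.continuous_s.prodMk ho.continuous_x).dist
        continuous_const)).continuousOn ht
      (by rw [hda]; linarith [min_le_left δ δ']) (not_lt.1 hle)
    have hcb : ∀ r ∈ Icc a c, (s r, x r) ∈ Metric.closedBall (d.s₀, d.al) δ := by
      intro r hr
      rw [Metric.mem_closedBall]
      rcases eq_or_lt_of_le hr.2 with h1 | h1
      · rw [h1]; linarith
      · linarith [hcp r ⟨hr.1, h1⟩]
    have hdec := sub_le_mul_of_deriv_le (r := 0) hc.1.le (fun r hr => by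
      have h1 := hbox (hcb r hr)
      exact energy_deriv (ho.s_deriv' h1.1.1.le h1.1.2.le)
        (ho.x_deriv' h1.1.1.le h1.1.2.le h1.2.1.le) h1.2.2.le) (fun r _ => by
      have h2 := d.two_al_lt
      have : 0 ≤ (d.N - 2 * d.al) * Real.exp (d.al * s r) * (d.al - x r) ^ 2 :=
        mul_nonneg (mul_nonneg (by linarith) (Real.exp_pos _).le) (sq_nonneg _)
      linarith)
    have h1 : d.energy q₀.1 q₀.2 ≤ d.energy (s c) (x c) :=
      hmin (show (s c, x c) ∈ Metric.sphere (d.s₀, d.al) δ by rw [Metric.mem_sphere]; linarith)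
    have h2 := hsm (y := s a) (by
      rw [Real.dist_eq, abs_of_pos (sub_pos.2 hsa)]; linarith [min_le_right δ δ'])
    rw [hxa] at hdec
    linarith
  have h1 := hbox (show (s t, x t) ∈ Metric.closedBall (d.s₀, d.al) δ by
    rw [Metric.mem_closedBall]; linarith [hin t ht])
  exact ⟨⟨h1.1.1.le, h1.1.2.le⟩, h1.2.1.le, h1.2.2.le⟩

namespace IsBlowup
variable {sg xg : ℝ → ℝ} {t₁ tl t₂ : ℝ}

/-- The backward return map is defined at all heights between `s₀` and `sg tl`, and its values stay
below `sg tl`. -/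
theorem exists_loop (hg : d.IsBlowup sg xg t₁ tl t₂) {z : ℝ} (hz : d.s₀ < z) (hz' : z < sg tl) :
    ∃ w < sg tl, d.HasLoop z w := by
  obtain ⟨s, x, ho, hs0, hx0⟩ := d.exists_orbit 0 z d.al
  obtain ⟨τ₁, h1, hx1, hl, hb⟩ := hg.reg.left_return ho hx0 (by rwa [hs0])
    (by rw [hs0]; exact hz'.trans_le hg.s_le)
  obtain ⟨τ₂, h2, hx2, hr, hw0, hw⟩ := hg.right_return ho hx1 hb
  exact ⟨s τ₂, hw, s, x, τ₂, τ₁, 0, ho, h2, h1, hx2, hx1, hx0, hr, hl, rfl, hs0, hb, hz, hw0⟩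

/-- Small loops turn outwards in backward time. -/
theorem exists_expanding_loop (hg : d.IsBlowup sg xg t₁ tl t₂) :
    ∃ z w, d.s₀ < z ∧ z < sg tl ∧ d.HasLoop z w ∧ z ≤ w := by
  have hsl := hg.s₀_lt
  obtain ⟨δ, hδ, htrap⟩ := exists_trapping (hsl.trans_le hg.le_S)
  set z := min ((d.s₀ + sg tl) / 2) (d.s₀ + δ / 2) with hz
  have hz0 : d.s₀ < z := lt_min (by linarith) (by linarith)
  have hz1 : z < sg tl := (min_le_left _ _).trans_lt (by linarith)
  have hz2 : z ≤ d.s₀ + δ / 2 := min_le_right _ _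
  obtain ⟨w, hw, hloop⟩ := hg.exists_loop hz0 hz1
  refine ⟨z, w, hz0, hz1, hloop, ?_⟩
  -- If `w < z`, the loop run forward from `w` is trapped near the stationary point, where the
  -- energy does not increase; but on the line above `s₀` the energy is larger at `z`.
  by_contra hlt
  push Not at hlt
  obtain ⟨s, x, τ₂, τ₁, τ₀, ho, h21, h10, hx2, hx1, hx0, hr, hl, hsw, hsz, hb, -, hw0⟩ := hloop
  have ht := htrap s x ho τ₂ hx2 (by rwa [hsw]) (by rw [hsw]; linarith)
  have hdec := sub_le_mul_of_deriv_le (r := 0) (h21.trans h10).le (fun r hr => by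
    have h1 := ht r hr.1
    exact energy_deriv (ho.s_deriv' h1.1.1 h1.1.2)
      (ho.x_deriv' h1.1.1 h1.1.2 h1.2.1) h1.2.2) (fun r _ => by
    have h2 := d.two_al_lt
    have : 0 ≤ (d.N - 2 * d.al) * Real.exp (d.al * s r) * (d.al - x r) ^ 2 :=
      mul_nonneg (mul_nonneg (by linarith) (Real.exp_pos _).le) (sq_nonneg _)
    linarith)
  rw [hx2, hx0, hsw, hsz] at hdec
  have := energy_al_strictMonoOn (d := d) hw0.le hz0.le hlt
  dsimp only at this
  linarith

/-- Loops cannot start close to the last arc of the regular orbit. -/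
theorem exists_no_loop (hg : d.IsBlowup sg xg t₁ tl t₂) :
    ∃ ε > 0, ∀ z w, sg tl - ε < w → w < sg tl → ¬ d.HasLoop z w := by
  have hsl := hg.s₀_lt
  obtain ⟨η, hη, hηx, -⟩ := exists_pos_right_of_deriv_pos
    ((hg.orbit.x_deriv t₂).sub_const d.N) (by simp [hg.at_end]) (by
      rw [hg.at_end, d.cl_of_mem d.N_pos.le le_rfl]; exact d.f_N_pos _)
  set T := t₂ + η / 2 - tl with hT
  have hT0 : 0 < T := by linarith [hg.lt]
  have hxT : d.N < xg (tl + T) := by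
    have := hηx (tl + T) ⟨by linarith, by linarith⟩
    linarith
  -- From its last passage until it is past `N`, the regular orbit never has `x ≤ al` and `s ≤ s₀`
  -- together. The minimum `m` measures the distance from that quadrant.
  have hpos : ∀ r ∈ Icc (0 : ℝ) T, 0 < max (xg (tl + r) - d.al) (sg (tl + r) - d.s₀) := by
    intro r hr
    rcases eq_or_lt_of_le hr.1 with h1 | h1
    · rw [← h1, add_zero]; exact lt_max_of_lt_right (by linarith)
    · refine lt_max_of_lt_left ?_
      rcases lt_trichotomy (tl + r) t₂ with h2 | h2 | h2
      · linarith [hg.right (tl + r) ⟨by linarith, h2⟩]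
      · rw [h2, hg.at_end]; linarith [d.al_lt_N]
      · have := hηx (tl + r) ⟨h2, by linarith [hr.2]⟩
        linarith [d.al_lt_N]
  have hcont : Continuous fun r => max (xg (tl + r) - d.al) (sg (tl + r) - d.s₀) := by
    have := hg.orbit.continuous_x
    have := hg.orbit.continuous_s
    fun_prop
  obtain ⟨r₀, hr0, hmin⟩ := isCompact_Icc.exists_isMinOn (nonempty_Icc.2 hT0.le)
    hcont.continuousOn
  set m := max (xg (tl + r₀) - d.al) (sg (tl + r₀) - d.s₀) with hm
  have hm0 : 0 < m := hpos r₀ hr0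
  obtain ⟨K, hK0, hK⟩ := IsOrbit.dist_le d
  set μ := min m (xg (tl + T) - d.N) with hμ
  have hμ0 : 0 < μ := lt_min hm0 (by linarith)
  -- By Grönwall, orbits starting on the line this close to `sg tl` stay within `μ` of the regular
  -- orbit up to time `T`.
  refine ⟨μ * Real.exp (-(K * T)), by positivity, fun z w hw1 hw2 hloop => ?_⟩
  obtain ⟨s, x, τ₂, τ₁, τ₀, ho, h21, h10, hx2, hx1, hx0, hr, hl, hsw, hsz, hb, -, hw0⟩ := hloop
  have hclose : ∀ r ∈ Icc (0 : ℝ) T, dist (s (τ₂ + r), x (τ₂ + r)) (sg (tl + r), xg (tl + r)) < μ := by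
    intro r hr
    refine (hK ho hg.orbit hr.1).trans_lt ?_
    have e1 : dist (s τ₂, x τ₂) (sg tl, xg tl) = sg tl - w := by
      rw [Prod.dist_eq, hx2, hg.at_tl, dist_self, hsw, Real.dist_eq, abs_sub_comm,
        abs_of_pos (sub_pos.2 hw2), max_eq_left (sub_pos.2 hw2).le]
    rw [e1]
    have e2 : Real.exp (K * r) ≤ Real.exp (K * T) :=
      Real.exp_le_exp.2 (mul_le_mul_of_nonneg_left hr.2 hK0)
    have e3 : μ = μ * Real.exp (-(K * T)) * Real.exp (K * T) := by
      rw [mul_assoc, ← Real.exp_add]; simp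
    rw [e3]
    have := Real.exp_pos (K * T)
    have := Real.exp_pos (K * r)
    calc (sg tl - w) * Real.exp (K * r) ≤ (sg tl - w) * Real.exp (K * T) :=
          mul_le_mul_of_nonneg_left e2 (by linarith)
      _ < _ := mul_lt_mul_of_pos_right (by linarith) (by positivity)
  have hclose' : ∀ r ∈ Icc (0 : ℝ) T, |s (τ₂ + r) - sg (tl + r)| < μ ∧
      |x (τ₂ + r) - xg (tl + r)| < μ := fun r hr => by
    have := hclose r hr
    rw [Prod.dist_eq] at this
    exact ⟨(le_max_left _ _).trans_lt this, (le_max_right _ _).trans_lt this⟩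
  -- A loop that turns by time `T` would be at `x = al`, `s < s₀`, within `m` of the regular orbit;
  -- one that turns later would follow the regular orbit beyond `N`.
  rcases le_or_gt (τ₁ - τ₂) T with h1 | h1
  · have hmem : τ₁ - τ₂ ∈ Icc 0 T := ⟨by linarith, h1⟩
    have h2 := hclose' _ hmem
    rw [add_sub_cancel, hx1, abs_lt, abs_lt] at h2
    have h3 : m ≤ max (xg (tl + (τ₁ - τ₂)) - d.al) (sg (tl + (τ₁ - τ₂)) - d.s₀) := hmin hmem
    have h4 := min_le_left m (xg (tl + T) - d.N)
    rcases le_max_iff.1 h3 with h5 | h5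
    · linarith [h2.2.1]
    · linarith [h2.1.1]
  · have h2 := (hclose' T ⟨hT0.le, le_rfl⟩).2
    rw [abs_lt] at h2
    linarith [(hr (τ₂ + T) ⟨by linarith, by linarith⟩).2, h2.1,
      min_le_right m (xg (tl + T) - d.N)]

/-- A regular orbit that reaches `N` forces a periodic orbit. -/
theorem hasPeriodicOrbit (hg : d.IsBlowup sg xg t₁ tl t₂) : HasPeriodicOrbit d.lam d.Lam d.p := by
  obtain ⟨z₀, w₀, hz0, hz0', hl0, hle0⟩ := hg.exists_expanding_loop
  obtain ⟨ε, hε, hno⟩ := hg.exists_no_loop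
  set A : Set ℝ := {z | z₀ ≤ z ∧ z < sg tl ∧ ∃ w, d.HasLoop z w ∧ z ≤ w} with hA
  have hz0A : z₀ ∈ A := ⟨le_rfl, hz0', w₀, hl0, hle0⟩
  have hbdd : BddAbove A := ⟨sg tl, fun z hz => hz.2.1.le⟩
  have hlt : ∀ {z w}, z < sg tl → d.HasLoop z w → w < sg tl := by
    intro z w hz hl
    obtain ⟨w', hw', hl'⟩ := hg.exists_loop (by
      obtain ⟨_, _, _, _, _, _, _, _, _, _, _, _, _, _, _, _, h, _⟩ := hl
      exact h) hz
    exact (hl.mono hl' le_rfl).trans_lt hw'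
  set zs := sSup A with hzs
  have hzs0 : z₀ ≤ zs := le_csSup hbdd hz0A
  have hzsl : zs < sg tl := by
    refine lt_of_le_of_ne (csSup_le ⟨_, hz0A⟩ fun z hz => hz.2.1.le) fun heq => ?_
    obtain ⟨z, hz, hzε⟩ := exists_lt_of_lt_csSup ⟨_, hz0A⟩ (show sg tl - ε < sSup A by
      rw [← hzs, heq]; linarith)
    obtain ⟨w, hw, hzw⟩ := hz.2.2
    exact hno z w (by linarith) (hlt hz.2.1 hw) hw
  obtain ⟨ws, hws, hls⟩ := hg.exists_loop (hz0.trans_le hzs0) hzsl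
  -- At the supremum, monotonicity replaces continuity. If `ws < zs`, an element of `A` above `ws`
  -- contradicts monotonicity; if `ws > zs`, then `ws` itself belongs to `A`.
  rcases lt_trichotomy ws zs with h | h | h
  · obtain ⟨z, hz, hzw⟩ := exists_lt_of_lt_csSup ⟨_, hz0A⟩ h
    obtain ⟨w, hw, hzw'⟩ := hz.2.2
    have := hw.mono hls (le_csSup hbdd hz)
    linarith
  · rw [h] at hls
    exact hls.hasPeriodicOrbit (hzsl.le.trans hg.le_S)
  · obtain ⟨w', hw', hl'⟩ := hg.exists_loop (z := ws) (by linarith) hws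
    have h1 := hls.mono hl' h.le
    have : ws ∈ A := ⟨by linarith, hws, w', hl', h1⟩
    linarith [le_csSup hbdd this]

end IsBlowup
end FlowData
end PucciLaneEmden
end

/-! ### From a regular trajectory to the truncated flow. -/

noncomputable section
namespace PucciLaneEmden
open Filter Topology Set

/-- A regular trajectory of the planar flow that leaves through `x = N` forces a periodic orbit. -/
theorem hasPeriodicOrbit_of_regular {lam Lam p S t₂ : ℝ} (hl : 0 < lam) (hL : lam < Lam)
    (hp : (Lam / lam - 1 + 4) / (Lam / lam - 1) < p) {s x : ℝ → ℝ}
    (hs : ∀ t ≤ t₂, HasDerivAt s (2 - (p - 1) * x t) t)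
    (hx : ∀ t ≤ t₂, HasDerivAt x (x t ^ 2 + min (Real.exp (s t) / Lam)
      (Real.exp (s t) / lam - (Lam / lam - 1) * x t)) t)
    (hpos : ∀ t ≤ t₂, 0 < x t) (hlt : ∀ t < t₂, x t < Lam / lam - 1) (hend : x t₂ = Lam / lam - 1)
    (hS : ∀ t ≤ t₂, s t ≤ S) (hx0 : Tendsto x atBot (𝓝 0)) (hs0 : Tendsto s atBot atBot) :
    HasPeriodicOrbit lam Lam p := by
  set d : FlowData := ⟨lam, Lam, p, S, hl, hL, hp⟩ with hd
  have hdN : d.N = Lam / lam - 1 := rfl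
  have hle : ∀ t ≤ t₂, x t ≤ d.N := fun t ht => by
    rcases eq_or_lt_of_le ht with h | h
    · rw [h, hend, hdN]
    · exact (hlt t h).le
  have hpair : ∀ t ≤ t₂, HasDerivAt (fun t => (s t, x t)) (d.fld (s t, x t)) t := by
    intro t ht
    refine ((hs t ht).prodMk (hx t ht)).congr_deriv ?_
    have h1 : d.cl (x t) = x t := d.cl_of_mem (hpos t ht).le (hle t ht)
    have h2 := d.p_mul_al
    unfold FlowData.fld FlowData.f
    simp only [h1, min_eq_left (show s t ≤ d.S from hS t ht)]
    refine Prod.ext ?_ rfl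
    change 2 - (d.p - 1) * x t = (d.p - 1) * (d.al - x t)
    linarith
  -- The trajectory lies in the untruncated region up to `t₂`, so by backward uniqueness the global
  -- orbit through its end point extends it.
  obtain ⟨sg, xg, ho, hsg, hxg⟩ := d.exists_orbit t₂ (s t₂) (x t₂)
  obtain ⟨K, hK⟩ := d.exists_lipschitz
  have heq : ∀ t ≤ t₂, sg t = s t ∧ xg t = x t := by
    intro t ht
    have h := ODE_solution_unique_of_mem_Icc_left (v := fun _ => d.fld) (s := fun _ => univ) (K := K)
      (f := fun t => (s t, x t)) (g := fun t => (sg t, xg t)) (a := t) (b := t₂)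
      (fun t _ => hK.lipschitzOnWith)
      (fun r hr => (hpair r hr.2).continuousAt.continuousWithinAt)
      (fun r hr => (hpair r hr.2).hasDerivWithinAt) (fun _ _ => mem_univ _)
      (fun r _ => (ho.pair r).continuousAt.continuousWithinAt)
      (fun r _ => (ho.pair r).hasDerivWithinAt) (fun _ _ => mem_univ _)
      (by simp [hsg, hxg])
    have := h ⟨le_rfl, ht⟩
    simp only [Prod.mk.injEq] at this
    exact ⟨this.1.symm, this.2.symm⟩
  have halN := d.al_lt_N
  obtain ⟨T, hT⟩ := eventually_atBot.1 ((hx0.eventually (gt_mem_nhds d.al_pos)).and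
    (eventually_lt_atBot t₂))
  have hx2 : x t₂ = d.N := hend
  obtain ⟨t₁, ht1, ht10, ht1p⟩ := exists_first_zero (φ := fun t => d.al - xg t) (a := T) (b := t₂)
    (continuous_const.sub ho.continuous_x).continuousOn (hT T le_rfl).2.le
    (by rw [(heq T (hT T le_rfl).2.le).2]; linarith [(hT T le_rfl).1])
    (by rw [hxg, hx2]; linarith)
  obtain ⟨tl, htl, htl0, htlp⟩ := exists_last_zero (φ := fun t => xg t - d.al) (a := t₁) (b := t₂)
    (ho.continuous_x.sub continuous_const).continuousOn ht1.2 (by linarith)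
    (by rw [hxg, hx2]; linarith)
  have hreg : d.IsRegular sg xg t₁ :=
    { orbit := ho
      left := fun t ht => by
        have h1 := (heq t (ht.le.trans ht1.2)).2
        refine ⟨by rw [h1]; exact hpos t (ht.le.trans ht1.2), ?_⟩
        rcases le_total T t with h2 | h2
        · linarith [ht1p t ⟨h2, ht⟩]
        · rw [h1]; exact (hT t h2).1
      at_end := by linarith
      tendsto := hs0.congr' (by
        filter_upwards [eventually_le_atBot t₂] with t ht using (heq t ht).1.symm)
      le_S := by rw [(heq t₁ ht1.2).1]; exact hS t₁ ht1.2 }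
  have hb : d.IsBlowup sg xg t₁ tl t₂ :=
    { reg := hreg
      le := htl.1
      lt := htl.2
      at_tl := by linarith
      right := fun t ht => by linarith [htlp t ⟨ht.1, ht.2.le⟩]
      at_end := by rw [hxg, hx2]
      le_S := by rw [(heq tl htl.2.le).1]; exact hS tl htl.2.le }
  exact hb.hasPeriodicOrbit
end PucciLaneEmden
end

/-! ### The logarithmic profile of a solution, and the periodic orbit it forces. -/

noncomputable section
namespace PucciLaneEmden
open Filter Topology Set

/-- A unit vector of the plane. -/
def axis : Plane := EuclideanSpace.single 0 1

theorem norm_axis : ‖axis‖ = 1 := by simp [axis]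

theorem norm_exp_smul_axis (t : ℝ) : ‖Real.exp t • axis‖ = Real.exp t := by
  rw [norm_smul, norm_axis, mul_one, Real.norm_eq_abs, Real.abs_exp]

/-- The Hessian of a radial function in terms of its profile in the logarithm of the radius. -/
theorem hasHessAt_log {G G₁ : ℝ → ℝ} {G₂ t : ℝ} {x : Plane} (hx : ‖x‖ ^ 2 = Real.exp (2 * t))
    (h1 : ∀ᶠ τ in 𝓝 t, HasDerivAt G (G₁ τ) τ) (h2 : HasDerivAt G₁ G₂ t) :
    ∃ B, HasHessAt (fun y : Plane => G (Real.log (‖y‖ ^ 2) / 2)) B x ∧ ∀ lam Lam,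
      Real.exp (2 * t) * pucciForm lam Lam B =
        pucciWeight lam Lam (G₂ - G₁ t) + pucciWeight lam Lam (G₁ t) := by
  set s := ‖x‖ ^ 2 with hs
  have hs0 : 0 < s := by rw [hx]; exact Real.exp_pos _
  have hlog : Real.log s / 2 = t := by rw [hx, Real.log_exp]; ring
  have hd : ∀ r, 0 < r → HasDerivAt (fun r => Real.log r / 2) (1 / (2 * r)) r := fun r hr =>
    ((Real.hasDerivAt_log hr.ne').div_const 2).congr_deriv (by field_simp)
  have hcont : ContinuousAt (fun r => Real.log r / 2) s := (hd s hs0).continuousAt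
  have hev : ∀ᶠ r in 𝓝 s, HasDerivAt (fun r => G (Real.log r / 2))
      (G₁ (Real.log r / 2) * (1 / (2 * r))) r := by
    rw [← hlog] at h1
    filter_upwards [hcont.eventually h1, lt_mem_nhds hs0] with r hr hr0
    exact hr.comp r (hd r hr0)
  have hd2 : HasDerivAt (fun r => G₁ (Real.log r / 2) * (1 / (2 * r)))
      (G₂ / (4 * s ^ 2) - G₁ t / (2 * s ^ 2)) s := by
    have e1 : HasDerivAt (fun r => G₁ (Real.log r / 2)) (G₂ * (1 / (2 * s))) s :=
      HasDerivAt.comp s (by rwa [hlog]) (hd s hs0)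
    have e2 : HasDerivAt (fun r : ℝ => 1 / (2 * r)) (-1 / (2 * s ^ 2)) s := by
      have := ((hasDerivAt_id s).const_mul 2).inv (by simpa using hs0.ne')
      simp only [one_div]
      refine this.congr_deriv ?_
      simp only [id]; field_simp
    refine (e1.mul e2).congr_deriv ?_
    rw [hlog]; field_simp; ring
  have hH := HasHessAt.of_normSq (x := x) (0 : Plane) (k := fun r => G (Real.log r / 2))
    (by simpa only [sub_zero] using hev) (by simpa only [sub_zero] using hd2)
  simp only [sub_zero] at hH
  refine ⟨_, hH, fun lam Lam => ?_⟩
  rw [pucciForm_rankOne, ← hx, ← hs, mul_add, ← pucciWeight_mul _ hs0.le, ← pucciWeight_mul _ hs0.le,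
    hlog]
  congr 2 <;> (field_simp; try ring)

/-- The tangential eigenvalue `-v` is nonpositive, but the sign of the radial one is unknown. The
weight is an increasing bijection with inverse `y ↦ max (y / lam) (y / Lam)`; solving for `v'` turns
the maximum into a minimum. -/
theorem pucciWeight_sub_eq_iff {lam Lam v v' F : ℝ} (hl : 0 < lam) (hL : lam < Lam) (hv : 0 ≤ v) :
    pucciWeight lam Lam (v - v') + pucciWeight lam Lam (-v) = -F ↔
      v' = min (F / Lam) (F / lam - (Lam / lam - 1) * v) := by
  have hLp := hl.trans hL
  rw [pucciWeight_of_nonpos (neg_nonpos.2 hv)]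
  have e : F / lam - (Lam / lam - 1) * v = v - (Lam * v - F) / lam := by field_simp; ring
  have e' : F / Lam = v - (Lam * v - F) / Lam := by field_simp; ring
  rw [e, e']
  have key : ∀ m y : ℝ, pucciWeight lam Lam m = y ↔ m = max (y / lam) (y / Lam) := by
    intro m y
    rcases le_total 0 y with hy | hy
    · rw [max_eq_left (div_le_div_of_nonneg_left hy hl hL.le)]
      constructor
      · intro h
        rcases le_total 0 m with hm | hm
        · rw [pucciWeight_of_nonneg hm] at h; rw [← h]; field_simp
        · rw [pucciWeight_of_nonpos hm] at h
          have : m = 0 := by nlinarith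
          rw [this, mul_zero] at h; rw [this, ← h]; simp
      · intro h
        rw [pucciWeight_of_nonneg (by rw [h]; positivity), h]; field_simp
    · have hle : y / lam ≤ y / Lam := by
        rw [div_le_div_iff₀ hl hLp]; nlinarith
      rw [max_eq_right hle]
      constructor
      · intro h
        rcases le_total 0 m with hm | hm
        · rw [pucciWeight_of_nonneg hm] at h
          have : m = 0 := by nlinarith
          rw [this, mul_zero] at h; rw [this, ← h]; simp
        · rw [pucciWeight_of_nonpos hm] at h; rw [← h]; field_simp
      · intro h
        rw [pucciWeight_of_nonpos (by rw [h]; exact div_nonpos_of_nonpos_of_nonneg hy hLp.le), h]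
        field_simp
  have hmin : min (v - (Lam * v - F) / Lam) (v - (Lam * v - F) / lam) =
      v - max ((Lam * v - F) / lam) ((Lam * v - F) / Lam) := by
    rw [min_comm, ← min_sub_sub_left]
  rw [hmin, show (pucciWeight lam Lam (v - v') + Lam * -v = -F) ↔
    pucciWeight lam Lam (v - v') = Lam * v - F by constructor <;> intro h <;> linarith, key]
  constructor <;> intro h <;> linarith

namespace IsBallSolution
variable {lam Lam p R : ℝ} {u : Plane → ℝ}

/-- The logarithmic profile of a solution and its equation. -/
theorem exists_profile (hu : IsBallSolution lam Lam p R u) (hl : 0 < lam) (hL : lam < Lam)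
    (hp : 1 < p) (hR : 0 < R) : ∃ v : ℝ → ℝ, ∀ t < Real.log R,
      HasDerivAt (fun t => u (Real.exp t • axis)) (-v t) t ∧ 0 < v t ∧
      HasDerivAt v (min (Real.exp (2 * t) * u (Real.exp t • axis) ^ p / Lam)
        (Real.exp (2 * t) * u (Real.exp t • axis) ^ p / lam - (Lam / lam - 1) * v t)) t ∧
      v t = -(Real.exp t * fderiv ℝ u (Real.exp t • axis) axis) := by
  set G : ℝ → ℝ := fun t => u (Real.exp t • axis) with hG
  have hexp : ∀ t < Real.log R, Real.exp t < R := fun t ht => by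
    rwa [← Real.lt_log_iff_exp_lt hR]
  have hlt : ∀ t < Real.log R, ‖Real.exp t • axis‖ < R := fun t ht => by
    rw [norm_exp_smul_axis]; exact hexp t ht
  have hC : ∀ t < Real.log R, ContDiffAt ℝ 2 G t := fun t ht => by
    have h1 := hu.contDiffOn.contDiffAt
      (Metric.isOpen_ball.mem_nhds (mem_ball_zero_iff.2 (hlt t ht)))
    have h2 : ContDiffAt ℝ 2 (fun t : ℝ => Real.exp t • axis) t :=
      Real.contDiff_exp.contDiffAt.smul contDiffAt_const
    exact h1.comp t h2
  have hd1 : ∀ t < Real.log R, HasDerivAt G (deriv G t) t := fun t ht =>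
    ((hC t ht).differentiableAt (by norm_num)).hasDerivAt
  have hd2 : ∀ t < Real.log R, HasDerivAt (deriv G) (deriv (deriv G) t) t := fun t ht => by
    have h1 : ContDiffAt ℝ 1 (fderiv ℝ G) t := (hC t ht).fderiv_right (by norm_num)
    have h2 : DifferentiableAt ℝ (fun t => fderiv ℝ G t 1) t :=
      (h1.differentiableAt (by norm_num)).clm_apply (differentiableAt_const _)
    exact h2.hasDerivAt
  have heq : ∀ t < Real.log R, pucciWeight lam Lam (deriv (deriv G) t - deriv G t) +
      pucciWeight lam Lam (deriv G t) = -(Real.exp (2 * t) * G t ^ p) := by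
    intro t ht
    have hx : ‖Real.exp t • axis‖ ^ 2 = Real.exp (2 * t) := by
      rw [norm_exp_smul_axis, ← Real.exp_nat_mul]; norm_num
    obtain ⟨B, hB, hBp⟩ := hasHessAt_log (G := G) hx (by
      filter_upwards [gt_mem_nhds ht] with τ hτ using hd1 τ hτ) (hd2 t ht)
    rw [← hBp]
    have hcongr : u =ᶠ[𝓝 (Real.exp t • axis)]
        fun y : Plane => G (Real.log (‖y‖ ^ 2) / 2) := by
      have ho : IsOpen {y : Plane | 0 < ‖y‖ ∧ ‖y‖ < R} :=
        (isOpen_lt continuous_const continuous_norm).inter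
          (isOpen_lt continuous_norm continuous_const)
      filter_upwards [ho.mem_nhds (show Real.exp t • axis ∈ {y : Plane | 0 < ‖y‖ ∧ ‖y‖ < R} from
        ⟨by rw [norm_exp_smul_axis]; exact Real.exp_pos t, hlt t ht⟩)] with y hy
      have e : Real.exp (Real.log (‖y‖ ^ 2) / 2) = ‖y‖ := by
        rw [Real.log_pow]; norm_num; exact Real.exp_log hy.1
      rw [hG]; simp only [e]
      exact hu.radial hl hL hp hR hy.2.le
        (by rw [norm_smul, norm_axis, mul_one, norm_norm])
    have h1 := (hB.congr hcongr).pucciMinus_hessian lam Lam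
    rw [pucciMinus_hessian, hu.pucciForm_eq (hlt t ht)] at h1
    rw [← h1]; ring
  have hanti : ∀ t < Real.log R, deriv G t ≤ 0 := by
    intro t ht
    have h := (hd1 t ht).hasDerivWithinAt (s := Iio t)
    rw [hasDerivWithinAt_iff_tendsto_slope' self_notMem_Iio] at h
    refine le_of_tendsto h ?_
    filter_upwards [self_mem_nhdsWithin] with r hr
    have := hu.antitone_on_ray hl hL hp hR norm_axis (Real.exp_pos r).le
      (Real.exp_le_exp.2 (mem_Iio.1 hr).le) (hexp t ht).le
    rw [slope_def_field]
    exact div_nonpos_of_nonneg_of_nonpos (sub_nonneg.2 this) (by linarith [mem_Iio.1 hr])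
  have hF : ∀ t < Real.log R, 0 < Real.exp (2 * t) * G t ^ p := fun t ht =>
    mul_pos (Real.exp_pos _) (Real.rpow_pos_of_pos (hu.pos _ (mem_ball_zero_iff.2 (hlt t ht))) _)
  have hv' : ∀ t < Real.log R, HasDerivAt (fun t => -deriv G t)
      (min (Real.exp (2 * t) * G t ^ p / Lam)
        (Real.exp (2 * t) * G t ^ p / lam - (Lam / lam - 1) * -deriv G t)) t := by
    intro t ht
    refine (hd2 t ht).neg.congr_deriv ?_
    rw [← pucciWeight_sub_eq_iff hl hL (by linarith [hanti t ht]), neg_neg, ← heq t ht]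
    congr 2; ring
  refine ⟨fun t => -deriv G t, fun t ht => ⟨by simpa using hd1 t ht, ?_, hv' t ht, ?_⟩⟩
  -- A zero of `v` would be a local minimum, with zero derivative; but when `v = 0` the right-hand
  -- side of the equation is positive.
  · refine lt_of_le_of_ne (by linarith [hanti t ht]) fun h0 => ?_
    dsimp only at h0
    have hmin : IsLocalMin (fun t => -deriv G t) t := by
      filter_upwards [gt_mem_nhds ht] with r hr
      rw [← h0]; linarith [hanti r hr]
    have h1 := hmin.hasDerivAt_eq_zero (hv' t ht)
    rw [← h0, mul_zero, sub_zero] at h1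
    have := lt_min (div_pos (hF t ht) (hl.trans hL)) (div_pos (hF t ht) hl)
    linarith
  · have h1 : HasFDerivAt u (fderiv ℝ u (Real.exp t • axis)) (Real.exp t • axis) :=
      ((hu.contDiffOn.contDiffAt (Metric.isOpen_ball.mem_nhds
        (mem_ball_zero_iff.2 (hlt t ht)))).differentiableAt (by norm_num)).hasFDerivAt
    have h2 : HasDerivAt (fun t : ℝ => Real.exp t • axis) (Real.exp t • axis) t :=
      (Real.hasDerivAt_exp t).smul_const axis
    have h3 : deriv G t = _ := (h1.comp_hasDerivAt t h2).deriv
    change -deriv G t = _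
    rw [h3, map_smul, smul_eq_mul]

/-- A solution with a large exponent forces a periodic orbit. -/
theorem hasPeriodicOrbit (hu : IsBallSolution lam Lam p R u) (hl : 0 < lam) (hL : lam < Lam)
    (hp : (Lam / lam - 1 + 4) / (Lam / lam - 1) < p) (hR : 0 < R) :
    HasPeriodicOrbit lam Lam p := by
  have hN : 0 < Lam / lam - 1 := by
    have : 1 < Lam / lam := by rwa [lt_div_iff₀ hl, one_mul]
    linarith
  have hp1 : 1 < p := by
    refine lt_trans ?_ hp
    rw [lt_div_iff₀ hN]; linarith
  obtain ⟨v, hv⟩ := hu.exists_profile hl hL hp1 hR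
  set N := Lam / lam - 1 with hNdef
  set G : ℝ → ℝ := fun t => u (Real.exp t • axis) with hG
  set ρ := Real.log R with hρ
  have hexp : ∀ t < ρ, Real.exp t < R := fun t ht => by rwa [← Real.lt_log_iff_exp_lt hR]
  have hG0 : ∀ t < ρ, 0 < G t := fun t ht => hu.pos _ (mem_ball_zero_iff.2 (by
    rw [norm_exp_smul_axis]; exact hexp t ht))
  have hu0 : 0 < u 0 := hu.pos 0 (by simpa using hR)
  set x : ℝ → ℝ := fun t => v t / G t with hx
  set s : ℝ → ℝ := fun t => 2 * t + (p - 1) * Real.log (G t) with hs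
  have hx0 : ∀ t < ρ, 0 < x t := fun t ht => div_pos (hv t ht).2.1 (hG0 t ht)
  have hes : ∀ t < ρ, Real.exp (s t) = Real.exp (2 * t) * G t ^ p / G t := by
    intro t ht
    have h := hG0 t ht
    rw [hs]; dsimp only
    rw [Real.exp_add, mul_div_assoc, Real.rpow_def_of_pos h]
    congr 1
    nth_rewrite 3 [← Real.exp_log h]
    rw [← Real.exp_sub]; ring_nf
  have hxd : ∀ t < ρ, HasDerivAt x (x t ^ 2 + min (Real.exp (s t) / Lam)
      (Real.exp (s t) / lam - N * x t)) t := by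
    intro t ht
    have h := hG0 t ht
    have hLp := hl.trans hL
    obtain ⟨h1, h2, h3, -⟩ := hv t ht
    refine (h3.div h1 h.ne').congr_deriv ?_
    have e : min (Real.exp (s t) / Lam) (Real.exp (s t) / lam - N * x t) =
        min (Real.exp (2 * t) * G t ^ p / Lam)
          (Real.exp (2 * t) * G t ^ p / lam - N * v t) / G t := by
      rw [hes t ht, hx, ← min_div_div_right h.le]
      congr 1
      · field_simp
      · field_simp
    rw [e, hx]; dsimp only
    change _ = (v t / G t) ^ 2 + _
    field_simp
    ring
  have hsd : ∀ t < ρ, HasDerivAt s (2 - (p - 1) * x t) t := by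
    intro t ht
    have h := hG0 t ht
    have := ((hasDerivAt_id t).const_mul 2).add (((hv t ht).1.log h.ne').const_mul (p - 1))
    refine this.congr_deriv ?_
    rw [hx]; dsimp only; ring
  have hγ : Tendsto (fun t : ℝ => Real.exp t • axis) atBot (𝓝 0) := by
    have := Real.tendsto_exp_atBot.smul_const axis
    rwa [zero_smul] at this
  have hC0 : ContDiffAt ℝ 2 u 0 := hu.contDiffOn.contDiffAt
    (Metric.isOpen_ball.mem_nhds (by simpa using hR))
  have hGlim : Tendsto G atBot (𝓝 (u 0)) := hC0.continuousAt.tendsto.comp hγ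
  have hvlim : Tendsto v atBot (𝓝 0) := by
    have h1 : ContDiffAt ℝ 1 (fderiv ℝ u) 0 := hC0.fderiv_right (by norm_num)
    have h2 : Tendsto (fun t : ℝ => fderiv ℝ u (Real.exp t • axis) axis) atBot
        (𝓝 (fderiv ℝ u 0 axis)) :=
      (h1.continuousAt.clm_apply continuousAt_const).tendsto.comp hγ
    have h3 := (Real.tendsto_exp_atBot.mul h2).neg
    rw [zero_mul, neg_zero] at h3
    refine h3.congr' ?_
    filter_upwards [eventually_lt_atBot ρ] with t ht using (hv t ht).2.2.2.symm
  have hxlim : Tendsto x atBot (𝓝 0) := by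
    have := hvlim.div hGlim hu0.ne'
    rwa [zero_div] at this
  have hslim : Tendsto s atBot atBot := by
    have h1 : Tendsto (fun t => (p - 1) * Real.log (G t)) atBot (𝓝 ((p - 1) * Real.log (u 0))) :=
      ((Real.continuousAt_log hu0.ne').tendsto.comp hGlim).const_mul _
    exact (tendsto_id.const_mul_atBot two_pos).atBot_add h1
  have hsS : ∀ t < ρ, s t ≤ 2 * ρ + (p - 1) * Real.log (u 0) := by
    intro t ht
    have h1 := hu.antitone_on_ray hl hL hp1 hR norm_axis le_rfl (Real.exp_pos t).le (hexp t ht).le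
    rw [zero_smul] at h1
    have h2 := Real.log_le_log (hG0 t ht) h1
    have := mul_le_mul_of_nonneg_left h2 (by linarith : 0 ≤ p - 1)
    rw [hs]; dsimp only; linarith
  obtain ⟨T, hT⟩ := eventually_atBot.1 ((hxlim.eventually (gt_mem_nhds hN)).and
    (eventually_lt_atBot ρ))
  -- Since `(log u)' = -x` in logarithmic radius, `x < N` up to `ρ` would bound `u` below by a
  -- positive constant, against the boundary condition.
  obtain ⟨t', ht', hxt'⟩ : ∃ t < ρ, N ≤ x t := by
    by_contra hcon
    push Not at hcon
    have hTρ := (hT T le_rfl).2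
    have hge : ∀ t ∈ Ico T ρ, G T * Real.exp (-N * (ρ - T)) ≤ G t := by
      intro t ht
      have h1 := mul_sub_le_of_le_deriv (r := -N) ht.1 (fun r hr =>
        (hv r (hr.2.trans_lt ht.2)).1.log (hG0 r (hr.2.trans_lt ht.2)).ne') (fun r hr => by
          have := (hcon r (hr.2.trans_lt ht.2)).le
          rw [neg_div]; exact neg_le_neg this)
      have h2 : Real.log (G T) + -N * (ρ - T) ≤ Real.log (G t) := by
        have := ht.2
        nlinarith
      have h3 := Real.exp_le_exp.2 h2
      rwa [Real.exp_add, Real.exp_log (hG0 T hTρ), Real.exp_log (hG0 t ht.2)] at h3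
    have hcl : Tendsto G (𝓝[<] ρ) (𝓝 0) := by
      have hn : ‖Real.exp ρ • axis‖ = R := by rw [norm_exp_smul_axis, hρ, Real.exp_log hR]
      have h1 := hu.continuousOn (Real.exp ρ • axis) (mem_closedBall_zero_iff.2 hn.le)
      rw [ContinuousWithinAt, hu.boundary _ (mem_sphere_zero_iff_norm.2 hn)] at h1
      refine h1.comp (tendsto_nhdsWithin_iff.2 ⟨?_, ?_⟩)
      · exact ((Real.continuous_exp.smul continuous_const).tendsto ρ).mono_left nhdsWithin_le_nhds
      · filter_upwards [self_mem_nhdsWithin] with r hr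
        rw [mem_closedBall_zero_iff, norm_exp_smul_axis]; exact (hexp r hr).le
    have h0 : G T * Real.exp (-N * (ρ - T)) ≤ 0 := by
      refine ge_of_tendsto hcl ?_
      filter_upwards [Ioo_mem_nhdsLT hTρ] with t ht using hge t ⟨ht.1.le, ht.2⟩
    have := mul_pos (hG0 T hTρ) (Real.exp_pos (-N * (ρ - T)))
    linarith
  have hTt : T ≤ t' := by
    by_contra h
    linarith [(hT t' (not_le.1 h).le).1]
  obtain ⟨t₂, ht2, ht20, ht2p⟩ := exists_first_zero (φ := fun t => N - x t) (a := T) (b := t')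
    (fun t ht => (continuousAt_const.sub
      (hxd t (ht.2.trans_lt ht')).continuousAt).continuousWithinAt) hTt
    (by linarith [(hT T le_rfl).1]) (by linarith)
  have h2ρ : t₂ < ρ := ht2.2.trans_lt ht'
  refine hasPeriodicOrbit_of_regular (t₂ := t₂) (s := s) (x := x)
    (S := 2 * ρ + (p - 1) * Real.log (u 0)) hl hL hp (fun t ht => hsd t (ht.trans_lt h2ρ))
    (fun t ht => hxd t (ht.trans_lt h2ρ)) (fun t ht => hx0 t (ht.trans_lt h2ρ)) (fun t ht => ?_)
    (by linarith) (fun t ht => hsS t (ht.trans_lt h2ρ)) hxlim hslim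
  rcases le_total T t with h | h
  · linarith [ht2p t ⟨h, ht⟩]
  · exact (hT t h).1

end IsBallSolution
end PucciLaneEmden
end

/-! ### Local existence of the regular radial profile at the origin. -/

noncomputable section
namespace PucciLaneEmden
open Filter Topology Set

/-- The power function, truncated outside `[0, 2]`. -/
def clampPow (p a : ℝ) : ℝ := (max 0 (min a 2)) ^ p

theorem clampPow_of_mem {p a : ℝ} (h0 : 0 ≤ a) (h2 : a ≤ 2) : clampPow p a = a ^ p := by
  rw [clampPow, min_eq_left h2, max_eq_right h0]

theorem clampPow_nonneg (p a : ℝ) : 0 ≤ clampPow p a := Real.rpow_nonneg (le_max_left _ _) _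

theorem clampPow_le {p : ℝ} (hp : 0 ≤ p) (a : ℝ) : clampPow p a ≤ 2 ^ p :=
  Real.rpow_le_rpow (le_max_left _ _) (max_le zero_le_two (min_le_right _ _)) hp

theorem continuous_clampPow {p : ℝ} (hp : 0 ≤ p) : Continuous (clampPow p) :=
  (continuous_const.max (continuous_id.min continuous_const)).rpow_const fun _ => Or.inr hp

theorem abs_clampPow_sub_le {p : ℝ} (hp : 1 ≤ p) (a b : ℝ) :
    |clampPow p a - clampPow p b| ≤ p * 2 ^ (p - 1) * |a - b| := by
  have hK : 0 ≤ p * (2 : ℝ) ^ (p - 1) := by positivity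
  have key : ∀ x y : ℝ, 0 ≤ y → y ≤ x → x ≤ 2 → |x ^ p - y ^ p| ≤ p * 2 ^ (p - 1) * |x - y| := by
    intro x y hy hxy hx
    rw [abs_of_nonneg (sub_nonneg.2 hxy),
      abs_of_nonneg (sub_nonneg.2 (Real.rpow_le_rpow hy hxy (by linarith)))]
    rcases eq_or_lt_of_le (hy.trans hxy) with h | h
    · have : y = 0 := le_antisymm (hxy.trans h.ge) hy
      rw [← h, this]; simp
    · refine (rpow_sub_rpow_le hp h hy).trans ?_
      have := Real.rpow_le_rpow h.le hx (by linarith : 0 ≤ p - 1)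
      exact mul_le_mul_of_nonneg_right (mul_le_mul_of_nonneg_left this (by linarith))
        (sub_nonneg.2 hxy)
  have hc : |max 0 (min a 2) - max 0 (min b 2)| ≤ |a - b| := by
    have h1 := abs_max_sub_max_le_max 0 (min a 2) 0 (min b 2)
    have h2 := abs_min_sub_min_le_max a 2 b 2
    simp only [sub_self, abs_zero] at h1 h2
    rw [max_eq_right (abs_nonneg (min a 2 - min b 2))] at h1
    rw [max_eq_left (abs_nonneg (a - b))] at h2
    exact h1.trans h2
  have hle : ∀ c : ℝ, max 0 (min c 2) ≤ 2 := fun c => max_le zero_le_two (min_le_right _ _)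
  refine le_trans ?_ (mul_le_mul_of_nonneg_left hc hK)
  rcases le_total (max 0 (min a 2)) (max 0 (min b 2)) with h | h
  · rw [abs_sub_comm, abs_sub_comm (max 0 (min a 2))]
    exact key _ _ (le_max_left _ _) h (hle b)
  · exact key _ _ (le_max_left _ _) h (hle a)

/-- Mean value over the segment from `0` to `s`. -/
def segmentMean (g : ℝ → ℝ) (s : ℝ) : ℝ := ∫ τ in (0 : ℝ)..1, g (s * τ)

theorem continuous_segmentMean {g : ℝ → ℝ} (hg : Continuous g) : Continuous (segmentMean g) :=
  intervalIntegral.continuous_parametric_intervalIntegral_of_continuous' (by fun_prop) 0 1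

theorem abs_segmentMean_le {g : ℝ → ℝ} {C : ℝ} (hC : ∀ s, |g s| ≤ C) (s : ℝ) :
    |segmentMean g s| ≤ C := by
  have := intervalIntegral.norm_integral_le_of_norm_le_const (a := 0) (b := 1) (C := C)
    (f := fun τ => g (s * τ)) (fun τ _ => hC _)
  unfold segmentMean
  simpa using this

theorem segmentMean_sub {g k : ℝ → ℝ} (hg : Continuous g) (hk : Continuous k) (s : ℝ) :
    segmentMean g s - segmentMean k s = segmentMean (fun r => g r - k r) s :=
  (intervalIntegral.integral_sub (Continuous.intervalIntegrable (by fun_prop) _ _)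
    (Continuous.intervalIntegrable (by fun_prop) _ _)).symm

theorem mul_segmentMean (g : ℝ → ℝ) (s : ℝ) : s * segmentMean g s = ∫ r in (0 : ℝ)..s, g r := by
  unfold segmentMean
  rw [intervalIntegral.mul_integral_comp_mul_left, mul_zero, mul_one]

/-- The mean `(1/s) ∫₀^s g` written as an integral over `[0, 1]` can be differentiated under the
integral also at `s = 0`. This gives a profile that is `C²` in `r²` across the origin. -/
theorem hasDerivAt_segmentMean {g g' : ℝ → ℝ} {ε : ℝ} (hg : Continuous g) (hg' : Continuous g')
    (hd : ∀ s, |s| < ε → HasDerivAt g (g' s) s) {s : ℝ} (hs : |s| < ε) :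
    HasDerivAt (segmentMean g) (∫ τ in (0 : ℝ)..1, τ * g' (s * τ)) s := by
  obtain ⟨C, hC⟩ := (isCompact_Icc (a := -ε) (b := ε)).exists_bound_of_continuousOn
    hg'.continuousOn
  have hmem : ∀ x ∈ Ioo (-ε) ε, ∀ τ ∈ Ioc (0 : ℝ) 1, |x * τ| < ε := by
    intro x hx τ hτ
    rw [abs_mul, abs_of_pos hτ.1]
    exact (mul_le_of_le_one_right (abs_nonneg _) hτ.2).trans_lt (abs_lt.2 hx)
  have hcF : ∀ x : ℝ, Continuous fun τ => g (x * τ) := fun x => by fun_prop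
  have hcF' : Continuous fun τ => τ * g' (s * τ) := by fun_prop
  refine (intervalIntegral.hasDerivAt_integral_of_dominated_loc_of_deriv_le (s := Ioo (-ε) ε)
    (F := fun x τ => g (x * τ)) (F' := fun x τ => τ * g' (x * τ)) (bound := fun _ => C)
    (Ioo_mem_nhds (abs_lt.1 hs).1 (abs_lt.1 hs).2)
    (Eventually.of_forall fun x => (hcF x).aestronglyMeasurable) ((hcF s).intervalIntegrable _ _)
    hcF'.aestronglyMeasurable (Eventually.of_forall fun τ hτ x hx => ?_)
    (continuous_const.intervalIntegrable _ _) (Eventually.of_forall fun τ hτ x hx => ?_)).2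
  · rw [uIoc_of_le zero_le_one] at hτ
    have h := hmem x hx τ hτ
    have h2 := hC (x * τ) ⟨(abs_lt.1 h).1.le, (abs_lt.1 h).2.le⟩
    rw [norm_mul, Real.norm_eq_abs, abs_of_pos hτ.1]
    exact (mul_le_of_le_one_left (norm_nonneg _) hτ.2).trans h2
  · rw [uIoc_of_le zero_le_one] at hτ
    have h1 : HasDerivAt (fun x : ℝ => x * τ) τ x := by
      simpa using (hasDerivAt_id x).mul_const τ
    have := (hd (x * τ) (hmem x hx τ hτ)).comp x h1
    rwa [mul_comm] at this

/-- Solution of the integral equation of the regular radial profile near the origin. -/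
theorem exists_integral_solution {p c : ℝ} (hp : 1 ≤ p) (hc : 0 < c) :
    ∃ ε > 0, ∃ h : ℝ → ℝ, Continuous h ∧ h 0 = 1 ∧ (∀ s, |h s - 1| ≤ 1 / 2) ∧
      ∀ s, |s| < ε → h s = 1 - c * ∫ σ in (0 : ℝ)..s, segmentMean (fun r => clampPow p (h r)) σ := by
  set L : ℝ := p * 2 ^ (p - 1) with hL
  have hL0 : 0 < L := by positivity
  have h2p : (0 : ℝ) < 2 ^ p := by positivity
  -- Small enough both to keep values within `1/2` of `1` and to make the integral operator contract
  -- by `1/2`.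
  set ε : ℝ := 1 / (2 * c * (L + 2 ^ p)) with hε
  have hε0 : 0 < ε := by positivity
  have hεL : c * (ε * L) ≤ 1 / 2 := by
    rw [hε]; rw [show c * (1 / (2 * c * (L + 2 ^ p)) * L) = L / (L + 2 ^ p) / 2 by field_simp]
    have : L / (L + 2 ^ p) ≤ 1 := (div_le_one (by positivity)).2 (by linarith)
    linarith
  have hε2 : c * (ε * 2 ^ p) ≤ 1 / 2 := by
    rw [hε]; rw [show c * (1 / (2 * c * (L + 2 ^ p)) * 2 ^ p) = 2 ^ p / (L + 2 ^ p) / 2 by field_simp]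
    have : (2 : ℝ) ^ p / (L + 2 ^ p) ≤ 1 := (div_le_one (by positivity)).2 (by linarith)
    linarith
  -- Freezing the argument at `±ε` lets the contraction act on bounded continuous functions on the
  -- whole line.
  set P : ℝ → ℝ := fun s => max (-ε) (min s ε) with hP
  have hPc : Continuous P := by rw [hP]; fun_prop
  have hPabs : ∀ s, |P s| ≤ ε := fun s =>
    abs_le.2 ⟨le_max_left _ _, max_le (by linarith) (min_le_right _ _)⟩
  have hψ : ∀ h : BoundedContinuousFunction ℝ ℝ, Continuous fun r => clampPow p (h r) := fun h =>
    (continuous_clampPow (by linarith)).comp h.continuous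
  have hψabs : ∀ h : BoundedContinuousFunction ℝ ℝ, ∀ r, |clampPow p (h r)| ≤ 2 ^ p := fun h r => by
    rw [abs_of_nonneg (clampPow_nonneg _ _)]; exact clampPow_le (by linarith) _
  set F : BoundedContinuousFunction ℝ ℝ → ℝ → ℝ := fun h s =>
    1 - c * ∫ σ in (0 : ℝ)..P s, segmentMean (fun r => clampPow p (h r)) σ with hF
  have hFc : ∀ h, Continuous (F h) := fun h => by
    have h1 : Continuous fun x => ∫ σ in (0 : ℝ)..x, segmentMean (fun r => clampPow p (h r)) σ :=
      intervalIntegral.continuous_primitive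
        (fun a b => (continuous_segmentMean (hψ h)).intervalIntegrable a b) 0
    exact continuous_const.sub (continuous_const.mul (h1.comp hPc))
  have hbound : ∀ (g : ℝ → ℝ) (C : ℝ), 0 ≤ C → (∀ s, |g s| ≤ C) → ∀ s,
      |∫ σ in (0 : ℝ)..P s, segmentMean g σ| ≤ ε * C := by
    intro g C hC0 hC s
    have := intervalIntegral.norm_integral_le_of_norm_le_const (a := 0) (b := P s) (C := C)
      (f := segmentMean g) (fun σ _ => abs_segmentMean_le hC σ)
    rw [sub_zero, Real.norm_eq_abs] at this
    refine this.trans ?_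
    rw [mul_comm]; exact mul_le_mul_of_nonneg_right (hPabs s) hC0
  have hF1 : ∀ h s, |F h s - 1| ≤ 1 / 2 := fun h s => by
    have := hbound _ _ h2p.le (hψabs h) s
    rw [hF]; dsimp only
    rw [show ∀ y : ℝ, 1 - c * y - 1 = -(c * y) by intro y; ring, abs_neg, abs_mul, abs_of_pos hc]
    exact (mul_le_mul_of_nonneg_left this hc.le).trans hε2
  have hFb : ∀ h s, ‖F h s‖ ≤ 2 := fun h s => by
    have := abs_le.1 (hF1 h s)
    rw [Real.norm_eq_abs, abs_le]; constructor <;> linarith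
  set Φ : BoundedContinuousFunction ℝ ℝ → BoundedContinuousFunction ℝ ℝ := fun h =>
    BoundedContinuousFunction.ofNormedAddCommGroup (F h) (hFc h) 2 (hFb h) with hΦ
  have hcontr : ContractingWith (1 / 2) Φ := by
    refine ⟨by rw [← NNReal.coe_lt_coe]; norm_num, LipschitzWith.of_dist_le_mul fun h k => ?_⟩
    refine (BoundedContinuousFunction.dist_le (by positivity)).2 fun s => ?_
    change dist (F h s) (F k s) ≤ _
    have hint : ∀ h : BoundedContinuousFunction ℝ ℝ, IntervalIntegrable
        (segmentMean fun r => clampPow p (h r)) MeasureTheory.volume 0 (P s) := fun h =>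
      (continuous_segmentMean (hψ h)).intervalIntegrable _ _
    have e : F h s - F k s = -(c * ∫ σ in (0 : ℝ)..P s,
        segmentMean (fun r => clampPow p (h r) - clampPow p (k r)) σ) := by
      rw [hF]; dsimp only
      rw [← intervalIntegral.integral_congr fun σ _ => segmentMean_sub (hψ h) (hψ k) σ,
        intervalIntegral.integral_sub (hint h) (hint k)]
      ring
    rw [Real.dist_eq, e, abs_neg, abs_mul, abs_of_pos hc]
    have := hbound (fun r => clampPow p (h r) - clampPow p (k r)) (L * dist h k) (by positivity)
      (fun r => (abs_clampPow_sub_le hp _ _).trans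
        (mul_le_mul_of_nonneg_left (by
          rw [← Real.dist_eq]; exact BoundedContinuousFunction.dist_coe_le_dist r) hL0.le)) s
    have h2 := mul_le_mul_of_nonneg_left this hc.le
    have h3 := mul_le_mul_of_nonneg_right hεL (dist_nonneg (x := h) (y := k))
    push_cast
    linarith
  obtain ⟨h, hh⟩ : ∃ h, Φ h = h := ⟨_, hcontr.fixedPoint_isFixedPt⟩
  have hfix : ∀ s, h s = F h s := fun s => by
    conv_lhs => rw [← hh]
    rfl
  have hPid : ∀ s, |s| < ε → P s = s := fun s hs => by
    rw [hP]; dsimp only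
    rw [min_eq_left (abs_lt.1 hs).2.le, max_eq_right (abs_lt.1 hs).1.le]
  refine ⟨ε, hε0, h, h.continuous, ?_, fun s => ?_, fun s hs => ?_⟩
  · rw [hfix, hF]; dsimp only; rw [hPid 0 (by simpa using hε0)]; simp
  · rw [hfix]; exact hF1 h s
  · rw [hfix, hF]; dsimp only; rw [hPid s hs]

/-- The regular radial profile near the origin, in the variable `σ = r ^ 2`. -/
theorem exists_local_profile {lam Lam p : ℝ} (hl : 0 < lam) (hL : lam < Lam) (hp : 1 ≤ p) :
    ∃ δ > 0, ∃ U W W₁ : ℝ → ℝ, ContinuousOn W₁ (Ioo (-δ) δ) ∧ ∀ s ∈ Ioo (-δ) δ,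
      HasDerivAt U (-W s / 2) s ∧ HasDerivAt W (W₁ s) s ∧ 0 < U s ∧ U s < 2 ∧ 0 ≤ W s ∧
      W s ≤ 2 ^ p / Lam ∧
      s * W₁ s = -W s + min (U s ^ p / Lam) (U s ^ p / lam - (Lam / lam - 1) * W s) / 2 := by
  have hLp := hl.trans hL
  have hN : 0 < Lam / lam - 1 := by
    have : 1 < Lam / lam := by rwa [lt_div_iff₀ hl, one_mul]
    linarith
  -- Near the origin the first branch holds, so `(s W)' = U^p / (2 Lam)` and `U' = -W/2`; hence the
  -- constant `1 / (4 Lam)`.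
  obtain ⟨ε, hε, h, hc, h0, hb, hint⟩ := exists_integral_solution (c := 1 / (4 * Lam)) hp
    (by positivity)
  set g : ℝ → ℝ := fun r => clampPow p (h r) with hg
  have hgc : Continuous g := (continuous_clampPow (by linarith)).comp hc
  set A := segmentMean g with hA
  have hAc : Continuous A := continuous_segmentMean hgc
  have hbd : ∀ s, 1 / 2 ≤ h s ∧ h s ≤ 3 / 2 := fun s => by
    have := abs_le.1 (hb s)
    constructor <;> linarith
  have hgp : ∀ s, g s = h s ^ p := fun s =>
    clampPow_of_mem (by linarith [(hbd s).1]) (by linarith [(hbd s).2])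
  have hopen : ∀ s, |s| < ε → ∀ᶠ r in 𝓝 s, |r| < ε := fun s hs =>
    (isOpen_lt continuous_abs continuous_const).mem_nhds hs
  have hU : ∀ s, |s| < ε → HasDerivAt h (-(1 / (4 * Lam)) * A s) s := by
    intro s hs
    have h1 : HasDerivAt (fun s => ∫ σ in (0 : ℝ)..s, A σ) (A s) s :=
      intervalIntegral.integral_hasDerivAt_right (hAc.intervalIntegrable _ _)
        hAc.stronglyMeasurable.stronglyMeasurableAtFilter hAc.continuousAt
    have h2 := (h1.const_mul (1 / (4 * Lam))).const_sub 1
    refine (h2.congr_of_eventuallyEq ?_).congr_deriv (by ring)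
    filter_upwards [hopen s hs] with r hr using hint r hr
  set g' : ℝ → ℝ := fun s => -(1 / (4 * Lam)) * A s * p * h s ^ (p - 1) with hg'
  have hg'c : Continuous g' := by
    have : Continuous fun s => h s ^ (p - 1) :=
      hc.rpow_const fun s => Or.inl (by linarith [(hbd s).1])
    fun_prop
  have hgd : ∀ s, |s| < ε → HasDerivAt g (g' s) s := by
    intro s hs
    have : g = fun s => h s ^ p := funext hgp
    rw [this]
    exact (hU s hs).rpow_const (Or.inr hp)
  set A₁ : ℝ → ℝ := fun s => ∫ τ in (0 : ℝ)..1, τ * g' (s * τ) with hA₁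
  have hAd : ∀ s, |s| < ε → HasDerivAt A (A₁ s) s := fun s hs =>
    hasDerivAt_segmentMean hgc hg'c hgd hs
  have hA₁c : Continuous A₁ :=
    intervalIntegral.continuous_parametric_intervalIntegral_of_continuous' (by fun_prop) 0 1
  have hrel : ∀ s, |s| < ε → A s + s * A₁ s = g s := by
    intro s hs
    have h1 : HasDerivAt (fun s => s * A s) (1 * A s + s * A₁ s) s :=
      (hasDerivAt_id s).mul (hAd s hs)
    have h2 : HasDerivAt (fun s => s * A s) (g s) s := by
      have : (fun s => s * A s) = fun s => ∫ r in (0 : ℝ)..s, g r :=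
        funext fun s => mul_segmentMean g s
      rw [this]
      exact intervalIntegral.integral_hasDerivAt_right (hgc.intervalIntegrable _ _)
        hgc.stronglyMeasurable.stronglyMeasurableAtFilter hgc.continuousAt
    rw [← h1.unique h2, one_mul]
  have hA0 : A 0 = 1 := by
    have := hrel 0 (by simpa using hε)
    rw [hgp, h0] at this
    simpa using this
  -- At the origin the mean `A` equals `g`. The bound `A < 2 g` says `W ≤ U^p / Lam`, which is the
  -- condition for the first branch.
  have hnear : ∀ᶠ s in 𝓝 (0 : ℝ), A s < 2 * g s ∧ 0 < A s ∧ |s| < ε := by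
    refine (hAc.continuousAt.eventually_lt (continuousAt_const.mul hgc.continuousAt) ?_).and
      ((hAc.continuousAt.eventually (lt_mem_nhds (by rw [hA0]; norm_num))).and
        (hopen 0 (by simpa using hε)))
    rw [hA0]
    change 1 < 2 * g 0
    rw [hgp, h0]; norm_num
  obtain ⟨δ, hδ, hnear⟩ := Metric.eventually_nhds_iff.1 hnear
  refine ⟨δ, hδ, h, fun s => A s / (2 * Lam), fun s => A₁ s / (2 * Lam),
    (hA₁c.div_const _).continuousOn, fun s hs => ?_⟩
  obtain ⟨n1, n2, n3⟩ := hnear (y := s) (by rw [Real.dist_eq, sub_zero, abs_lt]; exact hs)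
  have hle := (clampPow_le (by linarith : 0 ≤ p) (h s) : g s ≤ 2 ^ p)
  refine ⟨(hU s n3).congr_deriv (by field_simp; norm_num), (hAd s n3).div_const _,
    by linarith [(hbd s).1], by linarith [(hbd s).2], by positivity, ?_, ?_⟩
  · rw [div_le_div_iff₀ (by positivity) hLp]; nlinarith
  · rw [← hgp, min_eq_left]
    · rw [← hrel s n3]; field_simp; ring
    · have e : g s / lam = (Lam / lam - 1) * (g s / Lam) + g s / Lam := by field_simp; ring
      have : A s / (2 * Lam) ≤ g s / Lam := by
        rw [div_le_div_iff₀ (by positivity) hLp]; nlinarith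
      rw [e]
      have := mul_le_mul_of_nonneg_left this hN.le
      linarith

end PucciLaneEmden
end

/-! ### Continuation of the profile and its first zero when `(p - 1) N = 1`. -/

noncomputable section
namespace PucciLaneEmden
open Filter Topology Set

/-- Lower bound for the logarithmic derivative of the quotient of the unknowns. -/
theorem quotient_growth {lam Lam N r a w P : ℝ} (hl : 0 < lam) (hL : lam < Lam) (hr : 0 < r)
    (ha : 0 < a) (hP0 : 0 < P) (hP : Lam * (2 + N ^ 2 / 4) * a ≤ r * P) :
    2 * a ^ 2 ≤ a * (r * min (P / Lam) (P / lam - N * w)) + (r * w) ^ 2 := by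
  have hLp := hl.trans hL
  have hP' : (2 + N ^ 2 / 4) * a ≤ r * (P / Lam) := by
    rw [← mul_div_assoc, le_div_iff₀ hLp]; linarith
  have hPle : P / Lam ≤ P / lam := div_le_div_of_nonneg_left hP0.le hl hL.le
  rcases min_choice (P / Lam) (P / lam - N * w) with h | h
  · rw [h]
    have := mul_le_mul_of_nonneg_left hP' ha.le
    nlinarith [sq_nonneg (r * w), sq_nonneg (N * a)]
  · rw [h]
    have h1 : r * (P / Lam) ≤ r * (P / lam) := mul_le_mul_of_nonneg_left hPle hr.le
    have := mul_le_mul_of_nonneg_left (hP'.trans h1) ha.le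
    nlinarith [sq_nonneg (r * w - N * a / 2)]

/-- Positive radial profiles with `(p - 1) * N = 1` are not global. -/
theorem false_of_global_profile {lam Lam p σ₀ : ℝ} {U W : ℝ → ℝ} (hl : 0 < lam) (hL : lam < Lam)
    (hp : (p - 1) * (Lam / lam - 1) = 1) (hσ : 0 < σ₀) (hcon : ∀ s ≥ σ₀, 0 < U s)
    (hWnn : ∀ s ≥ σ₀, 0 ≤ W s) (hUd' : ∀ s ≥ σ₀, HasDerivAt U (-W s / 2) s)
    (hdec : ∀ s ≥ σ₀, HasDerivAt W
      ((-W s + min (U s ^ p / Lam) (U s ^ p / lam - (Lam / lam - 1) * W s) / 2) / s) s) : False := by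
  have hLp := hl.trans hL
  have hN : 0 < Lam / lam - 1 := by
    have : 1 < Lam / lam := by rwa [lt_div_iff₀ hl, one_mul]
    linarith
  set N := Lam / lam - 1 with hNd
  have hp1 : 1 < p := by
    have : 0 < p - 1 := by
      by_contra h
      have := mul_nonpos_of_nonpos_of_nonneg (not_lt.1 h) hN.le
      linarith
    linarith
  -- Its sign compares `x = s W / U` with `N`, and it is nondecreasing. Once positive, it forces `U`
  -- to zero logarithmically, so everything rests on showing that it becomes positive.
  set D : ℝ → ℝ := fun s => s * W s - N * U s with hD
  have hDd : ∀ s ≥ σ₀, HasDerivAt D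
      ((min (U s ^ p / Lam) (U s ^ p / lam - N * W s) + N * W s) / 2) s := by
    intro s hs
    have hs0 : s ≠ 0 := (hσ.trans_le hs).ne'
    refine (((hasDerivAt_id s).mul (hdec s hs)).sub ((hUd' s hs).const_mul N)).congr_deriv ?_
    simp only [id]
    field_simp
    ring
  have hDmono : ∀ s ≥ σ₀, ∀ t ≥ s, D s ≤ D t := by
    intro s hs t hst
    have := mul_sub_le_of_le_deriv (r := 0) hst (fun r hr => hDd r (hs.le.trans hr.1))
      (fun r hr => by
        have h1 := hWnn r (hs.le.trans hr.1)
        have h2 := hcon r (hs.le.trans hr.1)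
        have h3 : -(N * W r) ≤ min (U r ^ p / Lam) (U r ^ p / lam - N * W r) := by
          have : 0 ≤ U r ^ p / Lam := by positivity
          have : 0 ≤ U r ^ p / lam := by positivity
          have : 0 ≤ N * W r := by positivity
          exact le_min (by linarith) (by linarith)
        linarith)
    linarith
  obtain ⟨s₁, hs1, hDs1⟩ : ∃ s ≥ σ₀, 0 < D s := by
    by_contra hDn
    push Not at hDn
    have hDn' : ∀ s ≥ σ₀, s * W s ≤ N * U s := fun s hs => by linarith [hDn s hs]
    -- If `x ≤ N` throughout, then `(p - 1) N = 1` makes `U^(p-1) s^(1/2)` nondecreasing, so `s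
    -- U^(p-1)` tends to infinity. Then `quotient_growth` gives `x' ≥ 1/s`, and `x` exceeds `N`
    -- after all.
    set ℓ : ℝ → ℝ := fun s => (p - 1) * Real.log (U s) + Real.log s / 2 with hℓ
    have hℓm : ∀ s ≥ σ₀, ℓ σ₀ ≤ ℓ s := by
      intro s hs
      have := mul_sub_le_of_le_deriv (φ := ℓ) (r := 0) hs (fun r hr => by
        have hr0 := hσ.trans_le hr.1
        exact (((hUd' r hr.1).log (hcon r hr.1).ne').const_mul (p - 1)).add
          ((Real.hasDerivAt_log hr0.ne').div_const 2)) (fun r hr => by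
        have hr0 := hσ.trans_le hr.1
        have hu := hcon r hr.1
        have h1 : (p - 1) * (r * W r) ≤ U r := by
          have := mul_le_mul_of_nonneg_left (hDn' r hr.1) (by linarith : 0 ≤ p - 1)
          rw [← mul_assoc (p - 1) N, hp, one_mul] at this
          exact this
        have e : (p - 1) * (-W r / 2 / U r) + r⁻¹ / 2 =
            (U r - (p - 1) * (r * W r)) / (2 * r * U r) := by
          field_simp; ring
        rw [e]
        exact div_nonneg (by linarith) (by positivity))
      linarith
    have hq : ∀ s ≥ σ₀, Real.exp (ℓ σ₀ + Real.log s / 2) * U s ≤ s * U s ^ p := by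
      intro s hs
      have hu := hcon s hs
      have hs0 := hσ.trans_le hs
      have h1 : s * U s ^ p = Real.exp (ℓ s + Real.log s / 2) * U s := by
        rw [hℓ]; dsimp only
        rw [Real.rpow_def_of_pos hu,
          show s * Real.exp (Real.log (U s) * p) = Real.exp (Real.log s + Real.log (U s) * p) by
            rw [Real.exp_add, Real.exp_log hs0],
          show ∀ y, Real.exp y * U s = Real.exp (y + Real.log (U s)) by
            intro y; rw [Real.exp_add, Real.exp_log hu]]
        congr 1; ring
      rw [h1]
      exact mul_le_mul_of_nonneg_right (Real.exp_le_exp.2 (by linarith [hℓm s hs])) hu.le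
    have htend : Tendsto (fun s => Real.exp (ℓ σ₀ + Real.log s / 2)) atTop atTop :=
      Real.tendsto_exp_atTop.comp (tendsto_atTop_add_const_left _ _
        (Real.tendsto_log_atTop.atTop_div_const two_pos))
    obtain ⟨T, hT⟩ := eventually_atTop.1 (htend.eventually_ge_atTop (Lam * (2 + N ^ 2 / 4)))
    set T₁ := max T σ₀ with hT₁
    have hT1 : σ₀ ≤ T₁ := le_max_right _ _
    have hT0 : 0 < T₁ := hσ.trans_le hT1
    set T₂ := T₁ * Real.exp (N + 1) with hT₂
    have hT12 : T₁ ≤ T₂ := le_mul_of_one_le_right hT0.le (Real.one_le_exp (by linarith))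
    have hfin := mul_sub_le_of_le_deriv (φ := fun s => s * W s / U s - Real.log s) (r := 0) hT12
      (fun r hr => by
        have hr1 := hT1.trans hr.1
        exact (((hasDerivAt_id r).mul (hdec r hr1)).div (hUd' r hr1) (hcon r hr1).ne').sub
          (Real.hasDerivAt_log (hσ.trans_le hr1).ne')) (fun r hr => by
        have hr1 := hT1.trans hr.1
        have hr0 := hσ.trans_le hr1
        have hu := hcon r hr1
        have hlow := hT r ((le_max_left _ _).trans hr.1)
        have hqr := hq r hr1
        simp only [id, Pi.mul_apply]
        have hkey := quotient_growth (w := W r) hl hL hr0 hu (Real.rpow_pos_of_pos hu p)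
          ((mul_le_mul_of_nonneg_right hlow hu.le).trans hqr)
        have e : ∀ a w M : ℝ, 0 < a →
            ((1 * w + r * ((-w + M / 2) / r)) * a - r * w * (-w / 2)) / a ^ 2 - r⁻¹ =
            (a * (r * M) + (r * w) ^ 2 - 2 * a ^ 2) / (2 * r * a ^ 2) := by
          intro a w M ha
          field_simp
          ring
        rw [e _ _ _ hu]
        exact div_nonneg (by linarith) (by positivity))
    have hlog : Real.log T₂ = Real.log T₁ + (N + 1) := by
      rw [hT₂, Real.log_mul hT0.ne' (Real.exp_ne_zero _), Real.log_exp]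
    have h1 : 0 ≤ T₁ * W T₁ / U T₁ := div_nonneg (mul_nonneg hT0.le (hWnn _ hT1)) (hcon _ hT1).le
    have h2 : T₂ * W T₂ / U T₂ ≤ N := by
      rw [div_le_iff₀ (hcon _ (hT1.trans hT12))]; exact hDn' _ (hT1.trans hT12)
    linarith
  have hs10 := hσ.trans_le hs1
  -- The point where the bound `U ≤ U s₁ - (D s₁ / 2) log (s / s₁)` reaches zero.
  set T₂ := s₁ * Real.exp (2 * U s₁ / D s₁) with hT₂
  have hT12 : s₁ ≤ T₂ := le_mul_of_one_le_right hs10.le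
    (Real.one_le_exp (div_nonneg (by linarith [hcon s₁ hs1]) hDs1.le))
  have hfin := sub_le_mul_of_deriv_le (φ := fun s => U s + D s₁ / 2 * Real.log s) (r := 0) hT12
    (fun r hr => (hUd' r (hs1.le.trans hr.1)).add
      ((Real.hasDerivAt_log (hs10.trans_le hr.1).ne').const_mul (D s₁ / 2))) (fun r hr => by
      have hr0 := hs10.trans_le hr.1
      have h1 := hDmono s₁ hs1 r hr.1
      have h2 : D s₁ ≤ r * W r := by
        have h3 : 0 < N * U r := mul_pos hN (hcon r (hs1.le.trans hr.1))
        have h4 : D r = r * W r - N * U r := rfl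
        linarith
      have e : -W r / 2 + D s₁ / 2 * r⁻¹ = (D s₁ - r * W r) / (2 * r) := by field_simp; ring
      rw [e]
      exact div_nonpos_of_nonpos_of_nonneg (by linarith) (by positivity))
  have hlog : Real.log T₂ = Real.log s₁ + 2 * U s₁ / D s₁ := by
    rw [hT₂, Real.log_mul hs10.ne' (Real.exp_ne_zero _), Real.log_exp]
  rw [hlog] at hfin
  have e : D s₁ / 2 * (Real.log s₁ + 2 * U s₁ / D s₁) = D s₁ / 2 * Real.log s₁ + U s₁ := by
    field_simp
  rw [e] at hfin
  linarith [hcon T₂ (hs1.le.trans hT12)]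

/-- The radial equation in the variable `σ = r ^ 2`, from a positive radius up to the first zero. -/
theorem exists_profile_continuation {lam Lam p σ₀ a₀ b₀ : ℝ} (hl : 0 < lam) (hL : lam < Lam)
    (hp : (p - 1) * (Lam / lam - 1) = 1) (hσ : 0 < σ₀) (ha0 : 0 < a₀) (ha2 : a₀ < 2) (hb0 : 0 ≤ b₀)
    (hb1 : b₀ ≤ 2 ^ p / Lam) : ∃ U W : ℝ → ℝ, ∃ σ₁ > σ₀, U σ₀ = a₀ ∧ W σ₀ = b₀ ∧ U σ₁ = 0 ∧
      (∀ s ∈ Ico σ₀ σ₁, 0 < U s) ∧ ∀ s ∈ Icc σ₀ σ₁, 0 ≤ W s ∧ HasDerivAt U (-W s / 2) s ∧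
      HasDerivAt W
        ((-W s + min (U s ^ p / Lam) (U s ^ p / lam - (Lam / lam - 1) * W s) / 2) / s) s := by
  have hLp := hl.trans hL
  have hN : 0 < Lam / lam - 1 := by
    have : 1 < Lam / lam := by rwa [lt_div_iff₀ hl, one_mul]
    linarith
  set N := Lam / lam - 1 with hNd
  have hp1 : 1 < p := by
    have : 0 < p - 1 := by
      by_contra h
      have := mul_nonpos_of_nonpos_of_nonneg (not_lt.1 h) hN.le
      linarith
    linarith
  set B : ℝ := 2 ^ p / Lam with hB
  have h2p : (0 : ℝ) < 2 ^ p := by positivity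
  have hB0 : 0 < B := by positivity
  -- Truncating `W` to `[0, B]`, and replacing `1 / s` by `1 / max σ₀ s`, makes the field bounded
  -- and Lipschitz. Nothing is lost for `s ≥ σ₀`: the field points inwards at both ends of `[0, B]`,
  -- and `U` stays below `2` because it is nonincreasing.
  set β : ℝ → ℝ := fun b => max 0 (min b B) with hβ
  have hβm : ∀ b, 0 ≤ β b ∧ β b ≤ B := fun b =>
    ⟨le_max_left _ _, max_le hB0.le (min_le_right _ _)⟩
  have hβid : ∀ b, 0 ≤ b → b ≤ B → β b = b := fun b h0 h1 => by
    rw [hβ]; dsimp only; rw [min_eq_left h1, max_eq_right h0]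
  have hβl : ∀ b c, |β b - β c| ≤ |b - c| := by
    intro b c
    have h1 := abs_max_sub_max_le_max 0 (min b B) 0 (min c B)
    have h2 := abs_min_sub_min_le_max b B c B
    simp only [sub_self, abs_zero] at h1 h2
    rw [max_eq_right (abs_nonneg (min b B - min c B))] at h1
    rw [max_eq_left (abs_nonneg (b - c))] at h2
    exact h1.trans h2
  set m : ℝ × ℝ → ℝ := fun q => min (clampPow p q.1 / Lam) (clampPow p q.1 / lam - N * β q.2) with hm
  set v : ℝ → ℝ × ℝ → ℝ × ℝ := fun s q => (-β q.2 / 2, (-β q.2 + m q / 2) / max σ₀ s) with hv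
  have hmax : ∀ s, 0 < max σ₀ s := fun s => hσ.trans_le (le_max_left _ _)
  have hdivle : ∀ s y, |y / max σ₀ s| ≤ |y| / σ₀ := fun s y => by
    rw [abs_div, abs_of_pos (hmax s)]
    exact div_le_div_of_nonneg_left (abs_nonneg _) hσ (le_max_left _ _)
  set L : ℝ := p * 2 ^ (p - 1) with hLd
  have hL0 : 0 < L := by positivity
  set K : ℝ := 1 + (1 + (L / Lam + (L / lam + N))) / σ₀ with hK
  have hK0 : 0 ≤ K := by positivity
  have hlip : ∀ s, LipschitzWith K.toNNReal (v s) := by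
    refine fun s => LipschitzWith.of_dist_le_mul fun q r => ?_
    rw [Real.coe_toNNReal _ hK0]
    have hq1 : |q.1 - r.1| ≤ dist q r := by
      rw [Prod.dist_eq, ← Real.dist_eq]; exact le_max_left _ _
    have hq2 : |q.2 - r.2| ≤ dist q r := by
      rw [Prod.dist_eq, ← Real.dist_eq]; exact le_max_right _ _
    have hD : 0 ≤ dist q r := dist_nonneg
    have h1 := (hβl q.2 r.2).trans hq2
    have h2 : |clampPow p q.1 - clampPow p r.1| ≤ L * dist q r :=
      (abs_clampPow_sub_le hp1.le _ _).trans (mul_le_mul_of_nonneg_left hq1 hL0.le)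
    have h3 : |m q - m r| ≤ L / Lam * dist q r + (L / lam * dist q r + N * dist q r) := by
      refine (abs_min_sub_min_le_max _ _ _ _).trans (max_le ?_ ?_)
      · rw [← sub_div, abs_div, abs_of_pos hLp]
        have : |clampPow p q.1 - clampPow p r.1| / Lam ≤ L * dist q r / Lam :=
          div_le_div_of_nonneg_right h2 hLp.le
        rw [mul_div_right_comm] at this
        have : 0 ≤ L / lam * dist q r + N * dist q r := by positivity
        linarith
      · rw [show clampPow p q.1 / lam - N * β q.2 - (clampPow p r.1 / lam - N * β r.2) =
          (clampPow p q.1 - clampPow p r.1) / lam - N * (β q.2 - β r.2) by ring]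
        refine (abs_sub _ _).trans ?_
        rw [abs_div, abs_of_pos hl, abs_mul, abs_of_pos hN]
        have h4 : |clampPow p q.1 - clampPow p r.1| / lam ≤ L * dist q r / lam :=
          div_le_div_of_nonneg_right h2 hl.le
        rw [mul_div_right_comm] at h4
        have h5 := mul_le_mul_of_nonneg_left h1 hN.le
        have : 0 ≤ L / Lam * dist q r := by positivity
        linarith
    have hT : 0 ≤ L / Lam * dist q r + (L / lam * dist q r + N * dist q r) := by positivity
    rw [Prod.dist_eq]
    apply max_le
    · simp only [hv]
      rw [Real.dist_eq, show -β q.2 / 2 - -β r.2 / 2 = -(β q.2 - β r.2) / 2 by ring, abs_div, abs_neg]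
      rw [abs_of_pos (two_pos : (0 : ℝ) < 2)]
      have : 0 ≤ (1 + (L / Lam + (L / lam + N))) / σ₀ * dist q r := by positivity
      rw [hK]; nlinarith
    · simp only [hv]
      rw [Real.dist_eq, ← sub_div]
      refine (hdivle _ _).trans ?_
      have h4 : |-β q.2 + m q / 2 - (-β r.2 + m r / 2)| ≤
          (1 + (L / Lam + (L / lam + N))) * dist q r := by
        rw [show -β q.2 + m q / 2 - (-β r.2 + m r / 2) = (m q - m r) / 2 - (β q.2 - β r.2) by ring]
        refine (abs_sub _ _).trans ?_
        rw [abs_div, abs_of_pos (two_pos : (0 : ℝ) < 2)]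
        linarith
      have h5 := div_le_div_of_nonneg_right h4 hσ.le
      rw [mul_div_right_comm] at h5
      rw [hK]; nlinarith
  have hbound : ∀ s q, ‖v s q‖ ≤ B + (B + (2 ^ p / Lam + (2 ^ p / lam + N * B))) / σ₀ := by
    intro s q
    have hpos : 0 ≤ (B + (2 ^ p / Lam + (2 ^ p / lam + N * B))) / σ₀ := by positivity
    have h1 := hβm q.2
    have hc0 := clampPow_nonneg p q.1
    have hc1 := clampPow_le (by linarith : 0 ≤ p) q.1
    rw [Prod.norm_def]
    apply max_le
    · simp only [hv]
      rw [Real.norm_eq_abs, abs_le]; constructor <;> linarith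
    · simp only [hv]
      rw [Real.norm_eq_abs]
      refine (hdivle _ _).trans ?_
      have h2 : |-β q.2 + m q / 2| ≤ B + (2 ^ p / Lam + (2 ^ p / lam + N * B)) := by
        have e1 : m q ≤ 2 ^ p / Lam :=
          (min_le_left _ _).trans (div_le_div_of_nonneg_right hc1 hLp.le)
        have e2 : -(N * B) ≤ m q := by
          have : 0 ≤ clampPow p q.1 / Lam := by positivity
          have : 0 ≤ clampPow p q.1 / lam := by positivity
          have := mul_le_mul_of_nonneg_left h1.2 hN.le
          have : 0 ≤ N * B := by positivity
          exact le_min (by linarith) (by linarith)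
        have : 0 ≤ (2 : ℝ) ^ p / Lam := by positivity
        have : 0 ≤ (2 : ℝ) ^ p / lam := by positivity
        have : 0 ≤ N * B := by positivity
        rw [abs_le]; constructor <;> linarith
      have := div_le_div_of_nonneg_right h2 hσ.le
      linarith
  have hcont : ∀ q, Continuous fun s => v s q := fun q => by
    refine continuous_const.prodMk (continuous_const.div (by fun_prop) fun s => (hmax s).ne')
  obtain ⟨γ, hγ0, hγ⟩ := exists_global_solution hlip hcont hbound σ₀ (a₀, b₀)
  set U : ℝ → ℝ := fun s => (γ s).1 with hU
  set W : ℝ → ℝ := fun s => (γ s).2 with hW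
  have hUd : ∀ s, HasDerivAt U (-β (W s) / 2) s := fun s => (hγ s).fst
  have hWd : ∀ s, HasDerivAt W ((-β (W s) + m (U s, W s) / 2) / max σ₀ s) s := fun s => (hγ s).snd
  have hUc : Continuous U := continuous_iff_continuousAt.2 fun t => (hUd t).continuousAt
  have hWc : Continuous W := continuous_iff_continuousAt.2 fun t => (hWd t).continuousAt
  have hU0 : U σ₀ = a₀ := by simp [hU, hγ0]
  have hW0 : W σ₀ = b₀ := by simp [hW, hγ0]
  have hU2 : ∀ s ≥ σ₀, U s < 2 := fun s hs => by
    have := sub_le_mul_of_deriv_le (r := 0) hs (fun r _ => hUd r)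
      (fun r _ => by linarith [(hβm (W r)).1])
    linarith
  have hWnn : ∀ s ≥ σ₀, 0 ≤ W s := by
    intro s hs
    by_contra hlt
    obtain ⟨c, hc, hc0, hcp⟩ := exists_last_zero (φ := fun r => -W r) hWc.neg.continuousOn hs
      (by linarith) (by linarith)
    have := mul_sub_le_of_le_deriv (r := 0) hc.2.le (fun r _ => hWd r) (fun r hr => by
      have hWr : W r ≤ 0 := by
        rcases eq_or_lt_of_le hr.1 with h | h
        · rw [← h]; linarith
        · linarith [hcp r ⟨h, hr.2⟩]
      have hβ0 : β (W r) = 0 := by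
        rw [hβ]; dsimp only; exact max_eq_left ((min_le_left _ _).trans hWr)
      have hc0 := clampPow_nonneg p (U r)
      have : 0 ≤ m (U r, W r) := by
        rw [hm]; dsimp only; rw [hβ0]
        exact le_min (by positivity) (by rw [mul_zero, sub_zero]; positivity)
      rw [hβ0]
      exact div_nonneg (by linarith) (hmax r).le)
    linarith
  have hWB : ∀ s ≥ σ₀, W s ≤ B := by
    intro s hs
    by_contra hlt
    obtain ⟨c, hc, hc0, hcp⟩ := exists_last_zero (φ := fun r => W r - B)
      (hWc.sub continuous_const).continuousOn hs (by linarith) (by linarith)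
    have := sub_le_mul_of_deriv_le (r := 0) hc.2.le (fun r _ => hWd r) (fun r hr => by
      have hWr : B ≤ W r := by
        rcases eq_or_lt_of_le hr.1 with h | h
        · rw [← h]; linarith
        · linarith [hcp r ⟨h, hr.2⟩]
      have hβ1 : β (W r) = B := by
        rw [hβ]; dsimp only; rw [min_eq_right hWr, max_eq_right hB0.le]
      have : m (U r, W r) ≤ B := (min_le_left _ _).trans
        (div_le_div_of_nonneg_right (clampPow_le (by linarith) _) hLp.le)
      rw [hβ1]
      exact div_nonpos_of_nonpos_of_nonneg (by linarith) (hmax r).le)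
    linarith
  have hUd' : ∀ s ≥ σ₀, HasDerivAt U (-W s / 2) s := fun s hs => by
    have := hUd s
    rwa [hβid _ (hWnn s hs) (hWB s hs)] at this
  have hWd' : ∀ s ≥ σ₀, 0 ≤ U s → HasDerivAt W
      ((-W s + min (U s ^ p / Lam) (U s ^ p / lam - N * W s) / 2) / s) s := fun s hs hu => by
    have := hWd s
    simp only [hm] at this
    rwa [hβid _ (hWnn s hs) (hWB s hs), clampPow_of_mem hu (hU2 s hs).le, max_eq_right hs] at this
  obtain ⟨s', hs', hUs'⟩ : ∃ s ≥ σ₀, U s ≤ 0 := by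
    by_contra hcon
    push Not at hcon
    exact false_of_global_profile hl hL hp hσ hcon hWnn hUd' fun s hs => hWd' s hs (hcon s hs).le
  obtain ⟨σ₁, h1, h10, h1p⟩ := exists_first_zero hUc.continuousOn hs' (by rw [hU0]; exact ha0) hUs'
  refine ⟨U, W, σ₁, h1.1, hU0, hW0, h10, h1p, fun s hs => ⟨hWnn s hs.1, hUd' s hs.1,
    hWd' s hs.1 ?_⟩⟩
  rcases eq_or_lt_of_le hs.2 with h | h
  · rw [h, h10]
  · exact (h1p s ⟨hs.1, h⟩).le

end PucciLaneEmden
end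

/-! ### Gluing, scaling, and a solution in every ball. -/

noncomputable section
namespace PucciLaneEmden
open Filter Topology Set

theorem hasDerivAt_ite_le {f g : ℝ → ℝ} {a s d : ℝ} (hf : s ≤ a → HasDerivAt f d s)
    (hg : a ≤ s → HasDerivAt g d s) (hfg : f a = g a) :
    HasDerivAt (fun t => if t ≤ a then f t else g t) d s := by
  rcases lt_trichotomy s a with h | h | h
  · refine (hf h.le).congr_of_eventuallyEq ?_
    filter_upwards [gt_mem_nhds h] with t ht
    rw [if_pos (le_of_lt ht)]
  · subst h
    have h1 : HasDerivWithinAt (fun t => if t ≤ s then f t else g t) d (Iic s) s :=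
      (hf le_rfl).hasDerivWithinAt.congr (fun t ht => if_pos (mem_Iic.1 ht)) (if_pos le_rfl)
    have h2 : HasDerivWithinAt (fun t => if t ≤ s then f t else g t) d (Ici s) s := by
      refine (hg le_rfl).hasDerivWithinAt.congr (fun t ht => ?_) ((if_pos le_rfl).trans hfg)
      rcases eq_or_lt_of_le (mem_Ici.1 ht) with h | h
      · rw [← h, if_pos le_rfl, hfg]
      · rw [if_neg (not_le.2 h)]
    have := h1.union h2
    rwa [Iic_union_Ici, hasDerivWithinAt_univ] at this
  · refine (hg h.le).congr_of_eventuallyEq ?_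
    filter_upwards [lt_mem_nhds h] with t ht
    rw [if_neg (not_le.2 ht)]

theorem contDiffOn_two_of_hasDerivAt {H H₁ H₂ : ℝ → ℝ} {O : Set ℝ} (hO : IsOpen O)
    (h1 : ∀ s ∈ O, HasDerivAt H (H₁ s) s) (h2 : ∀ s ∈ O, HasDerivAt H₁ (H₂ s) s)
    (hc : ContinuousOn H₂ O) : ContDiffOn ℝ 2 H O := by
  have d1 : ContDiffOn ℝ 1 H₁ O := by
    rw [show (1 : WithTop ℕ∞) = 0 + 1 by norm_num, contDiffOn_succ_iff_deriv_of_isOpen hO]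
    refine ⟨fun s hs => (h2 s hs).differentiableAt.differentiableWithinAt, by simp, ?_⟩
    exact contDiffOn_zero.2 (hc.congr fun s hs => (h2 s hs).deriv)
  rw [show (2 : WithTop ℕ∞) = 1 + 1 by norm_num, contDiffOn_succ_iff_deriv_of_isOpen hO]
  exact ⟨fun s hs => (h1 s hs).differentiableAt.differentiableWithinAt, by simp,
    d1.congr fun s hs => (h1 s hs).deriv⟩

/-- A positive radial solution, in the variable `σ = r ^ 2`, up to its first zero. -/
theorem exists_radial_profile {lam Lam p : ℝ} (hl : 0 < lam) (hL : lam < Lam)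
    (hp : (p - 1) * (Lam / lam - 1) = 1) : ∃ δ > 0, ∃ σ > 0, ∃ U W W₁ : ℝ → ℝ,
      (∀ s ∈ Ioo (-δ) σ, HasDerivAt U (-W s / 2) s ∧ HasDerivAt W (W₁ s) s ∧ 0 < U s ∧ 0 ≤ W s ∧
        s * W₁ s = -W s + min (U s ^ p / Lam) (U s ^ p / lam - (Lam / lam - 1) * W s) / 2) ∧
      ContinuousOn W₁ (Ioo (-δ) σ) ∧ ContinuousAt U σ ∧ U σ = 0 := by
  have hN : 0 < Lam / lam - 1 := by
    have : 1 < Lam / lam := by rwa [lt_div_iff₀ hl, one_mul]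
    linarith
  have hp1 : 1 ≤ p := by
    by_contra h
    have := mul_nonpos_of_nonpos_of_nonneg (by linarith : p - 1 ≤ 0) hN.le
    linarith
  obtain ⟨δ, hδ, U₀, W₀, A₀, hA0c, h0⟩ := exists_local_profile hl hL hp1
  set a := δ / 2 with ha
  have hamem : a ∈ Ioo (-δ) δ := ⟨by linarith, by linarith⟩
  have ha0 : 0 < a := by linarith
  obtain ⟨-, -, ua, ua2, wa, wa2, -⟩ := h0 a hamem
  obtain ⟨U₁, W₁, σ, hσ, eU, eW, hzero, hpos, h1⟩ :=
    exists_profile_continuation hl hL hp ha0 ua ua2 wa wa2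
  set m : ℝ → ℝ → ℝ := fun u w => min (u ^ p / Lam) (u ^ p / lam - (Lam / lam - 1) * w) with hm
  set U : ℝ → ℝ := fun s => if s ≤ a then U₀ s else U₁ s with hU
  set W : ℝ → ℝ := fun s => if s ≤ a then W₀ s else W₁ s with hW
  set A : ℝ → ℝ := fun s => if s ≤ a then A₀ s else (-W₁ s + m (U₁ s) (W₁ s) / 2) / s with hA
  have hAa : A₀ a = (-W₁ a + m (U₁ a) (W₁ a) / 2) / a := by
    rw [eq_div_iff ha0.ne', mul_comm, eU, eW]
    exact (h0 a hamem).2.2.2.2.2.2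
  have hWa : ∀ s, a ≤ s → W s = W₁ s := fun s hs => by
    rcases eq_or_lt_of_le hs with h | h
    · rw [hW, ← h, eW]; exact if_pos le_rfl
    · exact if_neg (not_le.2 h)
  have hUa : ∀ s, a ≤ s → U s = U₁ s := fun s hs => by
    rcases eq_or_lt_of_le hs with h | h
    · rw [hU, ← h, eU]; exact if_pos le_rfl
    · exact if_neg (not_le.2 h)
  have hAa' : ∀ s, a ≤ s → A s = (-W₁ s + m (U₁ s) (W₁ s) / 2) / s := fun s hs => by
    rcases eq_or_lt_of_le hs with h | h
    · rw [hA, ← h, ← hAa]; exact if_pos le_rfl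
    · exact if_neg (not_le.2 h)
  have hUl : ∀ s, s ≤ a → U s = U₀ s := fun s hs => if_pos hs
  have hWl : ∀ s, s ≤ a → W s = W₀ s := fun s hs => if_pos hs
  have hAl : ∀ s, s ≤ a → A s = A₀ s := fun s hs => if_pos hs
  have hUd : ∀ s ∈ Ioc (-δ) σ, HasDerivAt U (-W s / 2) s := fun s hs =>
    hasDerivAt_ite_le (fun h => by rw [hWl s h]; exact (h0 s ⟨hs.1, by linarith⟩).1)
      (fun h => by rw [hWa s h]; exact (h1 s ⟨h, hs.2⟩).2.1) eU.symm
  have hall : ∀ s ∈ Ioo (-δ) σ, HasDerivAt U (-W s / 2) s ∧ HasDerivAt W (A s) s ∧ 0 < U s ∧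
      0 ≤ W s ∧ s * A s = -W s + m (U s) (W s) / 2 := by
    intro s hs
    refine ⟨hUd s ⟨hs.1, hs.2.le⟩, hasDerivAt_ite_le (fun h => ?_) (fun h => ?_) eW.symm, ?_⟩
    · rw [hAl s h]; exact (h0 s ⟨hs.1, by linarith⟩).2.1
    · rw [hAa' s h]; exact (h1 s ⟨h, hs.2.le⟩).2.2
    rcases le_total s a with h | h
    · rw [hUl s h, hWl s h, hAl s h]
      have := h0 s ⟨hs.1, by linarith⟩
      exact ⟨this.2.2.1, this.2.2.2.2.1, this.2.2.2.2.2.2⟩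
    · rw [hUa s h, hWa s h, hAa' s h]
      refine ⟨hpos s ⟨h, hs.2⟩, (h1 s ⟨h, hs.2.le⟩).1, ?_⟩
      have : s ≠ 0 := (ha0.trans_le h).ne'
      field_simp
  refine ⟨δ, hδ, σ, ha0.trans hσ, U, W, A, hall, fun s hs => ContinuousAt.continuousWithinAt ?_,
    (hUd σ ⟨by linarith, le_rfl⟩).continuousAt, by rw [hUa σ hσ.le, hzero]⟩
  -- For `s > 0` the equation, divided by `s`, expresses `A` through continuous functions, also at
  -- the junction `a`; near `s ≤ 0` only the local profile is involved.
  rcases lt_or_ge 0 s with h | h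
  · have hc : ContinuousAt (fun s => (-W s + m (U s) (W s) / 2) / s) s := by
      obtain ⟨c1, c2, c3, -⟩ := hall s hs
      have k1 := c1.continuousAt
      have k2 := c2.continuousAt
      have k3 : ContinuousAt (fun s => U s ^ p) s := k1.rpow_const (Or.inl c3.ne')
      exact (k2.neg.add (((k3.div_const Lam).min ((k3.div_const lam).sub
        (continuousAt_const.mul k2))).div_const 2)).div continuousAt_id h.ne'
    refine hc.congr ?_
    filter_upwards [Ioo_mem_nhds hs.1 hs.2, lt_mem_nhds h] with t ht ht0
    rw [div_eq_iff (ne_of_gt ht0), ← (hall t ht).2.2.2.2, mul_comm]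
  · have hmem : Ioo (-δ) δ ∈ 𝓝 s := Ioo_mem_nhds hs.1 (by linarith)
    refine (hA0c.continuousAt hmem).congr ?_
    filter_upwards [gt_mem_nhds (h.trans_lt ha0)] with t ht
    exact (hAl t (le_of_lt ht)).symm

/-- Existence of a solution for the exponent with `(p - 1) * N = 1`, in every ball. -/
theorem exists_isBallSolution {lam Lam p R : ℝ} (hl : 0 < lam) (hL : lam < Lam)
    (hp : (p - 1) * (Lam / lam - 1) = 1) (hR : 0 < R) :
    ∃ u : Plane → ℝ, IsBallSolution lam Lam p R u := by
  have hN : 0 < Lam / lam - 1 := by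
    have : 1 < Lam / lam := by rwa [lt_div_iff₀ hl, one_mul]
    linarith
  have hp1 : p - 1 ≠ 0 := by
    intro h
    rw [h, zero_mul] at hp
    exact zero_ne_one hp
  obtain ⟨δ, hδ, σ, hσ, U, W, W₁, hall, hc, hend, hzero⟩ := exists_radial_profile hl hL hp
  set k := σ / R ^ 2 with hk
  have hk0 : 0 < k := by positivity
  have hkR : k * R ^ 2 = σ := by rw [hk]; field_simp
  -- The amplitude with `κ^(p-1) = k`: then `κ U(k r²)` solves the same equation, and `k` places its
  -- zero at `r = R`.
  set κ := k ^ (1 / (p - 1)) with hκ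
  have hκ0 : 0 < κ := Real.rpow_pos_of_pos hk0 _
  have hκp : κ ^ p = κ * k := by
    have h1 : κ ^ (p - 1) = k := by
      rw [hκ, ← Real.rpow_mul hk0.le, one_div, inv_mul_cancel₀ hp1, Real.rpow_one]
    rw [← h1, mul_comm, ← Real.rpow_add_one hκ0.ne', sub_add_cancel]
  set O : Set ℝ := {s | k * s ∈ Ioo (-δ) σ} with hO
  have hOo : IsOpen O := isOpen_Ioo.preimage (continuous_const.mul continuous_id)
  have hlin : ∀ s : ℝ, HasDerivAt (fun s => k * s) k s := fun s => by
    simpa using (hasDerivAt_id s).const_mul k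
  set H : ℝ → ℝ := fun s => κ * U (k * s) with hH
  set H₁ : ℝ → ℝ := fun s => κ * (-W (k * s) / 2 * k) with hH₁
  set H₂ : ℝ → ℝ := fun s => κ * (-(W₁ (k * s) * k) / 2 * k) with hH₂
  have hHd : ∀ s ∈ O, HasDerivAt H (H₁ s) s := fun s hs =>
    ((hall _ hs).1.comp s (hlin s)).const_mul κ
  have hH1d : ∀ s ∈ O, HasDerivAt H₁ (H₂ s) s := fun s hs =>
    ((((hall _ hs).2.1.comp s (hlin s)).neg.div_const 2).mul_const k).const_mul κ
  have hH2c : ContinuousOn H₂ O := by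
    have : ContinuousOn (fun s => W₁ (k * s)) O :=
      hc.comp (continuous_const.mul continuous_id).continuousOn fun s hs => hs
    exact continuousOn_const.mul
      (((this.mul continuousOn_const).neg.div_const 2).mul continuousOn_const)
  have hHC := contDiffOn_two_of_hasDerivAt hOo hHd hH1d hH2c
  have hmem : ∀ x : Plane, ‖x‖ < R → ‖x‖ ^ 2 ∈ O := fun x hx => by
    have h1 : ‖x‖ ^ 2 < R ^ 2 := pow_lt_pow_left₀ hx (norm_nonneg _) two_ne_zero
    have h2 : 0 ≤ k * ‖x‖ ^ 2 := by positivity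
    refine ⟨by linarith, ?_⟩
    rw [← hkR]; exact mul_lt_mul_of_pos_left h1 hk0
  refine ⟨fun x => H (‖x‖ ^ 2), ?_, ?_, ?_, ?_, ?_⟩
  · exact hHC.comp (contDiff_norm_sq ℝ).contDiffOn fun x hx => hmem x (mem_ball_zero_iff.1 hx)
  · intro x hx
    refine ContinuousAt.continuousWithinAt ?_
    have hn : ContinuousAt (fun x : Plane => ‖x‖ ^ 2) x := by fun_prop
    refine ContinuousAt.comp (f := fun x : Plane => ‖x‖ ^ 2) (g := H) ?_ hn
    rcases eq_or_lt_of_le (mem_closedBall_zero_iff.1 hx) with h | h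
    · have hU : ContinuousAt U (k * ‖x‖ ^ 2) := by rw [h, hkR]; exact hend
      exact continuousAt_const.mul (ContinuousAt.comp (f := fun s => k * s) hU
        (continuous_const.mul continuous_id).continuousAt)
    · exact (hHd _ (hmem x h)).continuousAt
  · intro x hx
    have hs := hmem x (mem_ball_zero_iff.1 hx)
    have hh := HasHessAt.of_normSq (x := x) (0 : Plane) (k := H) (k₁ := H₁)
      (k₂ := H₂ (‖x‖ ^ 2)) (by
        rw [sub_zero]
        filter_upwards [hOo.mem_nhds hs] with s hs using hHd s hs)
      (by rw [sub_zero]; exact hH1d _ hs)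
    simp only [sub_zero] at hh
    rw [hh.pucciMinus_hessian, pucciForm_rankOne]
    obtain ⟨-, -, hU0, hW0, hrel⟩ := hall _ hs
    set s := ‖x‖ ^ 2
    -- The tangential eigenvalue is `-κ k W`, and `v'` is chosen so that `v - v'` is the radial one.
    have key := (pucciWeight_sub_eq_iff (lam := lam) (Lam := Lam) (v := κ * k * W (k * s))
      (v' := κ * k * min (U (k * s) ^ p / Lam) (U (k * s) ^ p / lam - (Lam / lam - 1) * W (k * s)))
      (F := H s ^ p) hl hL (by positivity)).2 (by
        rw [mul_min_of_nonneg _ _ (by positivity), hH]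
        dsimp only
        rw [Real.mul_rpow hκ0.le hU0.le, hκp]
        congr 1 <;> ring)
    have e1 : 4 * H₂ s * s + 2 * H₁ s = κ * k * W (k * s) - κ * k *
        min (U (k * s) ^ p / Lam) (U (k * s) ^ p / lam - (Lam / lam - 1) * W (k * s)) := by
      rw [hH₂, hH₁]
      dsimp only
      linear_combination (-2 * κ * k) * hrel
    have e2 : 2 * H₁ s = -(κ * k * W (k * s)) := by rw [hH₁]; dsimp only; ring
    rw [e1, e2, key, neg_neg]
  · intro x hx
    exact mul_pos hκ0 (hall _ (hmem x (mem_ball_zero_iff.1 hx))).2.2.1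
  · intro x hx
    rw [mem_sphere_zero_iff_norm.1 hx, hH]
    dsimp only
    rw [hkR, hzero, mul_zero]

end PucciLaneEmden
end

/-! ### Conclusion. -/

noncomputable section
namespace PucciLaneEmden
open Filter Topology Set

/-- Being above the infimum puts `p` above some element of `noPeriodicSet`, which yields both
supercriticality and the absence of periodic orbits at `p` itself. -/
theorem not_isBallSolution_of_pTilde_lt {lam Lam p R : ℝ} (hl : 0 < lam) (hL : lam < Lam)
    (hR : 0 < R) (hp : pTilde lam Lam < p) : ¬ ∃ u : Plane → ℝ, IsBallSolution lam Lam p R u := by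
  rintro ⟨u, hu⟩
  obtain ⟨q, ⟨hq1, hq2⟩, hqp⟩ := exists_lt_of_csInf_lt (noPeriodicSet_nonempty hl hL) hp
  have hN : 0 < Lam / lam - 1 := by
    have : 1 < Lam / lam := by rwa [lt_div_iff₀ hl, one_mul]
    linarith
  refine hq2 p hqp (hu.hasPeriodicOrbit hl hL ?_ hR)
  have e : (Lam / lam - 1 + 4) / (Lam / lam - 1) =
      (dimMinus lam Lam + 2) / (dimMinus lam Lam - 2) := by
    unfold dimMinus; congr 1 <;> ring
  rw [e]
  exact hq1.trans hqp

theorem solvableSet_nonempty {lam Lam R : ℝ} (hl : 0 < lam) (hL : lam < Lam) (hR : 0 < R) :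
    (solvableSet lam Lam R).Nonempty := by
  have hN : 0 < Lam / lam - 1 := by
    have : 1 < Lam / lam := by rwa [lt_div_iff₀ hl, one_mul]
    linarith
  -- The exponent for which `(p - 1) N = 1`.
  refine ⟨1 + 1 / (Lam / lam - 1), by simpa using hN, exists_isBallSolution hl hL ?_ hR⟩
  rw [add_sub_cancel_left]
  exact one_div_mul_cancel hN.ne'

end PucciLaneEmden
end

theorem theorem3p5 (lam Lam : ℝ) (hlam : 0 < lam) (hLam : lam < Lam) :
    (PucciLaneEmden.noPeriodicSet lam Lam).Nonempty ∧
    ∀ R : ℝ, 0 < R →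
      (∀ p : ℝ, PucciLaneEmden.pTilde lam Lam < p →
        ¬ ∃ u : PucciLaneEmden.Plane → ℝ, PucciLaneEmden.IsBallSolution lam Lam p R u) ∧
      (PucciLaneEmden.solvableSet lam Lam R).Nonempty ∧
      BddAbove (PucciLaneEmden.solvableSet lam Lam R) ∧
      PucciLaneEmden.criticalExponent lam Lam R ≤ PucciLaneEmden.pTilde lam Lam := by
  have hno : ∀ R : ℝ, 0 < R → ∀ p : ℝ, PucciLaneEmden.pTilde lam Lam < p →
      ¬ ∃ u : PucciLaneEmden.Plane → ℝ, PucciLaneEmden.IsBallSolution lam Lam p R u :=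
    fun R hR p hp => PucciLaneEmden.not_isBallSolution_of_pTilde_lt hlam hLam hR hp
  have hle : ∀ R : ℝ, 0 < R → ∀ p ∈ PucciLaneEmden.solvableSet lam Lam R,
      p ≤ PucciLaneEmden.pTilde lam Lam :=
    fun R hR p hp => not_lt.1 fun h => hno R hR p h hp.2
  exact ⟨PucciLaneEmden.noPeriodicSet_nonempty hlam hLam, fun R hR => ⟨hno R hR,
    PucciLaneEmden.solvableSet_nonempty hlam hLam hR, ⟨_, hle R hR⟩,
    csSup_le (PucciLaneEmden.solvableSet_nonempty hlam hLam hR) (hle R hR)⟩⟩
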